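/- Let $\Pi$ be a Poisson point process of intensity $1$ in $\mathbb{R}^2$. The Voronoi cell of $x\in\Pi$ is the set of points of the plane to which no point of $\Pi$ is closer than $x$. Let $\mathbb{T}$ be the Voronoi (Delaunay) triangulation of $\Pi$: the graph with vertex set $\Pi$ in which two distinct points are joined if their Voronoi cells share a common edge. For an integer $n\ge 1$ let $B(o,n)$ be the set of vertices at graph distance at most $n$ in $\mathbb{T}$ from $o$, the point of $\Pi$ closest to the origin (almost surely unique). A set $A$ of vertices is connected if the subgraph of $\mathbb{T}$ induced by $A$ is connected. For $A\subset B(o,n)$ let $\partial_V(A)$ be the set of vertices of $A$ with some neighbour in $\mathbb{T}$ outside $A$, and let $\partial_{\mathsf{int}}(A)$ be the set of vertices of $\partial_V(A)$ with at least one neighbour in $B(o,n)\setminus A$. There exist constants $\varepsilon_1>0$ and $c'>0$ such that for every $\alpha\in(0,2)$ there is a constant $c=c(\alpha)>0$ for which the following holds. For all integers $n\ge 1$ and $k$ with $n^{\alpha}\le k\le \tfrac12 n^2$, the probability that there exists a connected set $A\subset B(o,n)$ with exactly $k$ vertices and $|\partial_{\mathsf{int}}(A)|\le \varepsilon_1\sqrt{k}$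 is at most $c\,e^{-c'\sqrt{k}}$. -/

import Mathlib

open MeasureTheory ProbabilityTheory

/-- The Euclidean plane. -/
abbrev Plane : Type := EuclideanSpace ℝ (Fin 2)

/-- The random set `Pts` of points of the plane is a Poisson point process of intensity one with
respect to the probability measure `μ`: the numbers of points in Borel sets are random variables,
the number of points in a Borel set of finite area is Poisson distributed with that area as its
parameter, and the numbers of points in pairwise disjoint Borel sets are independent. -/
structure IsUnitPoissonProcess {Ω : Type*} [MeasurableSpace Ω] (μ : Measure Ω)
    (Pts : Ω → Set Plane) : Prop where
  measurable_count : ∀ B : Set Plane, MeasurableSet B →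
    Measurable (fun ω => (Pts ω ∩ B).encard)
  count_law : ∀ B : Set Plane, MeasurableSet B → volume B ≠ ⊤ →
    μ.map (fun ω => (Pts ω ∩ B).encard) =
      (poissonMeasure (volume B).toNNReal).map (fun j : ℕ => (j : ℕ∞))
  indep_count : ∀ (m : ℕ) (B : Fin m → Set Plane), (∀ i, MeasurableSet (B i)) →
    (∀ i j, i ≠ j → Disjoint (B i) (B j)) →
    iIndepFun (fun i ω => (Pts ω ∩ B i).encard) μ

/-- The (closed) Voronoi cell of `x` with respect to the point set `P`: the points of the plane
to which no point of `P` is closer than `x`. -/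
def voronoiCell (P : Set Plane) (x : Plane) : Set Plane :=
  {z | ∀ y ∈ P, dist z x ≤ dist z y}

/-- The Voronoi (Delaunay) triangulation of `P`: two distinct points of `P` are joined if their
Voronoi cells share a common edge. The intersection of the two cells is a convex subset of the
bisecting line of the two points, so it is a common edge exactly if it has more than one point. -/
def voronoiGraph (P : Set Plane) : SimpleGraph P where
  Adj x y := x ≠ y ∧ (voronoiCell P x ∩ voronoiCell P y).Nontrivial
  symm := ⟨fun x y h => ⟨h.1.symm, by rw [Set.inter_comm]; exact h.2⟩⟩
  loopless := ⟨fun _ h => h.1 rfl⟩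

/-- The ball of radius `n` around the vertex `o` in the graph distance. -/
def graphBall {V : Type*} (G : SimpleGraph V) (o : V) (n : ℕ) : Set V :=
  {v | G.edist o v ≤ n}

/-- The vertex boundary of `A`: the vertices of `A` with some neighbour outside `A`. -/
def vertexBoundary {V : Type*} (G : SimpleGraph V) (A : Set V) : Set V :=
  {v | v ∈ A ∧ ∃ w, w ∉ A ∧ G.Adj v w}

/-- The interior boundary of `A` relative to `B`: the vertices in the vertex boundary of `A` with
at least one neighbour in `B \ A`. -/
def interiorBoundary {V : Type*} (G : SimpleGraph V) (B A : Set V) : Set V :=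
  {v | v ∈ vertexBoundary G A ∧ ∃ w ∈ B \ A, G.Adj v w}

/-- The point configuration `P` has a connected set `A` of exactly `k` vertices, contained in the
graph distance ball of radius `n` around a point `o` of `P` closest to the origin, whose interior
boundary relative to this ball has at most `ε * √k` vertices. -/
def HasBadSet (ε : ℝ) (n k : ℕ) (P : Set Plane) : Prop :=
  ∃ o : P, (∀ y ∈ P, dist (0 : Plane) o ≤ dist (0 : Plane) y) ∧
    ∃ A : Finset P, (A : Set P) ⊆ graphBall (voronoiGraph P) o n ∧
      ((voronoiGraph P).induce (A : Set P)).Connected ∧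
      A.card = k ∧
      ((interiorBoundary (voronoiGraph P) (graphBall (voronoiGraph P) o n) A).ncard : ℝ)
        ≤ ε * √(k : ℝ)

/-! Cut the plane into boxes of a large side `a` and call a box good if all boxes near it are
occupied and none is overcrowded. A Peierls argument (`sum_rooted_le`,
`measure_not_peierlsBound_le`) shows that, off an event of probability at most `e^(1-t)` with `t =
κ√k`, every connected set of boxes of at least logarithmic size, and every union of components with
at least that average size, has few bad boxes: at most an eighth of its boxes, plus `t`. On this
event the isoperimetric part of the proof is deterministic.

Let `D` be the interior boundary of `A`, with `|D| ≤ ε√k`. The clusters of boxes that are bad or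
close to `D`, and that contain a box close to `D`, form a barrier. Its holes are filled and it
splits into pockets. Because the lattice is simply connected, each pocket is surrounded by a
connected ring of good boxes away from `D`. The cells near this ring form the rim: a connected set
of vertices outside `D`, at most proportional in number to the perimeter of the pocket. Follow a
geodesic from a vertex `v` of the ball to `o`. Between unshielded vertices it cannot change sides of
`A`. If it meets a pocket after at least as many steps as the rim has vertices, the whole rim lies
in `B(o,n)`, since the steps already made pay for the way round; hence the rim lies on one side of
`A`, and the side of `v` is carried across the pocket. So all vertices of the ball are on the same
side, except those that meet a pocket too early, the lost ones (`mem_iff_of_not_lost`).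

The vertices lost through one pocket lie within a distance comparable to the size of a connected set
of boxes that are mostly bad or close to `D`. After a Vitali selection the sizes of the large sets
add up to `O(|D| + t)`, so that they account for `O((|D| + t)²)` lost vertices, up to a term `O(|D|
t)`; the sets of logarithmic size contribute `O(|D| (log² n + t))`, and `k ≥ n^α` makes the
logarithms harmless. Altogether fewer than `k/1000` vertices are lost (`card_lost_le`).

Consequently `A` cannot consist of lost vertices only, so the vertices of the ball outside `A` are
all lost, and the ball has at most `1.001 k ≤ 0.5005 n²` vertices. But it has at least `0.501 n²`.
Indeed the disc of radius `2n/5` has area `0.16 π n² > 0.502 n²`, and a segment of length `ℓ` from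
the origin crosses at most about `2.43 ℓ` cells, where `2.43 · 2/5 < 1` (`exists_crossSum_bound`,
`Coarse.edist_le_of_norm_le`). The number `2.43` comes from the remark that a cell reaching an axis
from height `h` leaves a half disc of radius about `h` empty, on one side or the other; pieces of
the axis that are far apart are independent, and a Chernoff bound applies. -/

/-! ### Chains of related points. -/

/-- Two points of `S` are joined in `S` if they are linked by a chain of `r`-related points
of `S`. -/
def Linked {α : Type*} (r : α → α → Prop) (S : Set α) : α → α → Prop :=
  Relation.ReflTransGen (fun u v => u ∈ S ∧ v ∈ S ∧ r u v)

namespace Linked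

variable {α : Type*} {r : α → α → Prop} {S T : Set α} {x y z : α}

theorem refl (x : α) : Linked r S x x := Relation.ReflTransGen.refl

theorem trans (h₁ : Linked r S x y) (h₂ : Linked r S y z) : Linked r S x z :=
  Relation.ReflTransGen.trans h₁ h₂

theorem single (hx : x ∈ S) (hy : y ∈ S) (h : r x y) : Linked r S x y :=
  Relation.ReflTransGen.single ⟨hx, hy, h⟩

theorem symm (hr : ∀ u v, r u v → r v u) (h : Linked r S x y) : Linked r S y x := by
  induction h with
  | refl => exact refl _
  | tail _ h ih => exact (single h.2.1 h.1 (hr _ _ h.2.2)).trans ih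

theorem mono (hST : S ⊆ T) (h : Linked r S x y) : Linked r T x y :=
  Relation.ReflTransGen.mono (fun _ _ h => ⟨hST h.1, hST h.2.1, h.2.2⟩) _ _ h

theorem mem (h : Linked r S x y) (hx : x ∈ S) : y ∈ S := by
  induction h with
  | refl => exact hx
  | tail _ h _ => exact h.2.1

/-- A predicate that is passed on along related points of `S` is passed on along chains. -/
theorem induct {p : α → Prop} (hp : ∀ u v, u ∈ S → v ∈ S → r u v → p u → p v)
    (h : Linked r S x y) (hx : p x) : p y := by
  induction h with
  | refl => exact hx
  | tail _ h ih => exact hp _ _ h.1 h.2.1 h.2.2 ih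

/-- A chain from a point with `p` to a point without `p` has a step that loses `p`. -/
theorem exists_step {p : α → Prop} (h : Linked r S x y) (hx : p x) (hy : ¬ p y) :
    ∃ u v, u ∈ S ∧ v ∈ S ∧ r u v ∧ p u ∧ ¬ p v := by
  by_contra! hcon
  exact hy (h.induct (fun u v hu hv huv hpu => hcon u v hu hv huv hpu) hx)

/-- A chain stays in the set of points joined to its origin. -/
theorem self_set (h : Linked r S x y) : Linked r {z | Linked r S x z} x y := by
  induction h with
  | refl => exact refl _
  | tail h₁ h ih =>
    exact ih.trans (single h₁ (Relation.ReflTransGen.tail h₁ h) h.2.2)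

end Linked

/-! ### The square lattice with king moves. -/

/-- Two lattice points have coordinates that differ by at most `k`. -/
def Near (k : ℤ) (u v : ℤ × ℤ) : Prop :=
  -k ≤ u.1 - v.1 ∧ u.1 - v.1 ≤ k ∧ -k ≤ u.2 - v.2 ∧ u.2 - v.2 ≤ k

/-- King moves on the square lattice (staying put included). -/
abbrev Nbr : ℤ × ℤ → ℤ × ℤ → Prop := Near 1

theorem Near.symm {k : ℤ} {u v : ℤ × ℤ} (h : Near k u v) : Near k v u := by
  unfold Near at *; omega

theorem Near.rfl {k : ℤ} (hk : 0 ≤ k) {u : ℤ × ℤ} : Near k u u := by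
  unfold Near at *; omega

theorem Near.trans {k l : ℤ} {u v w : ℤ × ℤ} (h : Near k u v) (h' : Near l v w) :
    Near (k + l) u w := by
  unfold Near at *; omega

theorem Near.mono {k l : ℤ} (hkl : k ≤ l) {u v : ℤ × ℤ} (h : Near k u v) : Near l u v := by
  unfold Near at *; omega

theorem nbr_symm : ∀ u v, Nbr u v → Nbr v u := fun _ _ h => Near.symm h

/-- The square of radius `k` around `c`. -/
noncomputable def latSq (c : ℤ × ℤ) (k : ℤ) : Finset (ℤ × ℤ) :=
  Finset.Icc (c.1 - k) (c.1 + k) ×ˢ Finset.Icc (c.2 - k) (c.2 + k)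

theorem mem_latSq {c z : ℤ × ℤ} {k : ℤ} : z ∈ latSq c k ↔ Near k z c := by
  unfold latSq Near
  rw [Finset.mem_product, Finset.mem_Icc, Finset.mem_Icc]
  omega

theorem card_latSq (c : ℤ × ℤ) {k : ℤ} (hk : 0 ≤ k) : ((latSq c k).card : ℤ) = (2 * k + 1) ^ 2 := by
  unfold latSq
  rw [Finset.card_product, Int.card_Icc, Int.card_Icc]
  push_cast
  rw [Int.toNat_of_nonneg (by omega), Int.toNat_of_nonneg (by omega)]
  ring

/-- Points of a square can be linked by a chain inside any set that contains the square. -/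
theorem linked_of_near {S : Set (ℤ × ℤ)} {c : ℤ × ℤ} {k : ℤ} (hS : ∀ z, Near k z c → z ∈ S)
    {x : ℤ × ℤ} (hx : Near k x c) : Linked Nbr S c x := by
  have key : ∀ m : ℕ, ∀ x : ℤ × ℤ, Near k x c → Near m x c → Linked Nbr S c x := by
    intro m
    induction m with
    | zero =>
      intro x _ h0
      have : x = c := by unfold Near at h0; ext <;> push_cast at h0 <;> omega
      rw [this]; exact Linked.refl _
    | succ m ih =>
      intro x hx hm
      -- One king move from `x` towards `c`; it shrinks each nonzero coordinate difference by one.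
      obtain ⟨y, hy⟩ : ∃ y : ℤ × ℤ, y = (x.1 + (c.1 - x.1).sign, x.2 + (c.2 - x.2).sign) := ⟨_, rfl⟩
      have s1 := Int.sign_trichotomy (c.1 - x.1)
      have s2 := Int.sign_trichotomy (c.2 - x.2)
      have p1 := @Int.sign_eq_one_iff_pos (c.1 - x.1)
      have p2 := @Int.sign_eq_one_iff_pos (c.2 - x.2)
      have n1 := @Int.sign_eq_neg_one_iff_neg (c.1 - x.1)
      have n2 := @Int.sign_eq_neg_one_iff_neg (c.2 - x.2)
      have z1 := @Int.sign_eq_zero_iff_zero (c.1 - x.1)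
      have z2 := @Int.sign_eq_zero_iff_zero (c.2 - x.2)
      have h1 : y.1 = x.1 + (c.1 - x.1).sign := by rw [hy]
      have h2 : y.2 = x.2 + (c.2 - x.2).sign := by rw [hy]
      have hyk : Near k y c := by unfold Near at *; omega
      have hym : Near m y c := by unfold Near at *; push_cast at hm; omega
      have hxy : Nbr y x := by unfold Nbr Near at *; omega
      exact (ih y hyk hym).trans (Linked.single (hS _ hyk) (hS _ hx) hxy)
  obtain ⟨m, hm⟩ := Int.eq_ofNat_of_zero_le (show 0 ≤ k by unfold Near at hx; omega)
  exact key m x hx (hm ▸ hx)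

/-- A finset in which `c` and `x` are joined has more elements than their distance. -/
theorem card_of_linked {F : Finset (ℤ × ℤ)} {c x : ℤ × ℤ} (hc : c ∈ F)
    (h : Linked Nbr (F : Set (ℤ × ℤ)) c x) : Near ((F.card : ℤ) - 1) x c := by
  -- A function that grows by at most one per move takes every intermediate value along the chain.
  -- It is applied to both coordinates with both signs.
  have key : ∀ (g : ℤ × ℤ → ℤ), (∀ u v, Nbr u v → g v ≤ g u + 1) → g x - g c ≤ F.card - 1 := by
    intro g hg
    have hsub : Finset.Icc (g c) (g x) ⊆ F.image g := by
      intro i hi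
      rw [Finset.mem_Icc] at hi
      rw [Finset.mem_image]
      by_cases hix : i = g x
      · exact ⟨x, h.mem hc, hix.symm⟩
      · obtain ⟨u, v, hu, -, huv, h1, h2⟩ := h.exists_step (p := fun z => g z ≤ i) hi.1
          (by omega)
        have := hg u v huv
        exact ⟨u, hu, by omega⟩
    have h1 := (Finset.card_le_card hsub).trans Finset.card_image_le
    rw [Int.card_Icc] at h1
    have : 0 < F.card := Finset.card_pos.2 ⟨c, hc⟩
    omega
  have h1 := key (fun z => z.1) (by intro u v huv; unfold Nbr Near at huv; omega)
  have h2 := key (fun z => -z.1) (by intro u v huv; unfold Nbr Near at huv; omega)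
  have h3 := key (fun z => z.2) (by intro u v huv; unfold Nbr Near at huv; omega)
  have h4 := key (fun z => -z.2) (by intro u v huv; unfold Nbr Near at huv; omega)
  unfold Near
  omega

/-- The `k`-neighbourhood of a finset. -/
noncomputable def thick (k : ℤ) (F : Finset (ℤ × ℤ)) : Finset (ℤ × ℤ) := F.biUnion fun c => latSq c k

theorem mem_thick {k : ℤ} {F : Finset (ℤ × ℤ)} {z : ℤ × ℤ} :
    z ∈ thick k F ↔ ∃ c ∈ F, Near k z c := by
  simp only [thick, Finset.mem_biUnion, mem_latSq]

theorem subset_thick {k : ℤ} (hk : 0 ≤ k) (F : Finset (ℤ × ℤ)) : F ⊆ thick k F := fun z hz =>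
  mem_thick.2 ⟨z, hz, Near.rfl hk⟩

theorem card_thick_le {k : ℤ} (hk : 0 ≤ k) (F : Finset (ℤ × ℤ)) :
    ((thick k F).card : ℤ) ≤ (2 * k + 1) ^ 2 * F.card := by
  have h : (thick k F).card ≤ ∑ c ∈ F, (latSq c k).card := Finset.card_biUnion_le
  calc ((thick k F).card : ℤ) ≤ ((∑ c ∈ F, (latSq c k).card : ℕ) : ℤ) := by exact_mod_cast h
    _ = ∑ c ∈ F, ((latSq c k).card : ℤ) := by push_cast; rfl
    _ = (2 * k + 1) ^ 2 * F.card := by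
      rw [Finset.sum_congr rfl fun c _ => card_latSq c hk, Finset.sum_const]
      simp only [nsmul_eq_mul]; ring

/-! ### Counting rooted sets. -/

/-- The finset `F` is rooted at `r`: each point of `F` is joined in `F` to a point of `r`. -/
def Rooted (r F : Finset (ℤ × ℤ)) : Prop :=
  r ⊆ F ∧ ∀ z ∈ F, ∃ y ∈ r, Linked Nbr (F : Set (ℤ × ℤ)) y z

theorem Rooted.thick {r F : Finset (ℤ × ℤ)} (h : Rooted r F) {k : ℤ} (hk : 0 ≤ k) :
    Rooted r (thick k F) := by
  refine ⟨h.1.trans (subset_thick hk F), fun z hz => ?_⟩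
  obtain ⟨c, hc, hzc⟩ := mem_thick.1 hz
  obtain ⟨y, hy, hyc⟩ := h.2 c hc
  refine ⟨y, hy, (hyc.mono (Finset.coe_subset.2 (subset_thick hk F))).trans ?_⟩
  exact linked_of_near (fun w hw => Finset.mem_coe.2 (mem_thick.2 ⟨c, hc, hw⟩)) hzc

/-- Exploration bound: the rooted sets of a given root set have total weight at most one if every
point weighs `1/512`. -/
theorem sum_rooted_le (r : Finset (ℤ × ℤ)) (𝓕 : Finset (Finset (ℤ × ℤ)))
    (h𝓕 : ∀ F ∈ 𝓕, Rooted r F) : ∑ F ∈ 𝓕, ((1 : ℝ) / 512) ^ F.card ≤ 1 := by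
  classical
  set Λ : Finset (ℤ × ℤ) := 𝓕.biUnion (thick 1) with hΛ
  have hsub : ∀ F ∈ 𝓕, thick 1 F ⊆ Λ := fun F hF => Finset.subset_biUnion_of_mem (thick 1) hF
  have hF : ∀ F, F ⊆ thick 1 F := fun F => subset_thick (by norm_num) F
  -- View the subsets of `Λ` as percolation configurations with density `1/2`. The cylinder of `F`
  -- is the event that the cluster of the roots is exactly `F`: all of `F` is open and the rest of
  -- its neighbourhood is closed.
  let cyl : Finset (ℤ × ℤ) → Finset (Finset (ℤ × ℤ)) := fun F =>
    (Λ \ thick 1 F).powerset.image fun ω => F ∪ ω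
  have hcard : ∀ F ∈ 𝓕, (cyl F).card = 2 ^ (Λ.card - (thick 1 F).card) := by
    intro F hFF
    rw [Finset.card_image_of_injOn, Finset.card_powerset, Finset.card_sdiff_of_subset (hsub F hFF)]
    intro ω hω ω' hω' he
    have hω := Finset.mem_powerset.1 hω
    have hω' := Finset.mem_powerset.1 hω'
    dsimp only at he
    ext z
    constructor
    · intro hz
      have h1 := Finset.mem_sdiff.1 (hω hz)
      have : z ∈ F ∪ ω' := he ▸ Finset.mem_union_right _ hz
      exact (Finset.mem_union.1 this).resolve_left fun h => h1.2 (hF F h)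
    · intro hz
      have h1 := Finset.mem_sdiff.1 (hω' hz)
      have : z ∈ F ∪ ω := he.symm ▸ Finset.mem_union_right _ hz
      exact (Finset.mem_union.1 this).resolve_left fun h => h1.2 (hF F h)
  have hmem : ∀ F ∈ 𝓕, ∀ ω ∈ cyl F, F ⊆ ω ∧ ∀ z ∈ ω, z ∈ thick 1 F → z ∈ F := by
    intro F _ ω hω
    obtain ⟨ω', hω', rfl⟩ := Finset.mem_image.1 hω
    refine ⟨Finset.subset_union_left, fun z hz hz' => ?_⟩
    exact (Finset.mem_union.1 hz).resolve_right fun h =>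
      (Finset.mem_sdiff.1 (Finset.mem_powerset.1 hω' h)).2 hz'
  -- In a common configuration, exploring `F` from the roots can never leave `F'`, because the sites
  -- next to `F'` are closed. So distinct cylinders are disjoint.
  have hle : ∀ F ∈ 𝓕, ∀ F' ∈ 𝓕, ∀ ω, ω ∈ cyl F → ω ∈ cyl F' → F ⊆ F' := by
    intro F hF1 F' hF2 ω h1 h2 z hz
    obtain ⟨y, hy, hyz⟩ := (h𝓕 F hF1).2 z hz
    refine hyz.induct (p := fun z => z ∈ F') ?_ ((h𝓕 F' hF2).1 hy)
    intro u v _ hv huv hu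
    exact (hmem F' hF2 ω h2).2 v ((hmem F hF1 ω h1).1 hv) (mem_thick.2 ⟨u, hu, huv.symm⟩)
  have hdisj : (𝓕 : Set (Finset (ℤ × ℤ))).PairwiseDisjoint cyl := by
    intro F h1 F' h2 hne
    rw [Function.onFun, Finset.disjoint_left]
    intro ω hω hω'
    exact hne ((hle F h1 F' h2 ω hω hω').antisymm (hle F' h2 F h1 ω hω' hω))
  have htot : ∑ F ∈ 𝓕, (cyl F).card ≤ 2 ^ Λ.card := by
    rw [← Finset.card_biUnion hdisj, ← Finset.card_powerset]
    refine Finset.card_le_card (Finset.biUnion_subset.2 fun F hFF ω hω => ?_)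
    obtain ⟨ω', hω', rfl⟩ := Finset.mem_image.1 hω
    exact Finset.mem_powerset.2 (Finset.union_subset ((hF F).trans (hsub F hFF))
      ((Finset.mem_powerset.1 hω').trans Finset.sdiff_subset))
  have hterm : ∀ F ∈ 𝓕, ((1 : ℝ) / 512) ^ F.card ≤ (cyl F).card / 2 ^ Λ.card := by
    intro F hFF
    have h1 : (thick 1 F).card ≤ 9 * F.card := by
      have := card_thick_le (k := 1) (by norm_num) F
      norm_num at this; exact_mod_cast this
    have h2 : (thick 1 F).card ≤ Λ.card := Finset.card_le_card (hsub F hFF)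
    rw [hcard F hFF, le_div_iff₀ (by positivity)]
    push_cast
    have h3 : (2 : ℝ) ^ Λ.card = 2 ^ (Λ.card - (thick 1 F).card) * 2 ^ (thick 1 F).card := by
      rw [← pow_add]; congr 1; omega
    have h4 : (2 : ℝ) ^ (thick 1 F).card ≤ 512 ^ F.card := by
      calc (2 : ℝ) ^ (thick 1 F).card ≤ 2 ^ (9 * F.card) :=
            pow_le_pow_right₀ (by norm_num) h1
        _ = 512 ^ F.card := by rw [pow_mul]; norm_num
    rw [h3, one_div, inv_pow]
    calc ((512 : ℝ) ^ F.card)⁻¹ * (2 ^ (Λ.card - (thick 1 F).card) * 2 ^ (thick 1 F).card)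
        ≤ (512 ^ F.card)⁻¹ * (2 ^ (Λ.card - (thick 1 F).card) * 512 ^ F.card) := by gcongr
      _ = 2 ^ (Λ.card - (thick 1 F).card) := by field_simp
  calc ∑ F ∈ 𝓕, ((1 : ℝ) / 512) ^ F.card ≤ ∑ F ∈ 𝓕, ((cyl F).card : ℝ) / 2 ^ Λ.card :=
        Finset.sum_le_sum hterm
    _ = (∑ F ∈ 𝓕, (cyl F).card : ℕ) / 2 ^ Λ.card := by push_cast; rw [Finset.sum_div]
    _ ≤ 1 := by
      rw [div_le_one (by positivity)]
      exact_mod_cast htot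

/-! ### Simple connectivity of the king graph and connected boundaries. -/

theorem exists_int_primitive (s : ℤ → ZMod 2) :
    ∃ H : ℤ → ZMod 2, H 0 = 0 ∧ ∀ x, H (x + 1) = H x + s x := by
  refine ⟨fun x => ∑ i ∈ Finset.Ico 0 x, s i - ∑ i ∈ Finset.Ico x 0, s i, by simp, fun x => ?_⟩
  rcases le_or_gt 0 x with hx | hx
  · have h1 : Finset.Ico x 0 = ∅ := Finset.Ico_eq_empty (by omega)
    have h2 : Finset.Ico (x + 1) 0 = ∅ := Finset.Ico_eq_empty (by omega)
    have h3 : Finset.Ico 0 (x + 1) = insert x (Finset.Ico 0 x) := by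
      ext i; simp only [Finset.mem_Ico, Finset.mem_insert]; omega
    dsimp only
    rw [h1, h2, h3, Finset.sum_insert (by simp)]
    simp [add_comm]
  · have h1 : Finset.Ico 0 x = ∅ := Finset.Ico_eq_empty (by omega)
    have h2 : Finset.Ico 0 (x + 1) = ∅ := Finset.Ico_eq_empty (by omega)
    have h3 : Finset.Ico x 0 = insert x (Finset.Ico (x + 1) 0) := by
      ext i; simp only [Finset.mem_Ico, Finset.mem_insert]; omega
    dsimp only
    rw [h1, h2, h3, Finset.sum_insert (by simp)]
    simp
    rw [add_assoc, CharTwo.add_self_eq_zero, add_zero]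

/-- The king graph is simply connected: a cochain with values in `ZMod 2` that is closed on
triangles is exact. -/
theorem exists_potential (σ : ℤ × ℤ → ℤ × ℤ → ZMod 2)
    (hσ : ∀ u v w, Nbr u v → Nbr v w → Nbr u w → σ u v + σ v w = σ u w) :
    ∃ φ : ℤ × ℤ → ZMod 2, ∀ u v, Nbr u v → φ u + σ u v = φ v := by
  have hrefl : ∀ u, σ u u = 0 := by
    intro u
    have := hσ u u u (Near.rfl (by norm_num)) (Near.rfl (by norm_num)) (Near.rfl (by norm_num))
    simpa using this
  have hsymm : ∀ u v, Nbr u v → σ u v = σ v u := by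
    intro u v h
    have := hσ u v u h h.symm (Near.rfl (by norm_num))
    rw [hrefl] at this
    have h2 := CharTwo.add_self_eq_zero (σ v u)
    exact add_right_cancel (this.trans h2.symm)
  -- The potential is obtained by integrating along the horizontal axis and then vertically.
  obtain ⟨H, -, hH⟩ := exists_int_primitive fun x => σ (x, 0) (x + 1, 0)
  choose V hV0 hV using fun x : ℤ => exists_int_primitive fun y => σ (x, y) (x, y + 1)
  have hN : ∀ a b c d : ℤ, -1 ≤ a - c → a - c ≤ 1 → -1 ≤ b - d → b - d ≤ 1 → Nbr (a, b) (c, d) :=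
    fun a b c d h1 h2 h3 h4 => ⟨h1, h2, h3, h4⟩
  have hsq : ∀ x y : ℤ, σ (x, y) (x + 1, y) + σ (x + 1, y) (x + 1, y + 1) =
      σ (x, y) (x, y + 1) + σ (x, y + 1) (x + 1, y + 1) := by
    intro x y
    rw [hσ _ _ _ (hN _ _ _ _ _ _ _ _) (hN _ _ _ _ _ _ _ _) (hN _ _ _ _ _ _ _ _),
      hσ _ _ _ (hN _ _ _ _ _ _ _ _) (hN _ _ _ _ _ _ _ _) (hN _ _ _ _ _ _ _ _)] <;> omega
  have hvert : ∀ x y : ℤ, H x + V x y + σ (x, y) (x, y + 1) = H x + V x (y + 1) := by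
    intro x y; rw [hV, add_assoc]
  -- Horizontal edges are exact on the axis by construction, and exactness passes from row to row
  -- across the unit squares.
  have hhor : ∀ y x : ℤ, H x + V x y + σ (x, y) (x + 1, y) = H (x + 1) + V (x + 1) y := by
    intro y
    induction y using Int.induction_on with
    | zero => intro x; rw [hV0, hV0, hH]; ring
    | succ y ih =>
      intro x
      have h1 := ih x
      have h2 := hsq x y
      rw [hV, hV]
      linear_combination h1 - h2
    | pred y ih =>
      intro x
      have h1 := ih x
      have h2 := hsq x (-(y : ℤ) - 1)
      have h3 := hV x (-(y : ℤ) - 1)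
      have h4 := hV (x + 1) (-(y : ℤ) - 1)
      rw [sub_add_cancel] at h2 h3 h4
      rw [h3, h4] at h1
      linear_combination h1 + h2
  refine ⟨fun z => H z.1 + V z.1 z.2, ?_⟩
  have back : ∀ u v, Nbr u v → (H v.1 + V v.1 v.2) + σ v u = H u.1 + V u.1 u.2 →
      (H u.1 + V u.1 u.2) + σ u v = H v.1 + V v.1 v.2 := by
    intro u v huv h
    rw [hsymm u v huv, ← h, add_assoc, CharTwo.add_self_eq_zero, add_zero]
  have hup : ∀ x y x' : ℤ, Nbr (x, y) (x', y) → (H x + V x y) + σ (x, y) (x', y) =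
      H x' + V x' y := by
    intro x y x' h
    have h' : x' = x ∨ x' = x + 1 ∨ x = x' + 1 := by unfold Nbr Near at h; simp at h; omega
    rcases h' with rfl | rfl | rfl
    · rw [hrefl, add_zero]
    · exact hhor y x
    · exact back (x' + 1, y) (x', y) h (hhor y x')
  have hup' : ∀ x y y' : ℤ, Nbr (x, y) (x, y') → (H x + V x y) + σ (x, y) (x, y') =
      H x + V x y' := by
    intro x y y' h
    have h' : y' = y ∨ y' = y + 1 ∨ y = y' + 1 := by unfold Nbr Near at h; simp at h; omega
    rcases h' with rfl | rfl | rfl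
    · rw [hrefl, add_zero]
    · exact hvert x y
    · exact back (x, y' + 1) (x, y') h (hvert x y')
  rintro ⟨x, y⟩ ⟨x', y'⟩ h
  have h1 : Nbr (x, y) (x', y) := by unfold Nbr Near at *; simp at h ⊢; omega
  have h2 : Nbr (x', y) (x', y') := by unfold Nbr Near at *; simp at h ⊢; omega
  rw [← hσ _ _ _ h1 h2 h, ← add_assoc]
  dsimp only
  rw [hup _ _ _ h1, hup' _ _ _ h2]

/-- A class of edges of the cut between a connected set and its connected complement that is
closed under sharing a triangle is empty or everything. -/
theorem cut_class_eq {G : Set (ℤ × ℤ)} (hG : ∀ x ∈ G, ∀ y ∈ G, Linked Nbr G x y)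
    (hGc : ∀ x ∈ Gᶜ, ∀ y ∈ Gᶜ, Linked Nbr Gᶜ x y) (C : ℤ × ℤ → ℤ × ℤ → Prop)
    (h₁ : ∀ g w g', g ∈ G → g' ∈ G → w ∉ G → Nbr g w → Nbr g' w → Nbr g g' → C g w → C g' w)
    (h₂ : ∀ g w w', g ∈ G → w ∉ G → w' ∉ G → Nbr g w → Nbr g w' → Nbr w w' → C g w → C g w')
    {g₀ w₀ g w : ℤ × ℤ} (hg₀ : g₀ ∈ G) (hw₀ : w₀ ∉ G) (hn₀ : Nbr g₀ w₀) (hC : C g₀ w₀)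
    (hg : g ∈ G) (hw : w ∉ G) (hn : Nbr g w) : C g w := by
  classical
  -- The indicator of the cut edges in the class. A triangle has either no cut edge or two that
  -- share an end, and these two are both in the class or both outside it; hence `σ` is closed.
  let σ : ℤ × ℤ → ℤ × ℤ → ZMod 2 := fun u v =>
    if u ∈ G ∧ v ∉ G ∧ C u v ∨ v ∈ G ∧ u ∉ G ∧ C v u then 1 else 0
  have hσ : ∀ u v w, Nbr u v → Nbr v w → Nbr u w → σ u v + σ v w = σ u w := by
    intro u v w huv hvw huw
    have h11 : (1 : ZMod 2) + 1 = 0 := by decide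
    by_cases hu : u ∈ G <;> by_cases hv : v ∈ G <;> by_cases hw : w ∈ G <;>
      simp only [σ, hu, hv, hw, true_and, false_and, not_true_eq_false, not_false_eq_true, or_false,
        false_or, if_false, add_zero, zero_add]
    · have : C v w ↔ C u w := ⟨h₁ v w u hv hu hw hvw huw huv.symm, h₁ u w v hu hv hw huw hvw huv⟩
      simp only [this]
    · have : C u v ↔ C w v := ⟨h₁ u v w hu hw hv huv hvw.symm huw,
        h₁ w v u hw hu hv hvw.symm huv huw.symm⟩
      simp only [this]
      split_ifs <;> simp [h11]
    · have : C u v ↔ C u w := ⟨h₂ u v w hu hv hw huv huw hvw,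
        h₂ u w v hu hw hv huw huv hvw.symm⟩
      simp only [this]
    · have : C v u ↔ C w u := ⟨h₁ v u w hv hw hu huv.symm huw.symm hvw,
        h₁ w u v hw hv hu huw.symm huv.symm hvw.symm⟩
      simp only [this]
    · have : C v u ↔ C v w := ⟨h₂ v u w hv hu hw huv.symm hvw huw,
        h₂ v w u hv hw hu hvw huv.symm huw.symm⟩
      simp only [this]
      split_ifs <;> simp [h11]
    · have : C w v ↔ C w u := ⟨h₂ w v u hw hv hu hvw.symm huw.symm huv.symm,
        h₂ w u v hw hu hv huw.symm hvw.symm huv⟩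
      simp only [this]
  obtain ⟨φ, hφ⟩ := exists_potential σ hσ
  have hin : ∀ u v, u ∈ G → v ∈ G → φ u = φ v := by
    intro u v hu hv
    refine (hG u hu v hv).induct (p := fun z => φ u = φ z) ?_ rfl
    intro a b ha hb hab h
    have h0 : σ a b = 0 := by simp [σ, ha, hb]
    have := hφ a b hab
    rw [h, ← this, h0, add_zero]
  have hout : ∀ u v, u ∉ G → v ∉ G → φ u = φ v := by
    intro u v hu hv
    refine (hGc u hu v hv).induct (p := fun z => φ u = φ z) ?_ rfl
    intro a b ha hb hab h
    have h0 : σ a b = 0 := by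
      rw [Set.mem_compl_iff] at ha hb
      simp [σ, ha, hb]
    have := hφ a b hab
    rw [h, ← this, h0, add_zero]
  have e1 := hφ g₀ w₀ hn₀
  have e2 := hφ g w hn
  have e3 : σ g₀ w₀ = 1 := by simp [σ, hg₀, hw₀, hC]
  -- The potential is constant on `G` and on its complement, so `σ` has the same value on all cut
  -- edges.
  have e4 : σ g w = 1 := by
    rw [hin g g₀ hg hg₀, hout w w₀ hw hw₀, ← e1] at e2
    rw [add_left_cancel e2, e3]
  by_contra hcon
  have : σ g w = 0 := by simp [σ, hg, hw, hcon]
  rw [this] at e4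
  exact zero_ne_one e4

/-- The inner boundary of a set of lattice points. -/
def innerBdry (G : Set (ℤ × ℤ)) : Set (ℤ × ℤ) := {g | g ∈ G ∧ ∃ w, w ∉ G ∧ Nbr g w}

/-- The outer boundary of a set of lattice points. -/
def outerBdry (G : Set (ℤ × ℤ)) : Set (ℤ × ℤ) := {w | w ∉ G ∧ ∃ g, g ∈ G ∧ Nbr g w}

/-- Apply `cut_class_eq` to the class of cut edges whose inner end is linked to `x` in the boundary.
The inner ends of two cut edges of a triangle are equal or adjacent. -/
theorem innerBdry_linked {G : Set (ℤ × ℤ)} (hG : ∀ x ∈ G, ∀ y ∈ G, Linked Nbr G x y)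
    (hGc : ∀ x ∈ Gᶜ, ∀ y ∈ Gᶜ, Linked Nbr Gᶜ x y) {x y : ℤ × ℤ} (hx : x ∈ innerBdry G)
    (hy : y ∈ innerBdry G) : Linked Nbr (innerBdry G) x y := by
  obtain ⟨hxG, w₀, hw₀, hn₀⟩ := hx
  obtain ⟨hyG, w, hw, hn⟩ := hy
  refine cut_class_eq hG hGc (fun g _ => Linked Nbr (innerBdry G) x g) ?_ ?_ hxG hw₀ hn₀
    (Linked.refl _) hyG hw hn
  · intro g w g' hg hg' hw h1 h2 h3 h
    exact h.trans (Linked.single ⟨hg, w, hw, h1⟩ ⟨hg', w, hw, h2⟩ h3)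
  · intro g w w' _ _ _ _ _ _ h
    exact h

theorem outerBdry_linked {G : Set (ℤ × ℤ)} (hG : ∀ x ∈ G, ∀ y ∈ G, Linked Nbr G x y)
    (hGc : ∀ x ∈ Gᶜ, ∀ y ∈ Gᶜ, Linked Nbr Gᶜ x y) {x y : ℤ × ℤ} (hx : x ∈ outerBdry G)
    (hy : y ∈ outerBdry G) : Linked Nbr (outerBdry G) x y := by
  obtain ⟨hxG, g₀, hg₀, hn₀⟩ := hx
  obtain ⟨hyG, g, hg, hn⟩ := hy
  refine cut_class_eq hG hGc (fun _ w => Linked Nbr (outerBdry G) x w) ?_ ?_ hg₀ hxG hn₀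
    (Linked.refl _) hg hyG hn
  · intro g w g' _ _ _ _ _ _ h
    exact h
  · intro g w w' hg hw hw' h1 h2 h3 h
    exact h.trans (Linked.single ⟨hw, g, hg, h1⟩ ⟨hw', g, hg, h2⟩ h3)

theorem linked_row {S : Set (ℤ × ℤ)} {x x' y : ℤ}
    (h : ∀ t, min x x' ≤ t → t ≤ max x x' → (t, y) ∈ S) : Linked Nbr S (x, y) (x', y) := by
  have key : ∀ (k : ℕ) (x : ℤ), (∀ t, x ≤ t → t ≤ x + k → (t, y) ∈ S) →
      Linked Nbr S (x, y) (x + k, y) := by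
    intro k
    induction k with
    | zero => intro x _; simpa using Linked.refl _
    | succ k ih =>
      intro x hx
      refine (ih x fun t h1 h2 => hx t h1 (by push_cast; omega)).trans (Linked.single
        (hx _ (by omega) (by push_cast; omega)) (hx _ (by push_cast; omega) (by omega)) ?_)
      unfold Nbr Near; push_cast; simp
  rcases le_total x x' with hxx | hxx
  · obtain ⟨k, rfl⟩ := Int.le.dest hxx
    exact key k x fun t h1 h2 => h t (by omega) (by omega)
  · obtain ⟨k, rfl⟩ := Int.le.dest hxx
    exact (key k x' fun t h1 h2 => h t (by omega) (by omega)).symm nbr_symm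

theorem linked_column {S : Set (ℤ × ℤ)} {x y y' : ℤ}
    (h : ∀ t, min y y' ≤ t → t ≤ max y y' → (x, t) ∈ S) : Linked Nbr S (x, y) (x, y') := by
  have key : ∀ (k : ℕ) (y : ℤ), (∀ t, y ≤ t → t ≤ y + k → (x, t) ∈ S) →
      Linked Nbr S (x, y) (x, y + k) := by
    intro k
    induction k with
    | zero => intro y _; simpa using Linked.refl _
    | succ k ih =>
      intro y hy
      refine (ih y fun t h1 h2 => hy t h1 (by push_cast; omega)).trans (Linked.single
        (hy _ (by omega) (by push_cast; omega)) (hy _ (by push_cast; omega) (by omega)) ?_)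
      unfold Nbr Near; push_cast; simp
  rcases le_total y y' with hyy | hyy
  · obtain ⟨k, rfl⟩ := Int.le.dest hyy
    exact key k y fun t h1 h2 => h t (by omega) (by omega)
  · obtain ⟨k, rfl⟩ := Int.le.dest hyy
    exact (key k y' fun t h1 h2 => h t (by omega) (by omega)).symm nbr_symm

/-! ### Filling the holes of a set. -/

/-- The points that can be linked outside `Y` to a base point beyond the square of radius `M`. -/
def outside (Y : Set (ℤ × ℤ)) (M : ℤ) : Set (ℤ × ℤ) := {z | Linked Nbr Yᶜ (M + 1, 0) z}

/-- The set `Y` with its holes filled. -/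
def fillIn (Y : Set (ℤ × ℤ)) (M : ℤ) : Set (ℤ × ℤ) := (outside Y M)ᶜ

/-- The points linked to `g` in `S`. -/
def compOf (S : Set (ℤ × ℤ)) (g : ℤ × ℤ) : Set (ℤ × ℤ) := {z | Linked Nbr S g z}

section Fill

variable {Y : Set (ℤ × ℤ)} {M : ℤ}

theorem mem_outside_of_far (hY : ∀ z ∈ Y, Near M z 0) {z : ℤ × ℤ} (hz : ¬ Near M z 0) :
    z ∈ outside Y M := by
  by_cases hM : M < 0
  · have hY' : Y = ∅ := by
      refine Set.eq_empty_iff_forall_notMem.2 fun w hw => ?_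
      have := hY w hw
      unfold Near at this; omega
    subst hY'
    have h1 : Linked Nbr (∅ᶜ : Set (ℤ × ℤ)) (M + 1, 0) (z.1, 0) := linked_row fun _ _ _ => by simp
    have h2 : Linked Nbr (∅ᶜ : Set (ℤ × ℤ)) (z.1, 0) (z.1, z.2) :=
      linked_column fun _ _ _ => by simp
    exact h1.trans h2
  have hS : ∀ z : ℤ × ℤ, ¬ Near M z 0 → z ∈ Yᶜ := fun z hz hzY => hz (hY z hzY)
  have hN : ∀ x y : ℤ, ¬ Near M (x, y) 0 ↔ (x < -M ∨ M < x ∨ y < -M ∨ M < y) := by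
    intro x y; unfold Near; simp; omega
  have hright : ∀ x y : ℤ, M < x → (x, y) ∈ outside Y M := by
    intro x y hx
    have h1 : Linked Nbr Yᶜ (M + 1, 0) (x, 0) :=
      linked_row fun t h _ => hS _ ((hN _ _).2 (by omega))
    exact h1.trans (linked_column fun t _ _ => hS _ ((hN _ _).2 (by omega)))
  have htop : ∀ x y : ℤ, (M < y ∨ y < -M) → (x, y) ∈ outside Y M := by
    intro x y hy
    exact (hright (M + 1) y (by omega)).trans
      (linked_row fun t _ _ => hS _ ((hN _ _).2 (by omega)))
  obtain ⟨x, y⟩ := z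
  rcases (hN x y).1 hz with h | h | h | h
  · exact (htop x (M + 1) (by omega)).trans
      (linked_column fun t _ _ => hS _ ((hN _ _).2 (by omega)))
  · exact hright x y h
  · exact htop x y (by omega)
  · exact htop x y (by omega)

theorem near_of_mem_fillIn (hY : ∀ z ∈ Y, Near M z 0) {z : ℤ × ℤ} (hz : z ∈ fillIn Y M) :
    Near M z 0 := by
  by_contra h
  exact hz (mem_outside_of_far hY h)

theorem base_notMem (hY : ∀ z ∈ Y, Near M z 0) : ((M + 1, 0) : ℤ × ℤ) ∈ Yᶜ := by
  intro h
  have := hY _ h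
  unfold Near at this
  simp at this

theorem subset_fillIn (hY : ∀ z ∈ Y, Near M z 0) : Y ⊆ fillIn Y M := fun _ hz hz' =>
  (hz'.mem (base_notMem hY)) hz

/-- A point outside `Y` next to an outside point is an outside point. -/
theorem mem_outside_of_nbr (hY : ∀ z ∈ Y, Near M z 0) {z w : ℤ × ℤ} (hw : w ∈ outside Y M)
    (hz : z ∉ Y) (h : Nbr w z) : z ∈ outside Y M :=
  Linked.trans hw (Linked.single (hw.mem (base_notMem hY)) hz h)

theorem compOf_subset {S : Set (ℤ × ℤ)} {g : ℤ × ℤ} (hg : g ∈ S) : compOf S g ⊆ S :=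
  fun _ h => h.mem hg

theorem compOf_linked {S : Set (ℤ × ℤ)} {g : ℤ × ℤ} :
    ∀ x ∈ compOf S g, ∀ y ∈ compOf S g, Linked Nbr (compOf S g) x y := fun _ hx _ hy =>
  (hx.self_set.symm nbr_symm).trans hy.self_set

/-- Otherwise the point would be in the filled set and belong to the component itself. -/
theorem mem_outside_of_outerBdry {g w : ℤ × ℤ} (hg : g ∈ fillIn Y M)
    (hw : w ∈ outerBdry (compOf (fillIn Y M) g)) : w ∈ outside Y M := by
  by_contra h
  obtain ⟨h1, u, hu, huw⟩ := hw
  exact h1 (hu.trans (Linked.single (compOf_subset hg hu) h huw))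

/-- A point not in `Y` that is next to an outside point is itself outside, so it is not in the
filled set. -/
theorem mem_of_innerBdry (hY : ∀ z ∈ Y, Near M z 0) {g u : ℤ × ℤ} (hg : g ∈ fillIn Y M)
    (hu : u ∈ innerBdry (compOf (fillIn Y M) g)) : u ∈ Y := by
  by_contra h
  obtain ⟨h1, w, hw, huw⟩ := hu
  exact compOf_subset hg h1 (mem_outside_of_nbr hY
    (mem_outside_of_outerBdry hg ⟨hw, u, h1, huw⟩) h huw.symm)

/-- Each component of the filled set has a point of `Y` on its inner boundary to the right of any
of its points. -/
theorem exists_right_exit (hY : ∀ z ∈ Y, Near M z 0) {g z : ℤ × ℤ} (hg : g ∈ fillIn Y M)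
    (hz : z ∈ compOf (fillIn Y M) g) : ∃ x : ℤ, z.1 ≤ x ∧
      (∀ t, z.1 ≤ t → t ≤ x → (t, z.2) ∈ compOf (fillIn Y M) g) ∧
      (x + 1, z.2) ∉ compOf (fillIn Y M) g := by
  by_contra! hcon
  have key : ∀ k : ℕ, ∀ t, z.1 ≤ t → t ≤ z.1 + k → (t, z.2) ∈ compOf (fillIn Y M) g := by
    intro k
    induction k with
    | zero =>
      intro t h1 h2
      have : t = z.1 := by push_cast at h2; omega
      subst this; exact hz
    | succ k ih =>
      intro t h1 h2
      by_cases ht : t ≤ z.1 + k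
      · exact ih t h1 ht
      · have : t = z.1 + k + 1 := by push_cast at h2; omega
        subst this
        exact hcon _ (by omega) ih
  have h1 := near_of_mem_fillIn hY (compOf_subset hg hz)
  have h2 := near_of_mem_fillIn hY (compOf_subset hg
    (key (2 * M + 1).toNat (z.1 + (2 * M + 1).toNat) (by omega) le_rfl))
  unfold Near at h1 h2
  simp at h1 h2
  omega

/-- The outside is connected, and each other component of the filled set reaches it by moving to the
right. This is what makes the boundaries of a component connected. -/
theorem compl_compOf_linked (hY : ∀ z ∈ Y, Near M z 0) {g : ℤ × ℤ} (hg : g ∈ fillIn Y M) :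
    ∀ x ∈ (compOf (fillIn Y M) g)ᶜ, ∀ y ∈ (compOf (fillIn Y M) g)ᶜ,
      Linked Nbr (compOf (fillIn Y M) g)ᶜ x y := by
  set G := compOf (fillIn Y M) g with hG
  have hout : outside Y M ⊆ Gᶜ := fun z hz hz' => compOf_subset hg hz' hz
  have h1 : ∀ z ∈ outside Y M, Linked Nbr Gᶜ (M + 1, 0) z := fun z hz =>
    (Linked.self_set hz).mono hout
  have h2 : ∀ z ∈ Gᶜ, Linked Nbr Gᶜ (M + 1, 0) z := by
    intro z hz
    by_cases hzo : z ∈ outside Y M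
    · exact h1 z hzo
    · have hzF : z ∈ fillIn Y M := hzo
      obtain ⟨x, hx, hrow, hex⟩ := exists_right_exit hY hzF (Linked.refl z)
      have hsub : compOf (fillIn Y M) z ⊆ Gᶜ := by
        intro w hw hw'
        exact hz (hw'.trans (hw.symm nbr_symm))
      have hn : Nbr (x, z.2) (x + 1, z.2) := by unfold Nbr Near; simp
      have hlast := hrow x hx le_rfl
      have ho : (x + 1, z.2) ∈ outside Y M :=
        mem_outside_of_outerBdry hzF ⟨hex, _, hlast, hn⟩
      have l1 : Linked Nbr Gᶜ (z.1, z.2) (x, z.2) :=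
        linked_row fun t ht ht' => hsub (hrow t (by omega) (by omega))
      exact (h1 _ ho).trans ((l1.trans
        (Linked.single (hsub hlast) (hout ho) hn)).symm nbr_symm)
  exact fun x hx y hy => ((h2 x hx).symm nbr_symm).trans (h2 y hy)

end Fill

/-! ### Moments and independence of Poisson counts. -/

section Poisson

open scoped NNReal ENNReal

theorem lintegral_poisson_exp (r : ℝ≥0) (l : ℝ) :
    ∫⁻ j, ENNReal.ofReal (Real.exp (l * (j : ℕ))) ∂(poissonMeasure r) =
      ENNReal.ofReal (Real.exp (r * (Real.exp l - 1))) := by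
  rw [poissonMeasure, lintegral_sum_measure]
  simp_rw [lintegral_smul_measure, lintegral_dirac, smul_eq_mul]
  have h1 : ∀ j : ℕ, ENNReal.ofReal (Real.exp (-r) * (r : ℝ) ^ j / (j.factorial : ℝ)) *
      ENNReal.ofReal (Real.exp (l * j)) =
      ENNReal.ofReal (Real.exp (-r) * ((r * Real.exp l) ^ j / (j.factorial : ℝ))) := by
    intro j
    rw [← ENNReal.ofReal_mul (by positivity), mul_comm l, Real.exp_nat_mul, mul_pow]
    congr 1; ring
  simp_rw [h1]
  have h2 := (NormedSpace.expSeries_div_hasSum_exp (r * Real.exp l)).mul_left (Real.exp (-r))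
  rw [← ENNReal.ofReal_tsum_of_nonneg (fun _ => by positivity) h2.summable, h2.tsum_eq,
    ← Real.exp_eq_exp_ℝ, ← Real.exp_add]
  congr 2; ring

variable {Ω : Type*} [MeasurableSpace Ω] {μ : Measure Ω} {Pts : Ω → Set Plane}

theorem IsUnitPoissonProcess.measurable_comp_count (h : IsUnitPoissonProcess μ Pts) {B : Set Plane}
    (hB : MeasurableSet B) {β : Type*} [MeasurableSpace β] (g : ℕ∞ → β) :
    Measurable fun ω => g (Pts ω ∩ B).encard :=
  (Measurable.of_discrete (f := g)).comp (h.measurable_count B hB)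

theorem IsUnitPoissonProcess.lintegral_count (h : IsUnitPoissonProcess μ Pts) {B : Set Plane}
    (hB : MeasurableSet B) (hv : volume B ≠ ⊤) (g : ℕ∞ → ℝ≥0∞) :
    ∫⁻ ω, g (Pts ω ∩ B).encard ∂μ =
      ∫⁻ j, g ((j : ℕ) : ℕ∞) ∂(poissonMeasure (volume B).toNNReal) := by
  have hg : Measurable g := Measurable.of_discrete
  rw [← lintegral_map hg (h.measurable_count B hB), h.count_law B hB hv,
    lintegral_map hg (Measurable.of_discrete)]

theorem IsUnitPoissonProcess.lintegral_exp (h : IsUnitPoissonProcess μ Pts) {B : Set Plane}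
    (hB : MeasurableSet B) (hv : volume B ≠ ⊤) (l : ℝ) :
    ∫⁻ ω, ENNReal.ofReal (Real.exp (l * (Pts ω ∩ B).encard.toNat)) ∂μ =
      ENNReal.ofReal (Real.exp ((volume B).toReal * (Real.exp l - 1))) := by
  rw [h.lintegral_count hB hv fun c => ENNReal.ofReal (Real.exp (l * c.toNat))]
  simp only [ENat.toNat_natCast]
  exact lintegral_poisson_exp _ l

theorem IsUnitPoissonProcess.measure_count_eq_zero (h : IsUnitPoissonProcess μ Pts)
    {B : Set Plane} (hB : MeasurableSet B) (hv : volume B ≠ ⊤) :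
    ∫⁻ ω, (if (Pts ω ∩ B).encard = 0 then 1 else 0) ∂μ =
      ENNReal.ofReal (Real.exp (-(volume B).toReal)) := by
  rw [h.lintegral_count hB hv fun c => if c = 0 then 1 else 0]
  have h1 : (fun j : ℕ => if ((j : ℕ) : ℕ∞) = 0 then (1 : ℝ≥0∞) else 0) =
      Set.indicator {0} 1 := by
    ext j
    by_cases hj : j = 0 <;> simp [hj]
  rw [h1, lintegral_indicator_one (by simp), poissonMeasure_singleton]
  simp [ENNReal.coe_toNNReal_eq_toReal]

theorem IsUnitPoissonProcess.ae_finite (h : IsUnitPoissonProcess μ Pts) {B : Set Plane}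
    (hB : MeasurableSet B) (hv : volume B ≠ ⊤) : ∀ᵐ ω ∂μ, (Pts ω ∩ B).Finite := by
  have h1 := h.lintegral_count hB hv fun c => if c = ⊤ then 1 else 0
  simp only [ENat.natCast_ne_top, if_false, lintegral_zero] at h1
  rw [lintegral_eq_zero_iff
    (h.measurable_comp_count hB fun c => if c = ⊤ then (1 : ℝ≥0∞) else 0)] at h1
  filter_upwards [h1] with ω hω
  by_contra hcon
  have : (Pts ω ∩ B).encard = ⊤ := Set.encard_eq_top_iff.2 hcon
  simp [this] at hω

theorem IsUnitPoissonProcess.lintegral_prod_count (h : IsUnitPoissonProcess μ Pts) {ι : Type*}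
    (s : Finset ι) (B : ι → Set Plane) (hB : ∀ i ∈ s, MeasurableSet (B i))
    (hd : (s : Set ι).PairwiseDisjoint B) (g : ι → ℕ∞ → ℝ≥0∞) :
    ∫⁻ ω, ∏ i ∈ s, g i (Pts ω ∩ B i).encard ∂μ =
      ∏ i ∈ s, ∫⁻ ω, g i (Pts ω ∩ B i).encard ∂μ := by
  let e := s.equivFin
  have hB' : ∀ i, MeasurableSet (B (e.symm i)) := fun i => hB _ (e.symm i).2
  have hind := h.indep_count s.card (fun i => B (e.symm i)) hB' (by
    intro i j hij
    refine hd (e.symm i).2 (e.symm j).2 fun he => hij ?_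
    exact e.symm.injective (Subtype.ext he))
  have hind' : iIndepFun (fun i ω => g (e.symm i) (Pts ω ∩ B (e.symm i)).encard) μ :=
    hind.comp (fun i => g (e.symm i)) (fun i => Measurable.of_discrete)
  have h1 := lintegral_prod_eq_prod_lintegral_of_indepFun Finset.univ _ hind'
    (fun i => h.measurable_comp_count (hB' i) _)
  have h2 : ∀ F : ι → ℝ≥0∞, ∏ i ∈ s, F i = ∏ i : Fin s.card, F (e.symm i) := by
    intro F
    rw [← Finset.prod_coe_sort s F]
    exact (Equiv.prod_comp e.symm fun i : s => F i).symm
  rw [h2, ← h1]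
  congr 1
  ext ω
  rw [h2]

end Poisson

/-! ### The Peierls estimate for sums over rooted sets. -/

section Peierls

open scoped ENNReal

/-- The sum of `f` over a rooted subset of `Λ` is at most nine times the size of the set plus `t`,
provided that the set has at least `m` points per root. -/
def PeierlsBound (f : ℤ × ℤ → ℝ) (Λ : Finset (ℤ × ℤ)) (m : ℕ) (t : ℝ) : Prop :=
  ∀ r F : Finset (ℤ × ℤ), Rooted r F → F ⊆ Λ → m * r.card ≤ F.card →
    ∑ z ∈ F, f z ≤ 9 * F.card + t

/-- Markov's inequality bounds the probability for a single `F` by `3^|F| e^(-9|F|-t)`. For fixed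
roots, `512^(-|F|)` is summable over `F` by `sum_rooted_le`. The root sets cost `(1 + e^(-m))^|Λ| ≤
e`, which is where the requirement of `m` points per root is used. -/
theorem measure_not_peierlsBound_le {Ω : Type*} [MeasurableSpace Ω] {μ : Measure Ω}
    {X : ℤ × ℤ → Ω → ℝ} (hX : ∀ z, Measurable (X z))
    (hE : ∀ F : Finset (ℤ × ℤ), ∫⁻ ω, ENNReal.ofReal (Real.exp (∑ z ∈ F, X z ω)) ∂μ ≤ 3 ^ F.card)
    (Λ : Finset (ℤ × ℤ)) (m : ℕ) (hm : (Λ.card : ℝ) ≤ Real.exp m) (t : ℝ) :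
    μ {ω | ¬ PeierlsBound (fun z => X z ω) Λ m t} ≤ ENNReal.ofReal (Real.exp (1 - t)) := by
  classical
  let 𝓕 : Finset (ℤ × ℤ) → Finset (Finset (ℤ × ℤ)) := fun r =>
    Λ.powerset.filter fun F => Rooted r F ∧ m * r.card ≤ F.card
  let E : Finset (ℤ × ℤ) → Set Ω := fun F => {ω | 9 * F.card + t < ∑ z ∈ F, X z ω}
  have hsub : {ω | ¬ PeierlsBound (fun z => X z ω) Λ m t} ⊆
      ⋃ r ∈ Λ.powerset, ⋃ F ∈ 𝓕 r, E F := by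
    intro ω hω
    simp only [Set.mem_ofPred_eq, PeierlsBound] at hω
    push Not at hω
    obtain ⟨r, F, h1, h2, h3, h4⟩ := hω
    simp only [Set.mem_iUnion]
    exact ⟨r, Finset.mem_powerset.2 (h1.1.trans h2), F,
      Finset.mem_filter.2 ⟨Finset.mem_powerset.2 h2, h1, h3⟩, h4⟩
  have hone : ∀ F, μ (E F) ≤
      ENNReal.ofReal (((1 : ℝ) / 512) ^ F.card * Real.exp (-(F.card : ℝ)) * Real.exp (-t)) := by
    intro F
    have hmeas : Measurable fun ω => ENNReal.ofReal (Real.exp (∑ z ∈ F, X z ω)) :=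
      (Real.measurable_exp.comp (Finset.measurable_sum F fun z _ => hX z)).ennreal_ofReal
    have h1 : E F ⊆ {ω | ENNReal.ofReal (Real.exp (9 * F.card + t)) ≤
        ENNReal.ofReal (Real.exp (∑ z ∈ F, X z ω))} := by
      intro ω hω
      exact ENNReal.ofReal_le_ofReal (Real.exp_le_exp.2 (le_of_lt hω))
    refine (measure_mono h1).trans ((meas_ge_le_lintegral_div hmeas.aemeasurable
      (by simp [Real.exp_pos]) ENNReal.ofReal_ne_top).trans ?_)
    refine (ENNReal.div_le_div_right (hE F) _).trans ?_
    have h3 : (3 : ℝ≥0∞) ^ F.card = ENNReal.ofReal (3 ^ F.card) := by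
      rw [ENNReal.ofReal_pow (by norm_num)]; norm_num
    rw [h3, ← ENNReal.ofReal_div_of_pos (Real.exp_pos _)]
    refine ENNReal.ofReal_le_ofReal ?_
    rw [div_eq_mul_inv, ← Real.exp_neg, neg_add, Real.exp_add, ← mul_assoc]
    refine mul_le_mul_of_nonneg_right ?_ (Real.exp_pos _).le
    have h4 : Real.exp (-(9 * (F.card : ℝ))) = (Real.exp (-9)) ^ F.card := by
      rw [← Real.exp_nat_mul]; congr 1; ring
    have h5 : Real.exp (-(F.card : ℝ)) = (Real.exp (-1)) ^ F.card := by
      rw [← Real.exp_nat_mul]; congr 1; ring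
    rw [h4, h5, ← mul_pow, ← mul_pow]
    refine pow_le_pow_left₀ (by positivity) ?_ _
    have h6 : Real.exp (-9) = Real.exp (-1) * Real.exp (-8) := by
      rw [← Real.exp_add]; norm_num
    -- Since `1536 = 3 · 512`, a factor `e^(-8)` per point absorbs both the moment bound and the
    -- count, and a factor `e^(-1)` remains.
    have h7 : (1536 : ℝ) ≤ Real.exp 8 := by
      have : Real.exp 8 = Real.exp 1 ^ 8 := by rw [← Real.exp_nat_mul]; norm_num
      rw [this]
      calc (1536 : ℝ) ≤ 2.7 ^ 8 := by norm_num
        _ ≤ _ := pow_le_pow_left₀ (by norm_num) (by linarith [Real.exp_one_gt_d9]) _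
    have h8 : Real.exp (-8) ≤ 1 / 1536 := by
      rw [Real.exp_neg, ← one_div]
      exact one_div_le_one_div_of_le (by norm_num) h7
    rw [h6]
    nlinarith [Real.exp_pos (-1)]
  have hr : ∀ r ∈ Λ.powerset, ∑ F ∈ 𝓕 r, μ (E F) ≤
      ENNReal.ofReal ((Real.exp (-m)) ^ r.card * Real.exp (-t)) := by
    intro r _
    have h1 : ∑ F ∈ 𝓕 r, ((1 : ℝ) / 512) ^ F.card ≤ 1 :=
      sum_rooted_le r _ fun F hF => (Finset.mem_filter.1 hF).2.1
    calc ∑ F ∈ 𝓕 r, μ (E F) ≤ ∑ F ∈ 𝓕 r, ENNReal.ofReal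
          (((1 : ℝ) / 512) ^ F.card * ((Real.exp (-m)) ^ r.card * Real.exp (-t))) := by
          refine Finset.sum_le_sum fun F hF => (hone F).trans (ENNReal.ofReal_le_ofReal ?_)
          rw [mul_assoc]
          refine mul_le_mul_of_nonneg_left (mul_le_mul_of_nonneg_right ?_ (Real.exp_pos _).le)
            (by positivity)
          rw [← Real.exp_nat_mul]
          refine Real.exp_le_exp.2 ?_
          -- The remaining `e^(-|F|)` leaves a factor `e^(-m)` for each root, which pays for the sum
          -- over root sets.
          have : ((m * r.card : ℕ) : ℝ) ≤ F.card := by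
            exact_mod_cast (Finset.mem_filter.1 hF).2.2
          push_cast at this
          nlinarith
      _ = ENNReal.ofReal ((∑ F ∈ 𝓕 r, ((1 : ℝ) / 512) ^ F.card) *
          ((Real.exp (-m)) ^ r.card * Real.exp (-t))) := by
          rw [Finset.sum_mul, ENNReal.ofReal_sum_of_nonneg fun _ _ => by positivity]
      _ ≤ _ := ENNReal.ofReal_le_ofReal (mul_le_of_le_one_left (by positivity) h1)
  calc μ {ω | ¬ PeierlsBound (fun z => X z ω) Λ m t}
      ≤ μ (⋃ r ∈ Λ.powerset, ⋃ F ∈ 𝓕 r, E F) := measure_mono hsub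
    _ ≤ ∑ r ∈ Λ.powerset, μ (⋃ F ∈ 𝓕 r, E F) := measure_biUnion_finset_le _ _
    _ ≤ ∑ r ∈ Λ.powerset, ENNReal.ofReal ((Real.exp (-m)) ^ r.card * Real.exp (-t)) :=
        Finset.sum_le_sum fun r h => (measure_biUnion_finset_le _ _).trans (hr r h)
    _ = ENNReal.ofReal ((∏ _z ∈ Λ, (1 + Real.exp (-m))) * Real.exp (-t)) := by
        rw [← ENNReal.ofReal_sum_of_nonneg fun _ _ => by positivity, ← Finset.sum_mul,
          Finset.prod_one_add]
        simp only [Finset.prod_const]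
    _ ≤ ENNReal.ofReal (Real.exp (1 - t)) := by
        refine ENNReal.ofReal_le_ofReal ?_
        rw [sub_eq_add_neg, Real.exp_add]
        refine mul_le_mul_of_nonneg_right ?_ (Real.exp_pos _).le
        rw [Finset.prod_const]
        calc (1 + Real.exp (-(m : ℝ))) ^ Λ.card ≤ (Real.exp (Real.exp (-(m : ℝ)))) ^ Λ.card :=
              pow_le_pow_left₀ (by positivity)
                (by linarith [Real.add_one_le_exp (Real.exp (-(m : ℝ)))]) _
          _ = Real.exp (Λ.card * Real.exp (-(m : ℝ))) := by rw [← Real.exp_nat_mul]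
          _ ≤ Real.exp 1 := by
              refine Real.exp_le_exp.2 ?_
              rw [Real.exp_neg, ← div_eq_mul_inv, div_le_one (Real.exp_pos _)]
              exact hm

end Peierls

/-! ### Chernoff bounds for Poisson counts. -/

section Chernoff

open scoped ENNReal

variable {Ω : Type*} [MeasurableSpace Ω] {μ : Measure Ω} {Pts : Ω → Set Plane}

/-- The moment generating function of a Poisson variable with mean `v` has derivative `v` at `0`, so
a small `l` leaves a margin of `η / 2`. -/
theorem exists_exp_rate {v η : ℝ} (hη : 0 < η) :
    ∃ l : ℝ, 0 < l ∧ Real.exp (v * (Real.exp l - 1)) - 1 ≤ l * (v + η / 2) := by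
  have hd : HasDerivAt (fun l : ℝ => Real.exp (v * (Real.exp l - 1))) v 0 := by
    have h1 : HasDerivAt (fun l : ℝ => v * (Real.exp l - 1)) (v * Real.exp 0) 0 :=
      ((Real.hasDerivAt_exp 0).sub_const 1).const_mul v
    have := h1.exp
    simpa using this
  have h2 := hasDerivAt_iff_tendsto_slope.1 hd
  have h3 : ∀ᶠ l in nhdsWithin (0 : ℝ) {0}ᶜ,
      slope (fun l : ℝ => Real.exp (v * (Real.exp l - 1))) 0 l < v + η / 2 :=
    h2.eventually (gt_mem_nhds (by linarith))
  have h4 : ∀ᶠ l in nhdsWithin (0 : ℝ) (Set.Ioi 0),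
      slope (fun l : ℝ => Real.exp (v * (Real.exp l - 1))) 0 l < v + η / 2 :=
    h3.filter_mono (nhdsWithin_mono _ fun x hx => ne_of_gt hx)
  obtain ⟨l, hl, hl0⟩ := (h4.and self_mem_nhdsWithin).exists
  refine ⟨l, hl0, ?_⟩
  have hl0' : (0 : ℝ) < l := hl0
  rw [slope_def_field] at hl
  simp only [Real.exp_zero, sub_self, mul_zero, sub_zero] at hl
  rw [div_lt_iff₀ hl0'] at hl
  linarith

/-- Chernoff bound for sums of independent copies of a Poisson count that is only counted if
another, independent, Poisson count vanishes. -/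
theorem exists_chernoff {v η : ℝ} (hv : 0 ≤ v) (hη : 0 < η) : ∃ c : ℝ, 0 < c ∧
    ∀ {Ω : Type*} [MeasurableSpace Ω] (μ : Measure Ω) [IsProbabilityMeasure μ]
      (Pts : Ω → Set Plane), IsUnitPoissonProcess μ Pts →
    ∀ (m : ℕ) (Q R : ℕ → Set Plane) (q : ℝ), 0 ≤ q → q ≤ 1 →
      (∀ i, MeasurableSet (Q i)) → (∀ i, MeasurableSet (R i)) →
      (∀ i, volume (Q i) = ENNReal.ofReal v) → (∀ i, volume (R i) ≠ ⊤) →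
      (∀ i, Real.exp (-(volume (R i)).toReal) ≤ q) →
      (∀ i j, i ≠ j → Disjoint (Q i) (Q j)) → (∀ i j, i ≠ j → Disjoint (R i) (R j)) →
      (∀ i j, Disjoint (Q i) (R j)) →
      μ {ω | m * (v * q + η) ≤ ∑ i ∈ Finset.range m,
        if (Pts ω ∩ R i).encard = 0 then ((Pts ω ∩ Q i).encard.toNat : ℝ) else 0} ≤
        ENNReal.ofReal (Real.exp (-c * m)) := by
  classical
  obtain ⟨l, hl, hrate⟩ := exists_exp_rate (v := v) hη
  refine ⟨l * η / 2, by positivity, ?_⟩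
  intro Ω _ μ _ Pts hP m Q R q hq hq1 hQ hR hvQ hvR hqR hQQ hRR hQR
  set G : ℝ := Real.exp (v * (Real.exp l - 1)) - 1 with hG
  have hG0 : 0 ≤ G := by
    have : 0 ≤ v * (Real.exp l - 1) := mul_nonneg hv (by linarith [Real.add_one_le_exp l])
    linarith [Real.add_one_le_exp (v * (Real.exp l - 1))]
  -- With these functions, the exponential of `l` times a summand is `1 + u w`, where `u` and `w`
  -- depend on counts in disjoint sets.
  let u : ℕ∞ → ℝ≥0∞ := fun c => if c = 0 then 1 else 0
  let w : ℕ∞ → ℝ≥0∞ := fun c => ENNReal.ofReal (Real.exp (l * c.toNat) - 1)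
  have hQtop : ∀ i, volume (Q i) ≠ ⊤ := fun i => by rw [hvQ]; exact ENNReal.ofReal_ne_top
  have hw : ∀ i, ∫⁻ ω, w (Pts ω ∩ Q i).encard ∂μ = ENNReal.ofReal G := by
    intro i
    have h1 := hP.lintegral_exp (hQ i) (hQtop i) l
    have h2 : ∀ c : ℕ∞, ENNReal.ofReal (Real.exp (l * c.toNat)) = 1 + w c := by
      intro c
      have : (0 : ℝ) ≤ l * c.toNat := by positivity
      rw [← ENNReal.ofReal_one, ← ENNReal.ofReal_add zero_le_one
        (by linarith [Real.add_one_le_exp (l * (c.toNat : ℝ))])]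
      congr 1; ring
    simp_rw [h2] at h1
    rw [lintegral_add_left measurable_const, lintegral_const, measure_univ, mul_one, hvQ,
      ENNReal.toReal_ofReal hv] at h1
    have h3 : ENNReal.ofReal (Real.exp (v * (Real.exp l - 1))) = 1 + ENNReal.ofReal G := by
      rw [← ENNReal.ofReal_one, ← ENNReal.ofReal_add zero_le_one hG0]
      congr 1; rw [hG]; ring
    rw [h3] at h1
    exact (ENNReal.add_right_inj ENNReal.one_ne_top).1 h1
  have hu : ∀ i, ∫⁻ ω, u (Pts ω ∩ R i).encard ∂μ ≤ ENNReal.ofReal q := by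
    intro i
    rw [hP.measure_count_eq_zero (hR i) (hvR i)]
    exact ENNReal.ofReal_le_ofReal (hqR i)
  let B : ℕ ⊕ ℕ → Set Plane := Sum.elim Q R
  -- The product of the factors `1 + u w` is expanded over subsets `s`, so that every term is a
  -- product of functions of single counts. Summing the bounds restores `(1 + q G)^m ≤ e^(m q G)`.
  have hprod : ∀ s : Finset ℕ, ∫⁻ ω, ∏ i ∈ s, (u (Pts ω ∩ R i).encard * w (Pts ω ∩ Q i).encard) ∂μ
      ≤ ∏ i ∈ s, ENNReal.ofReal (q * G) := by
    intro s
    have h1 := hP.lintegral_prod_count (s.disjSum s) B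
      (by rintro (i | i) _; exacts [hQ i, hR i])
      (by
        rintro (i | i) _ (j | j) _ hij
        · exact hQQ i j fun h => hij (by rw [h])
        · exact hQR i j
        · exact (hQR j i).symm
        · exact hRR i j fun h => hij (by rw [h]))
      (Sum.elim (fun _ => w) fun _ => u)
    simp only [Finset.prod_disjSum, B, Sum.elim_inl, Sum.elim_inr] at h1
    have h2 : ∀ ω, ∏ i ∈ s, (u (Pts ω ∩ R i).encard * w (Pts ω ∩ Q i).encard) =
        (∏ i ∈ s, w (Pts ω ∩ Q i).encard) * ∏ i ∈ s, u (Pts ω ∩ R i).encard := by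
      intro ω; rw [Finset.prod_mul_distrib, mul_comm]
    simp_rw [h2]
    rw [h1, ← Finset.prod_mul_distrib]
    refine Finset.prod_le_prod' fun i _ => ?_
    rw [hw, ENNReal.ofReal_mul hq, mul_comm]
    exact mul_le_mul_left (hu i) _
  set S : Ω → ℝ := fun ω => ∑ i ∈ Finset.range m,
    if (Pts ω ∩ R i).encard = 0 then ((Pts ω ∩ Q i).encard.toNat : ℝ) else 0 with hS
  have hexp : ∀ ω, ENNReal.ofReal (Real.exp (l * S ω)) =
      ∏ i ∈ Finset.range m, (1 + u (Pts ω ∩ R i).encard * w (Pts ω ∩ Q i).encard) := by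
    intro ω
    rw [hS]
    dsimp only
    rw [Finset.mul_sum, Real.exp_sum, ENNReal.ofReal_prod_of_nonneg fun _ _ => (Real.exp_pos _).le]
    refine Finset.prod_congr rfl fun i _ => ?_
    by_cases h0 : (Pts ω ∩ R i).encard = 0
    · simp only [u, w, h0, if_true, one_mul]
      have : (0 : ℝ) ≤ l * (Pts ω ∩ Q i).encard.toNat := by positivity
      rw [← ENNReal.ofReal_one, ← ENNReal.ofReal_add zero_le_one
        (by linarith [Real.add_one_le_exp (l * ((Pts ω ∩ Q i).encard.toNat : ℝ))])]
      congr 1; ring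
    · simp [u, h0]
  have hmu : ∀ i, Measurable fun ω => u (Pts ω ∩ R i).encard := fun i =>
    hP.measurable_comp_count (hR i) u
  have hmw : ∀ i, Measurable fun ω => w (Pts ω ∩ Q i).encard := fun i =>
    hP.measurable_comp_count (hQ i) w
  have hint : ∫⁻ ω, ENNReal.ofReal (Real.exp (l * S ω)) ∂μ ≤
      ENNReal.ofReal (Real.exp (m * (q * G))) := by
    simp_rw [hexp, Finset.prod_one_add]
    rw [lintegral_finsetSum (f := fun t ω =>
      ∏ i ∈ t, u (Pts ω ∩ R i).encard * w (Pts ω ∩ Q i).encard) _ fun s _ =>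
      Finset.measurable_prod s fun i _ => (hmu i).mul (hmw i)]
    refine (Finset.sum_le_sum fun s _ => hprod s).trans ?_
    rw [← Finset.prod_one_add, Finset.prod_const, Finset.card_range, ← ENNReal.ofReal_one,
      ← ENNReal.ofReal_add zero_le_one (by positivity), ← ENNReal.ofReal_pow (by positivity)]
    refine ENNReal.ofReal_le_ofReal ?_
    rw [Real.exp_nat_mul]
    exact pow_le_pow_left₀ (by positivity) (by linarith [Real.add_one_le_exp (q * G)]) _
  have hmeasS : Measurable fun ω => ENNReal.ofReal (Real.exp (l * S ω)) := by
    simp_rw [hexp]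
    exact Finset.measurable_prod _ fun i _ => measurable_const.add ((hmu i).mul (hmw i))
  have hsub : {ω | m * (v * q + η) ≤ S ω} ⊆ {ω |
      ENNReal.ofReal (Real.exp (l * (m * (v * q + η)))) ≤ ENNReal.ofReal (Real.exp (l * S ω))} := by
    intro ω hω
    exact ENNReal.ofReal_le_ofReal (Real.exp_le_exp.2 (mul_le_mul_of_nonneg_left hω hl.le))
  refine (measure_mono hsub).trans ((meas_ge_le_lintegral_div hmeasS.aemeasurable
    (by simp [Real.exp_pos]) ENNReal.ofReal_ne_top).trans ?_)
  refine (ENNReal.div_le_div_right hint _).trans ?_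
  rw [← ENNReal.ofReal_div_of_pos (Real.exp_pos _), ← Real.exp_sub]
  refine ENNReal.ofReal_le_ofReal (Real.exp_le_exp.2 ?_)
  have h1 : q * G ≤ q * (l * (v + η / 2)) := mul_le_mul_of_nonneg_left hrate hq
  have h2 : q * (l * (η / 2)) ≤ 1 * (l * (η / 2)) :=
    mul_le_mul_of_nonneg_right hq1 (by positivity)
  have h3 : q * G ≤ l * v * q + l * η / 2 := by nlinarith
  have h4 : (m : ℝ) * (q * G) ≤ m * (l * v * q + l * η / 2) :=
    mul_le_mul_of_nonneg_left h3 (by positivity)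
  nlinarith

/-- Lower tail of a Poisson count. -/
theorem IsUnitPoissonProcess.measure_count_le (h : IsUnitPoissonProcess μ Pts)
    {B : Set Plane} (hB : MeasurableSet B) (hv : volume B ≠ ⊤) {δ : ℝ} (hδ : 0 < δ)
    (hδ1 : δ ≤ 1) :
    μ {ω | ((Pts ω ∩ B).encard.toNat : ℝ) ≤ (1 - δ) * (volume B).toReal} ≤
      ENNReal.ofReal (Real.exp (-(δ ^ 2 / 4) * (volume B).toReal)) := by
  set V := (volume B).toReal with hV
  have hV0 : 0 ≤ V := ENNReal.toReal_nonneg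
  -- The tilt `-δ/2` gives the exponent `V (-δ/2 + δ²/4) + (δ/2)(1 - δ) V = -δ² V / 4`.
  have h1 := h.lintegral_exp hB hv (-(δ / 2))
  have hmeas : Measurable fun ω =>
      ENNReal.ofReal (Real.exp (-(δ / 2) * (Pts ω ∩ B).encard.toNat)) :=
    h.measurable_comp_count hB fun c => ENNReal.ofReal (Real.exp (-(δ / 2) * c.toNat))
  have hsub : {ω | ((Pts ω ∩ B).encard.toNat : ℝ) ≤ (1 - δ) * V} ⊆ {ω |
      ENNReal.ofReal (Real.exp (-(δ / 2) * ((1 - δ) * V))) ≤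
        ENNReal.ofReal (Real.exp (-(δ / 2) * (Pts ω ∩ B).encard.toNat))} := by
    intro ω hω
    refine ENNReal.ofReal_le_ofReal (Real.exp_le_exp.2 ?_)
    have : ((Pts ω ∩ B).encard.toNat : ℝ) ≤ (1 - δ) * V := hω
    nlinarith
  refine (measure_mono hsub).trans ((meas_ge_le_lintegral_div hmeas.aemeasurable
    (by simp [Real.exp_pos]) ENNReal.ofReal_ne_top).trans ?_)
  rw [h1, ← ENNReal.ofReal_div_of_pos (Real.exp_pos _), ← Real.exp_sub]
  refine ENNReal.ofReal_le_ofReal (Real.exp_le_exp.2 ?_)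
  have h2 := Real.abs_exp_sub_one_sub_id_le (x := -(δ / 2)) (by rw [abs_neg, abs_of_pos] <;> linarith)
  have h3 := (abs_le.1 h2).2
  have h4 : Real.exp (-(δ / 2)) - 1 ≤ -(δ / 2) + δ ^ 2 / 4 := by nlinarith
  have h5 := mul_le_mul_of_nonneg_left h4 hV0
  nlinarith

end Chernoff

/-! ### Boxes and their penalties. -/

/-- The product of two sets of reals as a subset of the plane. -/
def planeRect (I J : Set ℝ) : Set Plane := {p | p 0 ∈ I ∧ p 1 ∈ J}

theorem planeRect_eq_preimage (I J : Set ℝ) :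
    planeRect I J = (MeasurableEquiv.toLp 2 (Fin 2 → ℝ)).symm ⁻¹' (Set.univ.pi ![I, J]) := by
  ext p
  simp [planeRect, Set.mem_pi, Fin.forall_fin_two]

theorem measurableSet_planeRect {I J : Set ℝ} (hI : MeasurableSet I) (hJ : MeasurableSet J) :
    MeasurableSet (planeRect I J) := by
  rw [planeRect_eq_preimage]
  refine (MeasurableEquiv.measurable _) (MeasurableSet.univ_pi fun i => ?_)
  fin_cases i <;> assumption

theorem volume_planeRect {I J : Set ℝ} (hI : MeasurableSet I) (hJ : MeasurableSet J) :
    volume (planeRect I J) = volume I * volume J := by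
  rw [planeRect_eq_preimage,
    (EuclideanSpace.volume_preserving_symm_measurableEquiv_toLp (Fin 2)).measure_preimage
      (MeasurableSet.univ_pi fun i => by fin_cases i <;> assumption).nullMeasurableSet,
    volume_pi_pi]
  simp [Fin.prod_univ_two]

/-- The index of the box of side `a` that contains a point. -/
noncomputable def boxOf (a : ℝ) (p : Plane) : ℤ × ℤ := (⌊p 0 / a⌋, ⌊p 1 / a⌋)

/-- The box of side `a` with a given index. -/
def boxSet (a : ℝ) (z : ℤ × ℤ) : Set Plane := {p | boxOf a p = z}

theorem boxSet_eq {a : ℝ} (ha : 0 < a) (z : ℤ × ℤ) :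
    boxSet a z = planeRect (Set.Ico (a * z.1) (a * z.1 + a)) (Set.Ico (a * z.2) (a * z.2 + a)) := by
  have key : ∀ (x : ℝ) (k : ℤ), ⌊x / a⌋ = k ↔ x ∈ Set.Ico (a * k) (a * k + a) := by
    intro x k
    rw [Int.floor_eq_iff, le_div_iff₀ ha, div_lt_iff₀ ha, Set.mem_Ico, mul_comm a]
    constructor <;> rintro ⟨h1, h2⟩ <;> constructor <;> linarith
  ext p
  simp only [boxSet, boxOf, planeRect, Set.mem_ofPred_eq, Prod.ext_iff, key]

theorem measurableSet_boxSet {a : ℝ} (ha : 0 < a) (z : ℤ × ℤ) : MeasurableSet (boxSet a z) := by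
  rw [boxSet_eq ha]; exact measurableSet_planeRect measurableSet_Ico measurableSet_Ico

theorem volume_boxSet {a : ℝ} (ha : 0 < a) (z : ℤ × ℤ) :
    volume (boxSet a z) = ENNReal.ofReal (a ^ 2) := by
  rw [boxSet_eq ha, volume_planeRect measurableSet_Ico measurableSet_Ico, Real.volume_Ico,
    Real.volume_Ico, ← ENNReal.ofReal_mul (by linarith)]
  congr 1; ring

theorem boxSet_disjoint (a : ℝ) {z w : ℤ × ℤ} (h : z ≠ w) :
    Disjoint (boxSet a z) (boxSet a w) :=
  Set.disjoint_left.2 fun _ hp hp' => h (hp.symm.trans hp')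

/-- The penalty of a box with a given number of points: boxes that are empty or have too many
points are penalized, and so is each point beyond the threshold. -/
noncomputable def penalty (a : ℝ) (c : ℕ∞) : ℝ :=
  (if c.toNat = 0 ∨ 3 * a ^ 2 < c.toNat then a ^ 2 else 0) + max ((c.toNat : ℝ) - 3 * a ^ 2) 0

/-- One term for each kind of box: ordinary, empty, overcrowded. In an overcrowded box the penalty
is `a² + (j - 3a²) = j - 2a²`. -/
theorem exp_penalty_le (a : ℝ) (j : ℕ) : Real.exp (penalty a j) ≤
    1 + (if j = 0 then Real.exp (a ^ 2) else 0) +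
      Real.exp (-(2 * a ^ 2)) * Real.exp (1 * j) := by
  unfold penalty
  simp only [ENat.toNat_natCast]
  have hE : 0 < Real.exp (-(2 * a ^ 2)) * Real.exp (1 * (j : ℝ)) := by positivity
  by_cases h0 : j = 0
  · subst h0
    have h1 : max (((0 : ℕ) : ℝ) - 3 * a ^ 2) 0 = 0 := by
      rw [max_eq_right]; push_cast; nlinarith
    simp only [true_or, if_true, h1, add_zero]
    linarith
  · by_cases h3 : 3 * a ^ 2 < j
    · have h1 : max ((j : ℝ) - 3 * a ^ 2) 0 = j - 3 * a ^ 2 := max_eq_left (by linarith)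
      simp only [h3, or_true, if_true, h1, h0, if_false]
      rw [← Real.exp_add]
      have : a ^ 2 + ((j : ℝ) - 3 * a ^ 2) = -(2 * a ^ 2) + 1 * j := by ring
      rw [this]; linarith
    · have h1 : max ((j : ℝ) - 3 * a ^ 2) 0 = 0 := max_eq_right (by linarith)
      simp only [h0, h3, or_self, if_false, h1, add_zero, Real.exp_zero]
      linarith

section

open scoped ENNReal

variable {Ω : Type*} [MeasurableSpace Ω] {μ : Measure Ω} {Pts : Ω → Set Plane}

/-- Each of the three terms has mean at most one: `e^(a²)` is cancelled by the probability that the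
box is empty, and the last term uses `e - 1 < 2`. -/
theorem IsUnitPoissonProcess.lintegral_exp_penalty [IsProbabilityMeasure μ]
    (h : IsUnitPoissonProcess μ Pts) {a : ℝ} (ha : 1 ≤ a) (z : ℤ × ℤ) :
    ∫⁻ ω, ENNReal.ofReal (Real.exp (penalty a (Pts ω ∩ boxSet a z).encard)) ∂μ ≤ 3 := by
  have ha0 : 0 < a := by linarith
  have hB := measurableSet_boxSet ha0 z
  have hv : volume (boxSet a z) ≠ ⊤ := by rw [volume_boxSet ha0]; exact ENNReal.ofReal_ne_top
  have hvr : (volume (boxSet a z)).toReal = a ^ 2 := by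
    rw [volume_boxSet ha0, ENNReal.toReal_ofReal (by positivity)]
  rw [h.lintegral_count hB hv fun c => ENNReal.ofReal (Real.exp (penalty a c))]
  set r := (volume (boxSet a z)).toNNReal
  have hr : (r : ℝ) = a ^ 2 := by rw [← hvr]; rfl
  have hle : ∀ j : ℕ, ENNReal.ofReal (Real.exp (penalty a j)) ≤
      1 + Set.indicator {0} (fun _ => ENNReal.ofReal (Real.exp (a ^ 2))) j +
        ENNReal.ofReal (Real.exp (-(2 * a ^ 2))) * ENNReal.ofReal (Real.exp (1 * j)) := by
    intro j
    refine (ENNReal.ofReal_le_ofReal (exp_penalty_le a j)).trans ?_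
    rw [ENNReal.ofReal_add (by split_ifs <;> positivity) (by positivity),
      ENNReal.ofReal_add zero_le_one (by split_ifs <;> positivity), ENNReal.ofReal_one,
      ENNReal.ofReal_mul (Real.exp_pos _).le]
    by_cases hj : j = 0 <;> simp [hj]
  refine (lintegral_mono hle).trans ?_
  rw [lintegral_add_right _ (Measurable.of_discrete), lintegral_add_left measurable_const,
    lintegral_const, measure_univ, lintegral_indicator_const (by simp),
    lintegral_const_mul _ (Measurable.of_discrete), lintegral_poisson_exp,
    poissonMeasure_singleton, hr, ← ENNReal.ofReal_mul (Real.exp_pos _).le,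
    ← ENNReal.ofReal_mul (Real.exp_pos _).le, mul_one, ← ENNReal.ofReal_one,
    ← ENNReal.ofReal_add zero_le_one (by positivity),
    ← ENNReal.ofReal_add (by positivity) (by positivity)]
  have h3 : (3 : ℝ≥0∞) = ENNReal.ofReal 3 := by simp
  rw [h3]
  refine ENNReal.ofReal_le_ofReal ?_
  have e1 : Real.exp (a ^ 2) * (Real.exp (-a ^ 2) * (a ^ 2) ^ 0 / (Nat.factorial 0 : ℕ)) = 1 := by
    simp [← Real.exp_add]
  have e2 : Real.exp (-(2 * a ^ 2)) * Real.exp (a ^ 2 * (Real.exp 1 - 1)) ≤ 1 := by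
    rw [← Real.exp_add, Real.exp_le_one_iff]
    have := Real.exp_one_lt_d9
    nlinarith [sq_nonneg a]
  linarith

theorem IsUnitPoissonProcess.measure_not_peierlsBound [IsProbabilityMeasure μ]
    (h : IsUnitPoissonProcess μ Pts) {a : ℝ} (ha : 1 ≤ a) (Λ : Finset (ℤ × ℤ)) (m : ℕ)
    (hm : (Λ.card : ℝ) ≤ Real.exp m) (t : ℝ) :
    μ {ω | ¬ PeierlsBound (fun z => penalty a (Pts ω ∩ boxSet a z).encard) Λ m t} ≤
      ENNReal.ofReal (Real.exp (1 - t)) := by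
  have ha0 : 0 < a := by linarith
  refine measure_not_peierlsBound_le
    (X := fun z ω => penalty a (Pts ω ∩ boxSet a z).encard)
    (fun z => h.measurable_comp_count (measurableSet_boxSet ha0 z) _) (fun F => ?_) Λ m hm t
  simp_rw [Real.exp_sum, ENNReal.ofReal_prod_of_nonneg fun _ _ => (Real.exp_pos _).le]
  rw [h.lintegral_prod_count F (boxSet a) (fun z _ => measurableSet_boxSet ha0 z)
    (fun z _ w _ hzw => boxSet_disjoint a hzw)
    (fun _ c => ENNReal.ofReal (Real.exp (penalty a c)))]
  exact Finset.prod_le_pow_card _ _ _ fun z _ => h.lintegral_exp_penalty ha z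

theorem IsUnitPoissonProcess.ae_finite_box (h : IsUnitPoissonProcess μ Pts) {a : ℝ} (ha : 0 < a) :
    ∀ᵐ ω ∂μ, ∀ z, (Pts ω ∩ boxSet a z).Finite := by
  rw [ae_all_iff]
  exact fun z => h.ae_finite (measurableSet_boxSet ha z)
    (by rw [volume_boxSet ha]; exact ENNReal.ofReal_ne_top)

end

/-! ### Distances in the plane and between boxes. -/

theorem plane_dist_sq (p q : Plane) : dist p q ^ 2 = (p 0 - q 0) ^ 2 + (p 1 - q 1) ^ 2 := by
  rw [EuclideanSpace.dist_eq, Real.sq_sqrt (by positivity), Fin.sum_univ_two, Real.dist_eq,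
    Real.dist_eq, sq_abs, sq_abs]

theorem abs_coord_le_dist (p q : Plane) (i : Fin 2) : |p i - q i| ≤ dist p q := by
  refine abs_le_of_sq_le_sq ?_ dist_nonneg
  rw [plane_dist_sq]
  fin_cases i
  · dsimp; nlinarith [sq_nonneg (p 1 - q 1)]
  · dsimp; nlinarith [sq_nonneg (p 0 - q 0)]

theorem dist_le_of_coord {p q : Plane} {d : ℝ} (hd : 0 ≤ d) (h0 : |p 0 - q 0| ≤ d)
    (h1 : |p 1 - q 1| ≤ d) : dist p q ≤ 3 / 2 * d := by
  refine abs_le_of_sq_le_sq' ?_ (by linarith) |>.2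
  rw [plane_dist_sq, ← sq_abs (p 0 - q 0), ← sq_abs (p 1 - q 1)]
  nlinarith [abs_nonneg (p 0 - q 0), abs_nonneg (p 1 - q 1)]

theorem near_boxOf {a : ℝ} (ha : 0 < a) {p q : Plane} {k : ℤ} (h : dist p q ≤ k * a) :
    Near k (boxOf a p) (boxOf a q) := by
  have key : ∀ x y : ℝ, |x - y| ≤ k * a → ⌊x / a⌋ - ⌊y / a⌋ ≤ k := by
    intro x y hxy
    have h1 : x / a ≤ y / a + k := by
      rw [div_le_iff₀ ha, add_mul, div_mul_cancel₀ _ ha.ne']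
      linarith [(abs_le.1 hxy).2]
    have h2 := (Int.floor_mono h1).trans_eq (Int.floor_add_intCast (y / a) k)
    omega
  have h0 := (abs_coord_le_dist p q 0).trans h
  have h1 := (abs_coord_le_dist p q 1).trans h
  have k1 := key _ _ h0
  have k2 := key _ _ h1
  rw [abs_sub_comm] at h0 h1
  have k3 := key _ _ h0
  have k4 := key _ _ h1
  unfold Near boxOf
  dsimp only
  omega

theorem dist_le_of_near {a : ℝ} (ha : 0 < a) {p q : Plane} {k : ℤ}
    (h : Near k (boxOf a p) (boxOf a q)) : dist p q ≤ 3 / 2 * ((k + 1) * a) := by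
  have key : ∀ x y : ℝ, ⌊x / a⌋ - ⌊y / a⌋ ≤ k → x - y ≤ (k + 1) * a := by
    intro x y hxy
    have h1 := Int.lt_floor_add_one (x / a)
    have h2 := Int.floor_le (y / a)
    have h3 : ((⌊x / a⌋ : ℝ) - ⌊y / a⌋) ≤ k := by exact_mod_cast hxy
    have h4 : x / a - y / a ≤ k + 1 := by linarith
    rw [← sub_div, div_le_iff₀ ha] at h4
    exact h4
  unfold Near boxOf at h
  dsimp only at h
  have hk : (0 : ℝ) ≤ k := by
    have : 0 ≤ k := by omega
    exact_mod_cast this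
  refine dist_le_of_coord (by positivity) (abs_le.2 ⟨?_, key _ _ (by omega)⟩)
    (abs_le.2 ⟨?_, key _ _ (by omega)⟩)
  · linarith [key (q 0) (p 0) (by omega)]
  · linarith [key (q 1) (p 1) (by omega)]

theorem dist_le_of_boxOf_eq {a : ℝ} (ha : 0 < a) {p q : Plane} (h : boxOf a p = boxOf a q) :
    dist p q ≤ 3 / 2 * a := by
  have := dist_le_of_near ha (k := 0) (p := p) (q := q) (by rw [h]; exact Near.rfl le_rfl)
  simpa using this

/-- Each box contains finitely many points of `P`. -/
def LocFinite (a : ℝ) (P : Set Plane) : Prop := ∀ z, (P ∩ boxSet a z).Finite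

theorem LocFinite.finite_inter_closedBall {a : ℝ} (ha : 0 < a) {P : Set Plane}
    (hP : LocFinite a P) (c : Plane) (r : ℝ) : (P ∩ Metric.closedBall c r).Finite := by
  obtain ⟨k, hk⟩ := exists_nat_ge (r / a)
  have hsub : P ∩ Metric.closedBall c r ⊆ ⋃ z ∈ latSq (boxOf a c) k, P ∩ boxSet a z := by
    rintro p ⟨hp, hpr⟩
    simp only [Set.mem_iUnion]
    refine ⟨boxOf a p, mem_latSq.2 (near_boxOf ha ?_), hp, rfl⟩
    rw [Metric.mem_closedBall] at hpr
    rw [div_le_iff₀ ha] at hk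
    exact_mod_cast hpr.trans hk
  exact (Set.Finite.biUnion (Finset.finite_toSet _) fun z _ => hP z).subset hsub

/-! ### Voronoi cells that meet a convex set. -/

section Cells

variable {P : Set Plane}

theorem isClosed_voronoiCell (x : Plane) : IsClosed (voronoiCell P x) := by
  have : voronoiCell P x = ⋂ y ∈ P, {z | dist z x ≤ dist z y} := by
    ext z; simp [voronoiCell]
  rw [this]
  exact isClosed_biInter fun y _ =>
    isClosed_le (continuous_id.dist continuous_const) (continuous_id.dist continuous_const)

theorem convex_voronoiCell (x : Plane) : Convex ℝ (voronoiCell P x) := by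
  have : voronoiCell P x = ⋂ y ∈ P, {z | dist z x ≤ dist z y} := by
    ext z; simp [voronoiCell]
  rw [this]
  refine convex_iInter₂ fun y _ => ?_
  intro p hp q hq s t hs ht hst
  have hsq : ∀ z : Plane, dist z x ≤ dist z y ↔
      (z 0 - x 0) ^ 2 + (z 1 - x 1) ^ 2 ≤ (z 0 - y 0) ^ 2 + (z 1 - y 1) ^ 2 := by
    intro z
    rw [← plane_dist_sq, ← plane_dist_sq]
    exact (pow_le_pow_iff_left₀ dist_nonneg dist_nonneg two_ne_zero).symm
  rw [Set.mem_ofPred_eq, hsq] at hp hq ⊢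
  simp only [PiLp.add_apply, PiLp.smul_apply, smul_eq_mul]
  have hs' : s = 1 - t := by linarith
  subst hs'
  nlinarith [mul_le_mul_of_nonneg_left hp hs, mul_le_mul_of_nonneg_left hq ht]

variable {a : ℝ}

theorem exists_mem_voronoiCell (ha : 0 < a) (hP : LocFinite a P) {p : Plane} (hp : p ∈ P)
    (t : Plane) : ∃ x : P, t ∈ voronoiCell P x := by
  have hfin := hP.finite_inter_closedBall ha t (dist t p)
  obtain ⟨x, hx, hmin⟩ := hfin.exists_minimalFor (fun y => dist t y) _
    ⟨p, hp, by rw [Metric.mem_closedBall, dist_comm]⟩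
  refine ⟨⟨x, hx.1⟩, fun y hy => ?_⟩
  by_cases hy' : dist t y ≤ dist t p
  · rcases le_total (dist t x) (dist t y) with h | h
    · exact h
    · exact hmin ⟨hy, by rwa [Metric.mem_closedBall, dist_comm]⟩ h
  · have := hx.2
    rw [Metric.mem_closedBall, dist_comm] at this
    exact this.trans (le_of_not_ge hy')

theorem interior_voronoiCell_nonempty (ha : 0 < a) (hP : LocFinite a P) {x : Plane} :
    (interior (voronoiCell P x)).Nonempty := by
  have hfin : ((P ∩ Metric.closedBall x 1) \ {x}).Finite :=
    (hP.finite_inter_closedBall ha x 1).subset Set.sdiff_subset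
  have hopen : IsOpen ((P ∩ Metric.closedBall x 1) \ {x})ᶜ := hfin.isClosed.isOpen_compl
  obtain ⟨ε, hε, hball⟩ := Metric.isOpen_iff.1 hopen x (by simp)
  refine ⟨x, mem_interior.2 ⟨Metric.ball x (min ε 1 / 2), ?_, Metric.isOpen_ball,
    Metric.mem_ball_self (by positivity)⟩⟩
  intro z hz y hy
  rw [Metric.mem_ball] at hz
  by_cases hyx : y = x
  · rw [hyx]
  have hd : min ε 1 ≤ dist y x := by
    by_contra hlt
    push Not at hlt
    refine hball (Metric.mem_ball.2 (hlt.trans_le (min_le_left _ _))) ⟨⟨hy, ?_⟩, hyx⟩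
    exact Metric.mem_closedBall.2 (hlt.le.trans (min_le_right _ _))
  have := dist_triangle y z x
  rw [dist_comm y z] at this
  linarith

/-- A convex set with nonempty interior lies in the closure of its interior. This gives room to move
the ends of a segment within two cells. -/
theorem interior_voronoiCell_inter_nonempty (ha : 0 < a) (hP : LocFinite a P) {x : Plane}
    {U : Set Plane} (hU : IsOpen U) (h : (voronoiCell P x ∩ U).Nonempty) :
    (interior (voronoiCell P x) ∩ U).Nonempty := by
  have hcl := (convex_voronoiCell (P := P) x).closure_interior_eq_closure_of_nonempty_interior
    (interior_voronoiCell_nonempty ha hP)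
  obtain ⟨p, hp, hpU⟩ := h
  have hp' : p ∈ closure (interior (voronoiCell P x)) := by
    rw [hcl]; exact subset_closure hp
  obtain ⟨q, hqU, hq⟩ := mem_closure_iff.1 hp' U hU hpU
  exact ⟨q, hq, hqU⟩

/-- The points of `P` whose Voronoi cells meet `U`. -/
def cellsMeeting (P U : Set Plane) : Set P := {x | (voronoiCell P x ∩ U).Nonempty}

theorem finite_cellsMeeting (ha : 0 < a) (hP : LocFinite a P) {U : Set Plane}
    (hU : Bornology.IsBounded U) : (cellsMeeting P U).Finite := by
  rcases Set.eq_empty_or_nonempty (cellsMeeting P U) with he | ⟨x₀, hx₀⟩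
  · rw [he]; exact Set.finite_empty
  obtain ⟨t₀, ht₀, ht₀U⟩ := hx₀
  obtain ⟨r, hr⟩ := hU.subset_closedBall t₀
  refine Set.Finite.of_finite_image (f := Subtype.val) ?_ Subtype.val_injective.injOn
  refine (hP.finite_inter_closedBall ha t₀ (r + (r + dist t₀ x₀))).subset ?_
  rintro _ ⟨x, ⟨t, ht, htU⟩, rfl⟩
  refine ⟨x.2, Metric.mem_closedBall.2 ?_⟩
  have h1 : dist t t₀ ≤ r := hr htU
  have h2 := ht x₀ x₀.2
  have h3 := dist_triangle t t₀ x₀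
  have h4 := dist_triangle (x : Plane) t t₀
  rw [dist_comm (x : Plane) t] at h4
  linarith

/-- Shift the end `y` perpendicularly to `y - x`. Each point of `Z` lies on the segment for at most
one shift, because it differs from `x`. -/
theorem exists_segment_avoiding {Z : Set Plane} (hZ : Z.Finite) {x y : Plane} (hx : x ∉ Z)
    (hxy : x ≠ y) {ε : ℝ} (hε : 0 < ε) : ∃ y' ∈ Metric.ball y ε, Disjoint (segment ℝ x y') Z := by
  set w : Plane := !₂[-(y 1 - x 1), y 0 - x 0] with hw
  have hw0 : w 0 = -(y 1 - x 1) := by simp [hw]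
  have hw1 : w 1 = y 0 - x 0 := by simp [hw]
  have hd : 0 < (y 0 - x 0) ^ 2 + (y 1 - x 1) ^ 2 := by
    have h1 : 0 < dist y x := dist_pos.2 hxy.symm
    have h2 := plane_dist_sq y x
    nlinarith
  have hbad : (⋃ z ∈ Z, {s : ℝ | z ∈ segment ℝ x (y + s • w)}).Finite := by
    refine hZ.biUnion fun z hz => Set.Subsingleton.finite ?_
    intro s hs s' hs'
    rw [Set.mem_ofPred_eq, segment_eq_image'] at hs hs'
    obtain ⟨θ, -, h1⟩ := hs
    obtain ⟨θ', -, h2⟩ := hs'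
    have hθ : θ ≠ 0 := by
      rintro rfl
      simp only [zero_smul, add_zero] at h1
      exact hx (h1 ▸ hz)
    have e := h1.trans h2.symm
    have e0 := congrArg (fun v : Plane => v 0) e
    have e1 := congrArg (fun v : Plane => v 1) e
    simp only [PiLp.add_apply, PiLp.smul_apply, PiLp.sub_apply, smul_eq_mul, hw0, hw1] at e0 e1
    have hθθ : θ = θ' := by
      have : (θ - θ') * ((y 0 - x 0) ^ 2 + (y 1 - x 1) ^ 2) = 0 := by
        linear_combination (y 0 - x 0) * e0 + (y 1 - x 1) * e1
      rcases mul_eq_zero.1 this with h | h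
      · linarith
      · exact absurd h hd.ne'
    subst hθθ
    have : (θ * (s - s')) * ((y 0 - x 0) ^ 2 + (y 1 - x 1) ^ 2) = 0 := by
      linear_combination (-(y 1 - x 1)) * e0 + (y 0 - x 0) * e1
    rcases mul_eq_zero.1 this with h | h
    · rcases mul_eq_zero.1 h with h | h
      · exact absurd h hθ
      · linarith
    · exact absurd h hd.ne'
  have hwn : 0 < ‖w‖ + 1 := by positivity
  obtain ⟨s, hs, hsb⟩ := ((Set.Ioo_infinite (div_pos hε hwn)).sdiff hbad).nonempty
  refine ⟨y + s • w, ?_, ?_⟩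
  · rw [Metric.mem_ball, dist_eq_norm, add_sub_cancel_left, norm_smul, Real.norm_eq_abs,
      abs_of_pos hs.1]
    have h2 := hs.2
    rw [lt_div_iff₀ hwn] at h2
    nlinarith [hs.1]
  · rw [Set.disjoint_left]
    intro z hz hzZ
    exact hsb (Set.mem_biUnion hzZ hz)

/-- The points of `P` whose cells meet an open bounded convex set are connected among themselves
in the Voronoi triangulation. -/
theorem cellsMeeting_linked (ha : 0 < a) (hP : LocFinite a P) {U : Set Plane}
    (hU : IsOpen U) (hconv : Convex ℝ U) (hb : Bornology.IsBounded U) {x y : P}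
    (hx : x ∈ cellsMeeting P U) (hy : y ∈ cellsMeeting P U) :
    Linked (voronoiGraph P).Adj (cellsMeeting P U) x y := by
  classical
  by_contra hcon
  set S := cellsMeeting P U with hS
  have hSfin : S.Finite := finite_cellsMeeting ha hP hb
  set A : Set P := {v | v ∈ S ∧ Linked (voronoiGraph P).Adj S x v} with hA
  set B : Set P := {v | v ∈ S ∧ ¬ Linked (voronoiGraph P).Adj S x v} with hB
  have hAfin : A.Finite := hSfin.subset fun v hv => hv.1
  have hBfin : B.Finite := hSfin.subset fun v hv => hv.1
  have hxA : x ∈ A := ⟨hx, Linked.refl _⟩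
  have hyB : y ∈ B := ⟨hy, hcon⟩
  -- Two cells that share more than a point are adjacent, so cells of different clusters share at
  -- most one. These finitely many points form `Z`.
  have hsub : ∀ u ∈ A, ∀ v ∈ B, (voronoiCell P u ∩ voronoiCell P v).Subsingleton := by
    intro u hu v hv
    by_contra hns
    rw [Set.not_subsingleton_iff] at hns
    refine hv.2 (hu.2.trans (Linked.single hu.1 hv.1 ⟨?_, hns⟩))
    rintro rfl
    exact hv.2 hu.2
  set Z : Set Plane := ⋃ u ∈ A, ⋃ v ∈ B, voronoiCell P u ∩ voronoiCell P v with hZ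
  have hZfin : Z.Finite := hAfin.biUnion fun u hu => hBfin.biUnion fun v hv => (hsub u hu v hv).finite
  have hclosed : ∀ C : Set P, C.Finite → IsClosed (⋃ u ∈ C, voronoiCell P (u : Plane)) :=
    fun C hC => hC.isClosed_biUnion fun u _ => isClosed_voronoiCell _
  obtain ⟨x₁, hx₁, hx₁U⟩ := interior_voronoiCell_inter_nonempty ha hP hU hx
  obtain ⟨y₁, hy₁, hy₁U⟩ := interior_voronoiCell_inter_nonempty ha hP hU hy
  obtain ⟨ε, hε, hballx⟩ := Metric.isOpen_iff.1 (isOpen_interior.inter hU) x₁ ⟨hx₁, hx₁U⟩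
  obtain ⟨δ, hδ, hbally⟩ := Metric.isOpen_iff.1 (isOpen_interior.inter hU) y₁ ⟨hy₁, hy₁U⟩
  have hinf : (Metric.ball x₁ ε).Infinite :=
    infinite_of_mem_nhds x₁ (Metric.ball_mem_nhds x₁ hε)
  obtain ⟨x₂, hx₂, hx₂Z⟩ := (hinf.sdiff (hZfin.union (Set.finite_singleton y₁))).nonempty
  have hx₂Z' : x₂ ∉ Z := fun h => hx₂Z (Or.inl h)
  have hx₂y : x₂ ≠ y₁ := fun h => hx₂Z (Or.inr h)
  obtain ⟨y₂, hy₂, hdisj⟩ := exists_segment_avoiding hZfin hx₂Z' hx₂y hδ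
  have hx₂U := (hballx hx₂).2
  have hy₂U := (hbally hy₂).2
  have hx₂c : x₂ ∈ voronoiCell P x := interior_subset (hballx hx₂).1
  have hy₂c : y₂ ∈ voronoiCell P y := interior_subset (hbally hy₂).1
  have hcover : segment ℝ x₂ y₂ ⊆
      (⋃ u ∈ A, voronoiCell P (u : Plane)) ∪ ⋃ u ∈ B, voronoiCell P (u : Plane) := by
    intro t ht
    obtain ⟨u, hu⟩ := exists_mem_voronoiCell ha hP x.2 t
    have huS : u ∈ S := ⟨t, hu, hconv.segment_subset hx₂U hy₂U ht⟩
    by_cases hl : Linked (voronoiGraph P).Adj S x u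
    · exact Or.inl (Set.mem_biUnion (show u ∈ A from ⟨huS, hl⟩) hu)
    · exact Or.inr (Set.mem_biUnion (show u ∈ B from ⟨huS, hl⟩) hu)
  -- The segment is connected and covered by the closed unions of the two clusters, so it passes
  -- through a point of both, that is, a point of `Z`, which it was chosen to avoid.
  obtain ⟨t, ht, htA, htB⟩ := isPreconnected_closed_iff.1 (convex_segment x₂ y₂).isPreconnected _ _
    (hclosed A hAfin) (hclosed B hBfin) hcover
    ⟨x₂, left_mem_segment ℝ _ _, Set.mem_biUnion hxA hx₂c⟩
    ⟨y₂, right_mem_segment ℝ _ _, Set.mem_biUnion hyB hy₂c⟩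
  simp only [Set.mem_iUnion] at htA htB
  obtain ⟨u, huA, hu⟩ := htA
  obtain ⟨v, hvB, hv⟩ := htB
  refine Set.disjoint_left.1 hdisj ht ?_
  simp only [hZ, Set.mem_iUnion]
  exact ⟨u, huA, v, hvB, hu, hv⟩

end Cells

/-- Vertices that are linked in a finite set are at a distance at most the size of the set. -/
theorem edist_le_of_linked {V : Type*} {G : SimpleGraph V} {S : Finset V} {x y : V} (hx : x ∈ S)
    (h : Linked G.Adj (S : Set V) x y) : G.edist x y ≤ S.card := by
  classical
  have hw : ∃ w : G.Walk x y, ∀ v ∈ w.support, v ∈ S := by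
    induction h with
    | refl => exact ⟨SimpleGraph.Walk.nil, by simpa using hx⟩
    | tail _ h ih =>
      obtain ⟨w, hw⟩ := ih
      refine ⟨w.concat h.2.2, fun v hv => ?_⟩
      rw [SimpleGraph.Walk.support_concat, List.mem_append,
        List.mem_singleton] at hv
      rcases hv with hv | rfl
      · exact hw v hv
      · exact h.2.1
  obtain ⟨w, hw⟩ := hw
  have h1 := SimpleGraph.edist_le (w.toPath : G.Walk x y)
  refine h1.trans ?_
  have hnd := w.toPath.2.support_nodup
  have h2 : (w.toPath : G.Walk x y).support.toFinset ⊆ S := by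
    intro v hv
    exact hw v (SimpleGraph.Walk.support_toPath_subset_support w (List.mem_toFinset.1 hv))
  have h3 := Finset.card_le_card h2
  rw [List.toFinset_card_of_nodup hnd, SimpleGraph.Walk.length_support] at h3
  exact_mod_cast (Nat.le_succ _).trans h3

/-! ### Boxes met by segments and the length of Voronoi edges. -/

/-- The boxes that meet a set. -/
def boxesMeeting (a : ℝ) (K : Set Plane) : Set (ℤ × ℤ) := {z | ∃ p ∈ K, boxOf a p = z}

theorem boxOf_mem_boxesMeeting {a : ℝ} {K : Set Plane} {p : Plane} (hp : p ∈ K) :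
    boxOf a p ∈ boxesMeeting a K := ⟨p, hp, rfl⟩

theorem finite_boxesMeeting {a : ℝ} (ha : 0 < a) {K : Set Plane} (hK : Bornology.IsBounded K) :
    (boxesMeeting a K).Finite := by
  obtain ⟨r, hr⟩ := hK.subset_closedBall 0
  obtain ⟨k, hk⟩ := exists_nat_ge (r / a)
  refine (Finset.finite_toSet (latSq (boxOf a 0) k)).subset ?_
  rintro _ ⟨p, hp, rfl⟩
  refine Finset.mem_coe.2 (mem_latSq.2 (near_boxOf ha ?_))
  have := Metric.mem_closedBall.1 (hr hp)
  rw [div_le_iff₀ ha] at hk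
  exact_mod_cast this.trans hk

/-- The closed box of side `a` with a given index. -/
def closedBox (a : ℝ) (z : ℤ × ℤ) : Set Plane :=
  planeRect (Set.Icc (a * z.1) (a * z.1 + a)) (Set.Icc (a * z.2) (a * z.2 + a))

theorem isClosed_closedBox (a : ℝ) (z : ℤ × ℤ) : IsClosed (closedBox a z) :=
  (isClosed_Icc.preimage (by fun_prop : Continuous fun p : Plane => p 0)).inter
    (isClosed_Icc.preimage (by fun_prop : Continuous fun p : Plane => p 1))

theorem mem_closedBox {a : ℝ} (ha : 0 < a) (p : Plane) : p ∈ closedBox a (boxOf a p) := by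
  have h : p ∈ boxSet a (boxOf a p) := rfl
  rw [boxSet_eq ha] at h
  exact ⟨Set.Ico_subset_Icc_self h.1, Set.Ico_subset_Icc_self h.2⟩

theorem nbr_of_closedBox {a : ℝ} (ha : 0 < a) {p : Plane} {z w : ℤ × ℤ} (hz : p ∈ closedBox a z)
    (hw : p ∈ closedBox a w) : Nbr z w := by
  have key : ∀ (x : ℝ) (k l : ℤ), x ∈ Set.Icc (a * k) (a * k + a) → x ∈ Set.Icc (a * l) (a * l + a) →
      k - l ≤ 1 := by
    rintro x k l ⟨h1, -⟩ ⟨-, h4⟩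
    have h5 : a * (k : ℝ) ≤ a * (l + 1) := by linarith
    have h6 := le_of_mul_le_mul_left h5 ha
    have h7 : k ≤ l + 1 := by exact_mod_cast h6
    omega
  have k1 := key _ _ _ hz.1 hw.1
  have k2 := key _ _ _ hw.1 hz.1
  have k3 := key _ _ _ hz.2 hw.2
  have k4 := key _ _ _ hw.2 hz.2
  unfold Nbr Near
  omega

/-- If the boxes fell into two unlinked classes, their closed versions would cover `K` by two closed
sets. These meet in `K`, and closed boxes with a common point are neighbours. -/
theorem boxesMeeting_linked {a : ℝ} (ha : 0 < a) {K : Set Plane} (hK : Bornology.IsBounded K)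
    (hc : IsPreconnected K) {z w : ℤ × ℤ} (hz : z ∈ boxesMeeting a K) (hw : w ∈ boxesMeeting a K) :
    Linked Nbr (boxesMeeting a K) z w := by
  by_contra hcon
  set S := boxesMeeting a K
  have hS : S.Finite := finite_boxesMeeting ha hK
  set A : Set (ℤ × ℤ) := {v | v ∈ S ∧ Linked Nbr S z v}
  set B : Set (ℤ × ℤ) := {v | v ∈ S ∧ ¬ Linked Nbr S z v}
  have hclosed : ∀ C : Set (ℤ × ℤ), C ⊆ S → IsClosed (⋃ u ∈ C, closedBox a u) :=
    fun C hC => (hS.subset hC).isClosed_biUnion fun u _ => isClosed_closedBox a u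
  obtain ⟨p, hp, hpz⟩ := hz
  obtain ⟨q, hq, hqw⟩ := hw
  have hcover : K ⊆ (⋃ u ∈ A, closedBox a u) ∪ ⋃ u ∈ B, closedBox a u := by
    intro t ht
    have htS : boxOf a t ∈ S := boxOf_mem_boxesMeeting ht
    by_cases hl : Linked Nbr S z (boxOf a t)
    · exact Or.inl (Set.mem_biUnion (show boxOf a t ∈ A from ⟨htS, hl⟩) (mem_closedBox ha t))
    · exact Or.inr (Set.mem_biUnion (show boxOf a t ∈ B from ⟨htS, hl⟩) (mem_closedBox ha t))
  obtain ⟨t, ht, htA, htB⟩ := isPreconnected_closed_iff.1 hc _ _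
    (hclosed A fun _ h => h.1) (hclosed B fun _ h => h.1) hcover
    ⟨p, hp, Set.mem_biUnion (show z ∈ A from ⟨⟨p, hp, hpz⟩, Linked.refl _⟩)
      (hpz ▸ mem_closedBox ha p)⟩
    ⟨q, hq, Set.mem_biUnion (show w ∈ B from ⟨⟨q, hq, hqw⟩, hcon⟩) (hqw ▸ mem_closedBox ha q)⟩
  simp only [Set.mem_iUnion] at htA htB
  obtain ⟨u, hu, htu⟩ := htA
  obtain ⟨v, hv, htv⟩ := htB
  exact hv.2 (hu.2.trans (Linked.single hu.1 hv.1 (nbr_of_closedBox ha htu htv)))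

theorem isBounded_segment (p q : Plane) : Bornology.IsBounded (segment ℝ p q) := by
  rw [← convexHull_pair, isBounded_convexHull]
  exact (Set.toFinite _).isBounded

theorem segment_linked {a : ℝ} (ha : 0 < a) {p q : Plane} {z w : ℤ × ℤ}
    (hz : z ∈ boxesMeeting a (segment ℝ p q)) (hw : w ∈ boxesMeeting a (segment ℝ p q)) :
    Linked Nbr (boxesMeeting a (segment ℝ p q)) z w :=
  boxesMeeting_linked ha (isBounded_segment p q) (convex_segment p q).isPreconnected hz hw

theorem near_of_mem_segment {a : ℝ} (ha : 0 < a) {p q : Plane} {c : ℤ × ℤ} {k : ℤ}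
    (hp : Near k (boxOf a p) c) (hq : Near k (boxOf a q) c) {z : ℤ × ℤ}
    (hz : z ∈ boxesMeeting a (segment ℝ p q)) : Near k z c := by
  obtain ⟨t, ht, rfl⟩ := hz
  have key : ∀ i : Fin 2, min ⌊p i / a⌋ ⌊q i / a⌋ ≤ ⌊t i / a⌋ ∧
      ⌊t i / a⌋ ≤ max ⌊p i / a⌋ ⌊q i / a⌋ := by
    intro i
    obtain ⟨s, s', hs, hs', hss, rfl⟩ := ht
    have e : (s • p + s' • q) i = s * p i + s' * q i := by simp
    rw [e]
    have hs1 : s = 1 - s' := by linarith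
    rcases le_total (p i) (q i) with h | h
    · constructor
      · refine (min_le_left _ _).trans (Int.floor_mono (div_le_div_of_nonneg_right ?_ ha.le))
        rw [hs1]; nlinarith
      · refine le_trans (Int.floor_mono (div_le_div_of_nonneg_right ?_ ha.le)) (le_max_right _ _)
        rw [hs1]; nlinarith
    · constructor
      · refine (min_le_right _ _).trans (Int.floor_mono (div_le_div_of_nonneg_right ?_ ha.le))
        rw [hs1]; nlinarith
      · refine le_trans (Int.floor_mono (div_le_div_of_nonneg_right ?_ ha.le)) (le_max_left _ _)
        rw [hs1]; nlinarith
  have h0 := key 0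
  have h1 := key 1
  unfold Near boxOf at *
  dsimp only at *
  omega

/-- An edge of the Voronoi triangulation near which there are no empty boxes is short. -/
theorem dist_le_of_adj {a : ℝ} (ha : 0 < a) {P : Set Plane} {u v : P}
    (h : (voronoiGraph P).Adj u v) {m : Plane} (hm : m ∈ segment ℝ (u : Plane) v)
    (hne : ∀ z, Near 6 z (boxOf a m) → (P ∩ boxSet a z).Nonempty) : dist (u : Plane) v ≤ 8 * a := by
  by_contra hlt
  push Not at hlt
  obtain ⟨-, t, ⟨htu, htv⟩, -⟩ := h.imp_right fun h => h.imp fun t ht => ht.imp_left fun h => h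
  have hρ : dist t u = dist t v := le_antisymm (htu v v.2) (htv u u.2)
  set L := dist (u : Plane) v with hL
  have hL0 : 0 < L := by linarith
  rw [segment_eq_image'] at hm
  obtain ⟨θ, ⟨hθ0, hθ1⟩, rfl⟩ := hm
  set d : Plane := (v : Plane) - u with hd
  have hdn : ‖d‖ = L := by rw [hd, ← dist_eq_norm, dist_comm]
  -- Move `m` along the edge by at most `4a` to a point `m'` at distance at least `4a` from both
  -- ends.
  obtain ⟨σ, h1, h2, h3⟩ : ∃ σ : ℝ, 4 * a ≤ σ * L ∧ 4 * a ≤ (1 - σ) * L ∧ |σ - θ| * L ≤ 4 * a := by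
    have h8 : 4 * a / L < 1 / 2 := by rw [div_lt_iff₀ hL0]; linarith
    have h4 : 4 * a / L * L = 4 * a := div_mul_cancel₀ _ hL0.ne'
    have h40 : 0 < 4 * a / L := by positivity
    rcases le_total θ (4 * a / L) with hθ | hθ
    · refine ⟨4 * a / L, h4.ge, by nlinarith, ?_⟩
      rw [abs_of_nonneg (by linarith)]; nlinarith
    · rcases le_total θ (1 - 4 * a / L) with hθ' | hθ'
      · refine ⟨θ, by nlinarith, by nlinarith, ?_⟩
        rw [sub_self, abs_zero, zero_mul]; positivity
      · refine ⟨1 - 4 * a / L, by nlinarith, by nlinarith, ?_⟩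
        rw [abs_of_nonpos (by linarith)]; nlinarith
  set m' : Plane := (u : Plane) + σ • d with hm'
  -- The point at distance `2a` from `m'` towards `t`; for `t = m'` the division by zero gives `c =
  -- m'`. Its box is within six of the box of `m`.
  set c : Plane := m' + (2 * a / ‖t - m'‖) • (t - m') with hc
  have hcm' : dist c m' ≤ 2 * a := by
    rw [hc, dist_eq_norm, add_sub_cancel_left, norm_smul, Real.norm_eq_abs,
      abs_of_nonneg (by positivity)]
    by_cases h0 : ‖t - m'‖ = 0
    · rw [h0]; simp; positivity
    · rw [div_mul_cancel₀ _ h0]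
  have hmm : dist m' ((u : Plane) + θ • d) ≤ 4 * a := by
    rw [hm', dist_eq_norm, add_sub_add_left_eq_sub, ← sub_smul, norm_smul, hdn, Real.norm_eq_abs]
    exact h3
  obtain ⟨q, hqP, hq⟩ := hne (boxOf a c) (near_boxOf ha (by
    push_cast
    linarith [dist_triangle c m' ((u : Plane) + θ • d)]))
  have hqc : dist q c ≤ 3 / 2 * a := dist_le_of_boxOf_eq ha hq
  have hqm : dist q m' ≤ 7 / 2 * a := by linarith [dist_triangle q c m']
  -- The shift by `2a` towards `t` outweighs the error `3a/2` in the position of `q`.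
  have hin : 0 ≤ inner ℝ (q - m') (t - m') := by
    have e : q - m' = (q - c) + (2 * a / ‖t - m'‖) • (t - m') := by rw [hc]; abel
    rw [e, inner_add_left, real_inner_smul_left, real_inner_self_eq_norm_sq]
    by_cases h0 : ‖t - m'‖ = 0
    · rw [norm_eq_zero.1 h0]; simp
    · have h5 := abs_real_inner_le_norm (q - c) (t - m')
      rw [← dist_eq_norm q c] at h5
      have h6 := (abs_le.1 h5).1
      have h7 : 2 * a / ‖t - m'‖ * ‖t - m'‖ ^ 2 = 2 * a * ‖t - m'‖ := by field_simp
      rw [h7]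
      nlinarith [norm_nonneg (t - m')]
  -- Power of the point `m'` with respect to the empty disc around `t` through `u` and `v`. It is at
  -- least `16 a²`, more than `(7a/2)²`, so `q` would lie inside the disc.
  have hpow : dist t m' ^ 2 + σ * L * ((1 - σ) * L) = dist t u ^ 2 := by
    have k1 : dist t u ^ 2 = dist t m' ^ 2 + 2 * σ * inner ℝ (t - m') d + σ ^ 2 * L ^ 2 := by
      rw [dist_eq_norm, dist_eq_norm, show t - (u : Plane) = (t - m') + σ • d by rw [hm']; abel,
        norm_add_sq_real, norm_smul, mul_pow, real_inner_smul_right, hdn, Real.norm_eq_abs, sq_abs]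
      ring
    have k2 : dist t v ^ 2 = dist t m' ^ 2 - 2 * (1 - σ) * inner ℝ (t - m') d +
        (1 - σ) ^ 2 * L ^ 2 := by
      rw [dist_eq_norm, dist_eq_norm, show t - (v : Plane) = (t - m') - (1 - σ) • d by
        rw [hm', hd, sub_smul, one_smul]; abel,
        norm_sub_sq_real, norm_smul, mul_pow, real_inner_smul_right, hdn, Real.norm_eq_abs, sq_abs]
      ring
    rw [← hρ] at k2
    linear_combination (-(1 - σ)) * k1 - σ * k2
  have hqt : dist t q ^ 2 ≤ dist q m' ^ 2 + dist t m' ^ 2 := by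
    rw [dist_comm t q, dist_eq_norm, dist_eq_norm, dist_eq_norm,
      show q - t = (q - m') - (t - m') by abel, norm_sub_sq_real]
    linarith
  have h16 : 16 * a ^ 2 ≤ σ * L * ((1 - σ) * L) := by nlinarith
  have hfin := htu q hqP
  have := pow_le_pow_left₀ dist_nonneg hfin 2
  nlinarith [dist_nonneg (x := q) (y := m')]

/-! ### Good boxes and regular configurations. -/

/-- The number of points of `P` in a box. -/
noncomputable def boxCount (a : ℝ) (P : Set Plane) (z : ℤ × ℤ) : ℕ := (P ∩ boxSet a z).ncard

/-- A box is good if no box near it is empty or has too many points. -/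
def GoodBox (a : ℝ) (P : Set Plane) (z : ℤ × ℤ) : Prop :=
  ∀ w, Near 12 w z → boxCount a P w ≠ 0 ∧ (boxCount a P w : ℝ) ≤ 3 * a ^ 2

/-- The regularity of a point configuration at scale `n` on which the deterministic part of the
argument is based. -/
structure Coarse (a : ℝ) (P : Set Plane) (n m : ℕ) (t : ℝ) : Prop where
  ha : 10 ^ 4 ≤ a
  fin : LocFinite a P
  peierls : PeierlsBound (fun z => penalty a (P ∩ boxSet a z).encard) (latSq 0 (2000 * n)) m t
  ht0 : 0 ≤ t
  ht : t ≤ n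
  hm1 : 1 ≤ m
  hm : m ≤ n

theorem penalty_nonneg (a : ℝ) (c : ℕ∞) : 0 ≤ penalty a c := by
  unfold penalty
  have : (0 : ℝ) ≤ if c.toNat = 0 ∨ 3 * a ^ 2 < c.toNat then a ^ 2 else 0 := by
    split_ifs <;> positivity
  have := le_max_right ((c.toNat : ℝ) - 3 * a ^ 2) 0
  linarith

theorem boxCount_le_penalty (a : ℝ) (P : Set Plane) (z : ℤ × ℤ) :
    (boxCount a P z : ℝ) ≤ 3 * a ^ 2 + penalty a (P ∩ boxSet a z).encard := by
  unfold penalty boxCount Set.ncard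
  have : (0 : ℝ) ≤ if (P ∩ boxSet a z).encard.toNat = 0 ∨
    3 * a ^ 2 < (P ∩ boxSet a z).encard.toNat then a ^ 2 else 0 := by split_ifs <;> positivity
  have := le_max_left (((P ∩ boxSet a z).encard.toNat : ℝ) - 3 * a ^ 2) 0
  linarith

theorem sq_le_penalty {a : ℝ} {P : Set Plane} {z : ℤ × ℤ}
    (h : ¬ (boxCount a P z ≠ 0 ∧ (boxCount a P z : ℝ) ≤ 3 * a ^ 2)) :
    a ^ 2 ≤ penalty a (P ∩ boxSet a z).encard := by
  unfold boxCount Set.ncard at h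
  unfold penalty
  rw [if_pos (by
    by_cases h0 : (P ∩ boxSet a z).encard.toNat = 0
    · exact Or.inl h0
    · exact Or.inr (lt_of_not_ge fun h1 => h ⟨h0, h1⟩))]
  have := le_max_right (((P ∩ boxSet a z).encard.toNat : ℝ) - 3 * a ^ 2) 0
  linarith

theorem rooted_latSq (c : ℤ × ℤ) {k : ℤ} (hk : 0 ≤ k) : Rooted {c} (latSq c k) := by
  refine ⟨Finset.singleton_subset_iff.2 (mem_latSq.2 (Near.rfl hk)), fun z hz => ⟨c, by simp, ?_⟩⟩
  exact linked_of_near (fun w hw => Finset.mem_coe.2 (mem_latSq.2 hw)) (mem_latSq.1 hz)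

namespace Coarse

variable {a t : ℝ} {P : Set Plane} {n m : ℕ} (h : Coarse a P n m t)

include h

theorem a_pos : 0 < a := by linarith [h.ha]

theorem sq_ge : 10 ^ 8 ≤ a ^ 2 := by nlinarith [h.ha]

theorem one_le_n : 1 ≤ n := h.hm1.trans h.hm

-- Each box that is not good has an empty or overcrowded box within distance `12`, and each such box
-- serves at most `25² = 625` others. It costs `a²`, while the total penalty of the
-- `12`-neighbourhood is at most `9 · 625 |F| + t`. Hence the density of boxes that are not good is
-- of order `1/a²`.
open Classical in
theorem sq_mul_card_not_good_le {r F : Finset (ℤ × ℤ)} (hr : Rooted r F)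
    (hF : ∀ z ∈ F, Near (1900 * n) z 0) (hm : m * r.card ≤ F.card) :
    a ^ 2 * (F.filter fun z => ¬ GoodBox a P z).card ≤ 625 * (5625 * F.card + t) := by
  have hn := h.one_le_n
  set T := thick 12 F
  set B := T.filter fun z => ¬ (boxCount a P z ≠ 0 ∧ (boxCount a P z : ℝ) ≤ 3 * a ^ 2)
  have hTc : (T.card : ℝ) ≤ 625 * F.card := by
    have := card_thick_le (k := 12) (by norm_num) F
    norm_num at this; exact_mod_cast this
  have hFT : F.card ≤ T.card := Finset.card_le_card (subset_thick (by norm_num) F)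
  have hsum := h.peierls r T (hr.thick (by norm_num)) (by
    intro z hz
    obtain ⟨c, hc, hzc⟩ := mem_thick.1 hz
    have := hF c hc
    rw [mem_latSq]
    unfold Near at *
    omega) (hm.trans hFT)
  have hB : a ^ 2 * B.card ≤ ∑ z ∈ T, penalty a (P ∩ boxSet a z).encard := by
    calc a ^ 2 * B.card = ∑ _z ∈ B, a ^ 2 := by rw [Finset.sum_const, nsmul_eq_mul, mul_comm]
      _ ≤ ∑ z ∈ B, penalty a (P ∩ boxSet a z).encard :=
        Finset.sum_le_sum fun z hz => sq_le_penalty (Finset.mem_filter.1 hz).2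
      _ ≤ _ := Finset.sum_le_sum_of_subset_of_nonneg (Finset.filter_subset _ _)
        fun z _ _ => penalty_nonneg _ _
  have hsub : (F.filter fun z => ¬ GoodBox a P z) ⊆ thick 12 B := by
    intro z hz
    obtain ⟨hzF, hzg⟩ := Finset.mem_filter.1 hz
    unfold GoodBox at hzg
    push Not at hzg
    obtain ⟨w, hw, hw0⟩ := hzg
    refine mem_thick.2 ⟨w, Finset.mem_filter.2 ⟨mem_thick.2 ⟨z, hzF, hw⟩, ?_⟩, hw.symm⟩
    exact fun hcon => absurd (hw0 hcon.1) (not_lt.2 hcon.2)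
  have hc : ((F.filter fun z => ¬ GoodBox a P z).card : ℝ) ≤ 625 * B.card := by
    have h1 := Finset.card_le_card hsub
    have h2 := card_thick_le (k := 12) (by norm_num) B
    norm_num at h2
    exact_mod_cast (Nat.cast_le (α := ℤ).2 h1).trans h2
  have h3 : a ^ 2 * B.card ≤ 5625 * F.card + t := by linarith
  have := mul_le_mul_of_nonneg_left hc (by positivity : 0 ≤ a ^ 2)
  linarith

open Classical in
theorem card_not_good_le {r F : Finset (ℤ × ℤ)} (hr : Rooted r F)
    (hF : ∀ z ∈ F, Near (1900 * n) z 0) (hm : m * r.card ≤ F.card) :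
    ((F.filter fun z => ¬ GoodBox a P z).card : ℝ) ≤ F.card / 8 + t := by
  have h1 := h.sq_mul_card_not_good_le hr hF hm
  have h2 := mul_le_mul_of_nonneg_right h.sq_ge
    (by positivity : (0 : ℝ) ≤ (F.filter fun z => ¬ GoodBox a P z).card)
  have := h.ht0
  have : (0 : ℝ) ≤ F.card := by positivity
  linarith

theorem sum_boxCount_le {c : ℤ × ℤ} {R : ℤ} (hR : 0 ≤ R) (hm : (m : ℤ) ≤ (2 * R + 1) ^ 2)
    (hc : Near (2000 * n - R) c 0) :
    ∑ z ∈ latSq c R, (boxCount a P z : ℝ) ≤ (3 * a ^ 2 + 9) * (2 * R + 1) ^ 2 + t := by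
  have hcard : ((latSq c R).card : ℝ) = (2 * R + 1) ^ 2 := by exact_mod_cast card_latSq c hR
  have h1 := h.peierls {c} (latSq c R) (rooted_latSq c hR) (by
    intro z hz
    have hz := mem_latSq.1 hz
    rw [mem_latSq]
    unfold Near at *
    omega) (by
      have := card_latSq c hR
      rw [Finset.card_singleton, mul_one]
      exact_mod_cast hm.trans this.ge)
  calc ∑ z ∈ latSq c R, (boxCount a P z : ℝ)
      ≤ ∑ z ∈ latSq c R, (3 * a ^ 2 + penalty a (P ∩ boxSet a z).encard) :=
        Finset.sum_le_sum fun z _ => boxCount_le_penalty a P z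
    _ = 3 * a ^ 2 * (2 * R + 1) ^ 2 + ∑ z ∈ latSq c R, penalty a (P ∩ boxSet a z).encard := by
        rw [Finset.sum_add_distrib, Finset.sum_const, nsmul_eq_mul, hcard, mul_comm]
    _ ≤ _ := by rw [hcard] at h1; linarith

/-- The number of points of `P` in the boxes of a square. -/
theorem card_points_le {c : ℤ × ℤ} {R : ℤ} (hR : 0 ≤ R) (hm : (m : ℤ) ≤ (2 * R + 1) ^ 2)
    (hc : Near (2000 * n - R) c 0) {S : Finset Plane} (hS : ∀ p ∈ S, p ∈ P)
    (hSc : ∀ p ∈ S, Near R (boxOf a p) c) :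
    (S.card : ℝ) ≤ (3 * a ^ 2 + 9) * (2 * R + 1) ^ 2 + t := by
  classical
  refine le_trans ?_ (h.sum_boxCount_le hR hm hc)
  have h1 : S.card ≤ ∑ z ∈ latSq c R, boxCount a P z := by
    rw [Finset.card_eq_sum_card_fiberwise (f := boxOf a) (t := latSq c R)
      fun p hp => Finset.mem_coe.2 (mem_latSq.2 (hSc p hp))]
    refine Finset.sum_le_sum fun z _ => ?_
    unfold boxCount
    rw [← Set.ncard_coe_finset]
    refine Set.ncard_le_ncard (fun p hp => ?_) (h.fin z)
    have hp := Finset.mem_filter.1 (Finset.mem_coe.1 hp)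
    exact ⟨hS p hp.1, hp.2⟩
  exact_mod_cast h1

/-- Each square of radius `n` has a point of `P`. -/
theorem exists_near {c : ℤ × ℤ} (hc : Near (1900 * n) c 0) :
    ∃ p ∈ P, Near n (boxOf a p) c := by
  by_contra! hcon
  have hn := h.one_le_n
  have hcard : ((latSq c n).card : ℝ) = (2 * n + 1) ^ 2 := by
    exact_mod_cast card_latSq c (k := n) (by positivity)
  have h1 := h.peierls {c} (latSq c n) (rooted_latSq c (by positivity)) (by
    intro z hz
    have hz := mem_latSq.1 hz
    rw [mem_latSq]
    unfold Near at *
    omega) (by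
      rw [Finset.card_singleton, mul_one]
      have h2 : (m : ℝ) ≤ (latSq c n).card := by
        rw [hcard]
        have : (m : ℝ) ≤ n := by exact_mod_cast h.hm
        nlinarith
      exact_mod_cast h2)
  -- If all boxes of the square were empty, each would cost `a² ≥ 10^8`, far more than the allowance
  -- of `9`.
  have h2 : ∑ _z ∈ latSq c n, a ^ 2 ≤ ∑ z ∈ latSq c n, penalty a (P ∩ boxSet a z).encard := by
    refine Finset.sum_le_sum fun z hz => sq_le_penalty fun hcon' => hcon'.1 ?_
    unfold boxCount
    rw [Set.ncard_eq_zero (h.fin z), Set.eq_empty_iff_forall_notMem]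
    rintro p ⟨hp, hpz⟩
    exact hcon p hp (by rw [show boxOf a p = z from hpz]; exact mem_latSq.1 hz)
  rw [Finset.sum_const, nsmul_eq_mul, hcard] at h2
  rw [hcard] at h1
  have := h.sq_ge
  have := h.ht
  have hn' : (1 : ℝ) ≤ n := by exact_mod_cast hn
  nlinarith

theorem near_of_nearest {o : Plane} (ho : ∀ y ∈ P, dist 0 o ≤ dist 0 y) :
    Near (3 * n) (boxOf a o) 0 := by
  have hn : (1 : ℝ) ≤ n := by exact_mod_cast h.one_le_n
  have h0 : boxOf a 0 = 0 := by simp [boxOf]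
  obtain ⟨p, hp, hpn⟩ := h.exists_near (c := 0) (Near.rfl (by positivity))
  rw [← h0] at hpn ⊢
  have h1 := dist_le_of_near h.a_pos hpn
  have h2 := ho p hp
  rw [dist_comm 0 o, dist_comm 0 p] at h2
  refine near_boxOf h.a_pos (h2.trans (h1.trans ?_))
  push_cast
  nlinarith [h.a_pos]

end Coarse

/-! ### Geodesics towards `o` and the boxes they meet. -/

section Paths

variable {V : Type*} {G : SimpleGraph V} {o : V}

open Classical in
/-- A neighbour that is closer to `o`. -/
noncomputable def toward (G : SimpleGraph V) (o v : V) : V :=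
  if h : ∃ w, G.Adj v w ∧ G.edist o w + 1 ≤ G.edist o v then h.choose else v

theorem toward_adj_or_eq (v : V) : G.Adj v (toward G o v) ∨ toward G o v = v := by
  unfold toward
  split_ifs with h
  · exact Or.inl h.choose_spec.1
  · exact Or.inr rfl

theorem exists_toward {v : V} (hv : G.edist o v ≠ ⊤) (hne : v ≠ o) :
    ∃ w, G.Adj v w ∧ G.edist o w + 1 ≤ G.edist o v := by
  obtain ⟨p, hp⟩ := SimpleGraph.exists_walk_of_edist_ne_top hv
  induction p using SimpleGraph.Walk.concatRec with
  | Hnil => exact absurd rfl hne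
  | Hconcat p hadj _ =>
    refine ⟨_, hadj.symm, ?_⟩
    rw [← hp, SimpleGraph.Walk.length_concat]
    push_cast
    exact add_le_add_left (SimpleGraph.edist_le p) 1

/-- Each step lowers the distance by at least one until `o` is reached, where the map stays put. -/
theorem edist_iterate_toward {v : V} {n : ℕ} (hv : G.edist o v ≤ n) (j : ℕ) (hj : j ≤ n) :
    G.edist o ((toward G o)^[j] v) + j ≤ n ∨ (toward G o)^[j] v = o := by
  induction j with
  | zero => left; simpa using hv
  | succ j ih =>
    rw [Function.iterate_succ_apply']
    have hfix : toward G o o = o := by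
      unfold toward
      refine dif_neg ?_
      rintro ⟨w, -, h2⟩
      simp at h2
    rcases ih (by omega) with h | h
    · set w := (toward G o)^[j] v
      by_cases hw : w = o
      · right; rw [hw, hfix]
      · left
        have htop : G.edist o w ≠ ⊤ := by
          intro htop
          rw [htop, top_add] at h
          exact absurd h (by simp)
        have hex := exists_toward htop hw
        have h2 : G.edist o (toward G o w) + 1 ≤ G.edist o w := by
          unfold toward
          rw [dif_pos hex]
          exact hex.choose_spec.2
        calc G.edist o (toward G o w) + ((j + 1 : ℕ) : ℕ∞)
            = (G.edist o (toward G o w) + 1) + j := by push_cast; ring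
          _ ≤ G.edist o w + j := add_le_add_left h2 _
          _ ≤ n := h
    · right; rw [h, hfix]

theorem edist_iterate_toward_le {v : V} {n : ℕ} (hv : G.edist o v ≤ n) (j : ℕ) (hj : j ≤ n) :
    G.edist o ((toward G o)^[j] v) ≤ (n - j : ℕ) := by
  rcases edist_iterate_toward hv j hj with h | h
  · have h2 : ((n : ℕ) : ℕ∞) = ((n - j : ℕ) : ℕ∞) + j := by
      rw [← Nat.cast_add]; congr 1; omega
    rw [h2] at h
    exact (ENat.add_le_add_iff_right (by simp)).1 h
  · rw [h, SimpleGraph.edist_self]; exact zero_le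

theorem iterate_toward_eq {v : V} {n : ℕ} (hv : G.edist o v ≤ n) : (toward G o)^[n] v = o := by
  have := edist_iterate_toward_le hv n le_rfl
  rw [Nat.sub_self, Nat.cast_zero, nonpos_iff_eq_zero, SimpleGraph.edist_eq_zero_iff] at this
  exact this.symm

theorem iterate_toward_mem {v : V} {n : ℕ} (hv : G.edist o v ≤ n) (j : ℕ) :
    G.edist o ((toward G o)^[j] v) ≤ n := by
  induction j with
  | zero => exact hv
  | succ j ih =>
    rw [Function.iterate_succ_apply']
    have h1 := edist_iterate_toward_le ih (min 1 n) (min_le_right _ _)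
    rcases Nat.eq_zero_or_pos n with rfl | hn
    · have := iterate_toward_eq ih
      have hfix := iterate_toward_eq (G := G) (o := o) (v := o) (n := 1) (by simp)
      simp only [Function.iterate_zero, id] at this
      rw [this]
      simp only [Function.iterate_one] at hfix
      rw [hfix]; simp
    · rw [min_eq_left hn, Function.iterate_one] at h1
      exact h1.trans (by exact_mod_cast Nat.sub_le _ _)

end Paths

/-- The boxes met by the first `j` edges of the path from `v` towards `o`. -/
def pathBoxes (a : ℝ) {P : Set Plane} (o v : P) (j : ℕ) : Set (ℤ × ℤ) :=
  ⋃ i < j + 1, boxesMeeting a (segment ℝ (((toward (voronoiGraph P) o)^[i] v : P) : Plane)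
    ((toward (voronoiGraph P) o)^[i + 1] v : P))

section PathBoxes

variable {a : ℝ} {P : Set Plane} {o v : P}

theorem mem_pathBoxes {i j : ℕ} (hij : i ≤ j) :
    boxOf a ((toward (voronoiGraph P) o)^[i] v : P) ∈ pathBoxes a o v j :=
  Set.mem_biUnion (show i < j + 1 by omega) (boxOf_mem_boxesMeeting (left_mem_segment ℝ _ _))

theorem finite_pathBoxes (ha : 0 < a) (j : ℕ) : (pathBoxes a o v j).Finite :=
  (Set.finite_lt_nat _).biUnion fun _ _ => finite_boxesMeeting ha (isBounded_segment _ _)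

theorem pathBoxes_linked (ha : 0 < a) {j : ℕ} {z : ℤ × ℤ} (hz : z ∈ pathBoxes a o v j) :
    Linked Nbr (pathBoxes a o v j) (boxOf a v) z := by
  have hsub : ∀ i < j + 1, boxesMeeting a (segment ℝ (((toward (voronoiGraph P) o)^[i] v : P) : Plane)
    ((toward (voronoiGraph P) o)^[i + 1] v : P)) ⊆ pathBoxes a o v j := fun i hi =>
    Set.subset_biUnion_of_mem (u := fun i => boxesMeeting a
      (segment ℝ (((toward (voronoiGraph P) o)^[i] v : P) : Plane)
        ((toward (voronoiGraph P) o)^[i + 1] v : P))) (show i ∈ {i | i < j + 1} from hi)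
  have hv : ∀ i ≤ j, Linked Nbr (pathBoxes a o v j) (boxOf a v)
      (boxOf a ((toward (voronoiGraph P) o)^[i] v : P)) := by
    intro i
    induction i with
    | zero => intro _; exact Linked.refl _
    | succ i ih =>
      intro hi
      refine (ih (by omega)).trans ((segment_linked ha
        (boxOf_mem_boxesMeeting (left_mem_segment ℝ _ _))
        (boxOf_mem_boxesMeeting (right_mem_segment ℝ _ _))).mono (hsub i (by omega)))
  simp only [pathBoxes, Set.mem_iUnion] at hz
  obtain ⟨i, hi, hz⟩ := hz
  exact (hv i (by omega)).trans ((segment_linked ha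
    (boxOf_mem_boxesMeeting (left_mem_segment ℝ _ _)) hz).mono (hsub i hi))

/-- An edge through a good box has length at most `8a`, so its starting vertex is within eight
boxes. -/
theorem good_pathBoxes (ha : 0 < a) {j : ℕ} {z : ℤ × ℤ} (hz : z ∈ pathBoxes a o v j)
    (hg : GoodBox a P z) :
    ∃ i < j + 1, Near 8 z (boxOf a ((toward (voronoiGraph P) o)^[i] v : P)) := by
  simp only [pathBoxes, Set.mem_iUnion] at hz
  obtain ⟨i, hi, p, hp, rfl⟩ := hz
  refine ⟨i, hi, ?_⟩
  rw [Function.iterate_succ_apply'] at hp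
  set w := (toward (voronoiGraph P) o)^[i] v
  rcases toward_adj_or_eq (G := voronoiGraph P) (o := o) w with hadj | heq
  · have h1 := dist_le_of_adj ha hadj hp fun z hz => by
      have := (hg z (hz.mono (by norm_num))).1
      exact Set.nonempty_of_ncard_ne_zero this
    refine near_boxOf ha ?_
    have h2 := dist_add_dist_of_mem_segment hp
    rw [dist_comm (w : Plane) p] at h2
    have h3 := dist_nonneg (x := p) (y := ((toward (voronoiGraph P) o w : P) : Plane))
    push_cast
    linarith
  · rw [heq, segment_same] at hp
    rw [Set.mem_singleton_iff.1 hp]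
    exact Near.rfl (by norm_num)

-- Good boxes on a path are paid for by its vertices: each vertex accounts for at most `17² = 289`
-- of them. Only bad boxes can make a path longer than its number of steps suggests.
open Classical in
theorem card_good_pathBoxes_le (ha : 0 < a) {j : ℕ} {F : Finset (ℤ × ℤ)}
    (hF : ∀ z ∈ F, z ∈ pathBoxes a o v j ∧ GoodBox a P z) : F.card ≤ 289 * (j + 1) := by
  have hsub : F ⊆ (Finset.range (j + 1)).biUnion fun i =>
      latSq (boxOf a ((toward (voronoiGraph P) o)^[i] v : P)) 8 := by
    intro z hz
    obtain ⟨i, hi, hn⟩ := good_pathBoxes ha (hF z hz).1 (hF z hz).2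
    exact Finset.mem_biUnion.2 ⟨i, Finset.mem_range.2 hi, mem_latSq.2 hn⟩
  refine (Finset.card_le_card hsub).trans (Finset.card_biUnion_le.trans ?_)
  have : ∀ c : ℤ × ℤ, (latSq c 8).card = 289 := by
    intro c
    have := card_latSq c (k := 8) (by norm_num)
    norm_num at this
    exact_mod_cast this
  simp only [this, Finset.sum_const, Finset.card_range, smul_eq_mul]
  omega

end PathBoxes


open Classical in
/-- The part of a connected set inside a square, as seen from one of its points. -/
theorem exists_truncation {S : Set (ℤ × ℤ)} {c x b : ℤ × ℤ} {R : ℤ} (hc : c ∈ S)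
    (hcR : Near R c b) (h : Linked Nbr S c x) :
    ∃ F : Finset (ℤ × ℤ), Rooted {c} F ∧ (∀ z ∈ F, z ∈ S ∧ Near R z b) ∧
      (x ∈ F ∨ ∃ u ∈ F, ¬ Near (R - 1) u b) := by
  set T : Set (ℤ × ℤ) := {z | z ∈ S ∧ Near R z b}
  have hcT : c ∈ T := ⟨hc, hcR⟩
  set F := (latSq b R).filter fun z => Linked Nbr T c z
  have hmem : ∀ z, z ∈ F ↔ Linked Nbr T c z := fun z => by
    refine ⟨fun hz => (Finset.mem_filter.1 hz).2, fun hz => Finset.mem_filter.2 ⟨?_, hz⟩⟩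
    exact mem_latSq.2 (hz.mem hcT).2
  have hcF : c ∈ F := (hmem c).2 (Linked.refl c)
  refine ⟨F, ⟨Finset.singleton_subset_iff.2 hcF, fun z hz => ⟨c, by simp, ?_⟩⟩,
    fun z hz => ((hmem z).1 hz).mem hcT, ?_⟩
  · exact ((hmem z).1 hz).self_set.mono fun w hw => Finset.mem_coe.2 ((hmem w).2 hw)
  · by_cases hx : x ∈ F
    · exact Or.inl hx
    · right
      -- The chain to `x` leaves `F` at a step from `u` to `v`. As `v` is in `S`, it can only fail
      -- to be in the square, so `u` is at its border.
      obtain ⟨u, v, hu, hv, huv, huF, hvF⟩ := h.exists_step (p := (· ∈ F)) hcF hx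
      refine ⟨u, huF, fun hcon => hvF ((hmem v).2 (((hmem u).1 huF).trans ?_))⟩
      refine Linked.single (((hmem u).1 huF).mem hcT) ⟨hv, ?_⟩ huv
      have := huv.symm.trans hcon
      exact this.mono (by omega)

open Classical in
/-- All points at graph distance at most `n` from the nearest point to the origin lie in a square
of size linear in `n`. -/
theorem Coarse.near_of_edist_le {a t : ℝ} {P : Set Plane} {n m : ℕ} (h : Coarse a P n m t) {o : P}
    (ho : ∀ y ∈ P, dist (0 : Plane) o ≤ dist 0 y) {v : P}
    (hv : (voronoiGraph P).edist o v ≤ n) : Near (1000 * n) (boxOf a (v : Plane)) 0 := by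
  by_contra hcon
  have hn := h.one_le_n
  have ha := h.a_pos
  have hon := h.near_of_nearest ho
  have hoF : boxOf a (o : Plane) ∈ pathBoxes a o v n := by
    have := mem_pathBoxes (a := a) (o := o) (v := v) (le_refl n)
    rwa [iterate_toward_eq hv] at this
  have hpath : Linked Nbr (pathBoxes a o v n) (boxOf a o) (boxOf a v) :=
    (pathBoxes_linked ha hoF).symm nbr_symm
  obtain ⟨F, hF, hFS, hx⟩ := exists_truncation (b := 0) (R := 1000 * n) hoF
    (hon.mono (by omega)) hpath
  have hx : ∃ u ∈ F, ¬ Near (1000 * n - 1) u 0 := by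
    rcases hx with hx | hx
    · exact absurd (hFS _ hx).2 hcon
    · exact hx
  obtain ⟨u, huF, hu⟩ := hx
  -- The truncated path runs from the root, within `3n`, to the border at `1000n`. At most an eighth
  -- of its boxes plus `t` are not good and at most `289(n+1)` are good, which is too few.
  have hcard : 997 * n ≤ F.card := by
    obtain ⟨c, hc, hlink⟩ := hF.2 u huF
    rw [Finset.mem_singleton] at hc
    subst hc
    have h1 := (card_of_linked (hF.1 (Finset.mem_singleton_self _)) hlink).trans hon
    by_contra hlt
    exact hu (h1.mono (by omega))
  have h1 := h.card_not_good_le hF (fun z hz => (hFS z hz).2.mono (by omega)) (by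
    rw [Finset.card_singleton]; have := h.hm; omega)
  have h2 := card_good_pathBoxes_le (P := P) ha (F := F.filter fun z => GoodBox a P z)
    fun z hz => ⟨(hFS z (Finset.mem_filter.1 hz).1).1, (Finset.mem_filter.1 hz).2⟩
  have h3 := Finset.card_filter_add_card_filter_not (s := F) (fun z => GoodBox a P z)
  have h4 := h.ht
  have hn' : (1 : ℝ) ≤ n := by exact_mod_cast hn
  have h2' : ((F.filter fun z => GoodBox a P z).card : ℝ) ≤ 289 * (n + 1) := by exact_mod_cast h2
  have h3' : ((F.filter fun z => GoodBox a P z).card : ℝ) +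
    (F.filter fun z => ¬ GoodBox a P z).card = F.card := by exact_mod_cast h3
  have hcard' : (997 : ℝ) * n ≤ F.card := by exact_mod_cast hcard
  linarith

/-! ### Cells around a good box. -/

theorem isOpen_planeRect {I J : Set ℝ} (hI : IsOpen I) (hJ : IsOpen J) : IsOpen (planeRect I J) :=
  (hI.preimage (by fun_prop : Continuous fun p : Plane => p 0)).inter
    (hJ.preimage (by fun_prop : Continuous fun p : Plane => p 1))

theorem convex_planeRect {I J : Set ℝ} (hI : Convex ℝ I) (hJ : Convex ℝ J) :
    Convex ℝ (planeRect I J) :=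
  (hI.linear_preimage (PiLp.proj (𝕜 := ℝ) 2 (fun _ : Fin 2 => ℝ) 0).toLinearMap).inter
    (hJ.linear_preimage (PiLp.proj (𝕜 := ℝ) 2 (fun _ : Fin 2 => ℝ) 1).toLinearMap)

/-- The open square around a box that covers all boxes near it. -/
def bigBox (a : ℝ) (w : ℤ × ℤ) : Set Plane :=
  planeRect (Set.Ioo (a * (w.1 - 9)) (a * (w.1 + 10))) (Set.Ioo (a * (w.2 - 9)) (a * (w.2 + 10)))

theorem isOpen_bigBox (a : ℝ) (w : ℤ × ℤ) : IsOpen (bigBox a w) :=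
  isOpen_planeRect isOpen_Ioo isOpen_Ioo

theorem convex_bigBox (a : ℝ) (w : ℤ × ℤ) : Convex ℝ (bigBox a w) :=
  convex_planeRect (convex_Ioo _ _) (convex_Ioo _ _)

theorem near_of_mem_bigBox {a : ℝ} (ha : 0 < a) {w : ℤ × ℤ} {p : Plane} (hp : p ∈ bigBox a w) :
    Near 9 (boxOf a p) w := by
  have key : ∀ (x : ℝ) (k : ℤ), x ∈ Set.Ioo (a * (k - 9)) (a * (k + 10)) →
      -9 ≤ ⌊x / a⌋ - k ∧ ⌊x / a⌋ - k ≤ 9 := by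
    rintro x k ⟨h1, h2⟩
    have h3 : k - 9 ≤ ⌊x / a⌋ := Int.le_floor.2 (by
      rw [le_div_iff₀ ha]; push_cast; linarith)
    have h4 : ⌊x / a⌋ < k + 10 := Int.floor_lt.2 (by
      rw [div_lt_iff₀ ha]; push_cast; linarith)
    omega
  have h0 := key _ _ hp.1
  have h1 := key _ _ hp.2
  exact ⟨h0.1, h0.2, h1.1, h1.2⟩

theorem mem_bigBox {a : ℝ} (ha : 0 < a) {w : ℤ × ℤ} {p : Plane} (hp : Near 8 (boxOf a p) w) :
    p ∈ bigBox a w := by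
  have key : ∀ (x : ℝ) (k : ℤ), -8 ≤ ⌊x / a⌋ - k → ⌊x / a⌋ - k ≤ 8 →
      x ∈ Set.Ioo (a * (k - 9)) (a * (k + 10)) := by
    intro x k h1 h2
    have h3 : k - 8 ≤ ⌊x / a⌋ := by omega
    have h4 : ⌊x / a⌋ < k + 9 := by omega
    have h3 := Int.le_floor.1 h3
    have h4 := Int.floor_lt.1 h4
    rw [le_div_iff₀ ha] at h3
    rw [div_lt_iff₀ ha] at h4
    push_cast at h3 h4
    constructor <;> nlinarith
  unfold Near at hp
  exact ⟨key _ _ hp.1 hp.2.1, key _ _ hp.2.2.1 hp.2.2.2⟩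

theorem isBounded_bigBox {a : ℝ} (ha : 0 < a) (w : ℤ × ℤ) : Bornology.IsBounded (bigBox a w) := by
  rcases Set.eq_empty_or_nonempty (bigBox a w) with h | ⟨q, hq⟩
  · rw [h]; exact Bornology.isBounded_empty
  refine (Metric.isBounded_closedBall (x := q) (r := 3 / 2 * (((18 : ℤ) + 1) * a))).subset
    fun p hp => Metric.mem_closedBall.2 (dist_le_of_near ha ?_)
  exact (near_of_mem_bigBox ha hp).trans (near_of_mem_bigBox ha hq).symm

/-- A point whose cell contains a given point lies in a nearby box if the box of the given point
is not empty. -/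
theorem near_of_mem_voronoiCell {a : ℝ} (ha : 0 < a) {P : Set Plane} {x t : Plane}
    (ht : t ∈ voronoiCell P x) (hne : boxCount a P (boxOf a t) ≠ 0) :
    Near 2 (boxOf a x) (boxOf a t) := by
  obtain ⟨q, hqP, hq⟩ := Set.nonempty_of_ncard_ne_zero hne
  have h1 := dist_le_of_boxOf_eq ha hq
  have h2 := ht q hqP
  refine near_boxOf ha ?_
  rw [dist_comm] at h1 h2
  rw [dist_comm t q, dist_comm q t] at h2
  push_cast
  linarith

/-- The cell is met within nine boxes of `w`, in an occupied box, and the nucleus is within two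
boxes of that point. The radius `12` in the definition of a good box leaves room for `9 + 2`. -/
theorem near_of_mem_cellsMeeting_bigBox {a : ℝ} (ha : 0 < a) {P : Set Plane} {w : ℤ × ℤ}
    (hw : GoodBox a P w) {x : P} (hx : x ∈ cellsMeeting P (bigBox a w)) :
    Near 11 (boxOf a (x : Plane)) w := by
  obtain ⟨t, ht, htw⟩ := hx
  have h1 := near_of_mem_bigBox ha htw
  exact (near_of_mem_voronoiCell ha ht (hw _ (h1.mono (by norm_num))).1).trans h1

/-- The nuclei lie in the `23² = 529` boxes within distance eleven, each with at most `3a²` points.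
-/
theorem ncard_cellsMeeting_bigBox_le {a : ℝ} (ha : 0 < a) {P : Set Plane} (hP : LocFinite a P)
    {w : ℤ × ℤ} (hw : GoodBox a P w) :
    ((cellsMeeting P (bigBox a w)).ncard : ℝ) ≤ 1587 * a ^ 2 := by
  classical
  have hfin := finite_cellsMeeting ha hP (isBounded_bigBox ha w)
  set S := hfin.toFinset.image (Subtype.val : P → Plane)
  have hS : (cellsMeeting P (bigBox a w)).ncard = S.card := by
    rw [Finset.card_image_of_injective _ Subtype.val_injective, Set.ncard_eq_toFinset_card _ hfin]
  have h1 : S.card ≤ ∑ z ∈ latSq w 11, boxCount a P z := by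
    rw [Finset.card_eq_sum_card_fiberwise (f := boxOf a) (t := latSq w 11)
      fun p hp => by
        obtain ⟨x, hx, rfl⟩ := Finset.mem_image.1 hp
        exact Finset.mem_coe.2 (mem_latSq.2
          (near_of_mem_cellsMeeting_bigBox ha hw (hfin.mem_toFinset.1 hx)))]
    refine Finset.sum_le_sum fun z _ => ?_
    unfold boxCount
    rw [← Set.ncard_coe_finset]
    refine Set.ncard_le_ncard (fun p hp => ?_) (hP z)
    have hp := Finset.mem_filter.1 (Finset.mem_coe.1 hp)
    obtain ⟨x, hx, rfl⟩ := Finset.mem_image.1 hp.1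
    exact ⟨x.2, hp.2⟩
  have h2 : ∑ z ∈ latSq w 11, (boxCount a P z : ℝ) ≤ (latSq w 11).card * (3 * a ^ 2) := by
    rw [← nsmul_eq_mul]
    refine Finset.sum_le_card_nsmul _ _ _ fun z hz => (hw z ?_).2
    exact (mem_latSq.1 hz).mono (by norm_num)
  have h3 : ((latSq w 11).card : ℝ) = 529 := by
    have := card_latSq w (k := 11) (by norm_num)
    norm_num at this; exact_mod_cast this
  rw [hS]
  have h1' : (S.card : ℝ) ≤ ∑ z ∈ latSq w 11, (boxCount a P z : ℝ) := by exact_mod_cast h1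
  rw [h3] at h2
  linarith

/-- A short edge that meets a good box joins two points whose cells meet the square around
the box. -/
theorem mem_cellsMeeting_of_adj {a : ℝ} (ha : 0 < a) {P : Set Plane} {u v : P}
    (h : (voronoiGraph P).Adj u v) {w : ℤ × ℤ} (hw : GoodBox a P w)
    (hm : w ∈ boxesMeeting a (segment ℝ (u : Plane) v)) :
    u ∈ cellsMeeting P (bigBox a w) ∧ v ∈ cellsMeeting P (bigBox a w) := by
  obtain ⟨p, hp, rfl⟩ := hm
  have hd := dist_le_of_adj ha h hp fun z hz =>
    Set.nonempty_of_ncard_ne_zero (hw z (hz.mono (by norm_num))).1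
  have h2 := dist_add_dist_of_mem_segment hp
  have hself : ∀ x : P, (x : Plane) ∈ voronoiCell P x := fun x y _ => by simp
  refine ⟨⟨u, hself u, mem_bigBox ha (near_boxOf ha ?_)⟩, ⟨v, hself v, mem_bigBox ha
    (near_boxOf ha ?_)⟩⟩
  · push_cast; linarith [dist_nonneg (x := p) (y := (v : Plane))]
  · rw [dist_comm]; push_cast; linarith [dist_nonneg (x := (u : Plane)) (y := p)]

/-! ### Barriers, pockets and rims. -/

/-- The boxes near a point of `D`. -/
def touched (a : ℝ) {P : Set Plane} (D : Finset P) : Set (ℤ × ℤ) :=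
  {z | ∃ d ∈ D, Near 12 (boxOf a (d : Plane)) z}

/-- The boxes in a large window that are not good or near a point of `D`. -/
def obstacles (a : ℝ) {P : Set Plane} (n : ℕ) (D : Finset P) : Set (ℤ × ℤ) :=
  {z | Near (1500 * n) z 0 ∧ (¬ GoodBox a P z ∨ z ∈ touched a D)}

/-- The connected clusters of obstacles around the points of `D`. -/
def barrier (a : ℝ) {P : Set Plane} (n : ℕ) (D : Finset P) : Set (ℤ × ℤ) :=
  {z | ∃ y ∈ touched a D, Linked Nbr (obstacles a n D) y z}

/-- The barrier with its holes filled. -/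
def shielded (a : ℝ) {P : Set Plane} (n : ℕ) (D : Finset P) : Set (ℤ × ℤ) :=
  fillIn (barrier a n D) (1100 * n)

/-- The component of the filled barrier that contains a box. -/
def pocket (a : ℝ) {P : Set Plane} (n : ℕ) (D : Finset P) (g : ℤ × ℤ) : Set (ℤ × ℤ) :=
  compOf (shielded a n D) g

/-- The number of boxes on the inner boundary of a component of the filled barrier. -/
noncomputable def perim (a : ℝ) {P : Set Plane} (n : ℕ) (D : Finset P) (g : ℤ × ℤ) : ℕ :=
  (innerBdry (pocket a n D g)).ncard

/-- The points of `P` around a component of the filled barrier. -/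
def rim (a : ℝ) {P : Set Plane} (n : ℕ) (D : Finset P) (g : ℤ × ℤ) : Set P :=
  ⋃ w ∈ outerBdry (pocket a n D g), cellsMeeting P (bigBox a w)

/-- The points whose path towards `o` visits a component of the filled barrier before a number of
steps proportional to its perimeter. -/
def Lost (a : ℝ) {P : Set Plane} (n : ℕ) (D : Finset P) (o v : P) : Prop :=
  ∃ j : ℕ, boxOf a (((toward (voronoiGraph P) o)^[j] v : P) : Plane) ∈ shielded a n D ∧
    (j : ℝ) ≤ 14283 * a ^ 2 *
      perim a n D (boxOf a (((toward (voronoiGraph P) o)^[j] v : P) : Plane))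

/-- A regular configuration with a small set `D` of vertices of a ball. -/
structure Separation (a : ℝ) (P : Set Plane) (n m : ℕ) (t : ℝ) (o : P) (D : Finset P) : Prop
    extends Coarse a P n m t where
  nearest : ∀ y ∈ P, dist (0 : Plane) o ≤ dist 0 y
  sub : ∀ d ∈ D, (voronoiGraph P).edist o d ≤ n
  small : 625 * (D.card : ℝ) + t ≤ n / 2

theorem finite_touched (a : ℝ) {P : Set Plane} (D : Finset P) : (touched a D).Finite := by
  classical
  refine (Finset.finite_toSet (thick 12 (D.image fun d : P => boxOf a (d : Plane)))).subset ?_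
  rintro z ⟨d, hd, hz⟩
  exact Finset.mem_coe.2 (mem_thick.2 ⟨_, Finset.mem_image_of_mem _ hd, hz.symm⟩)

theorem ncard_touched_le (a : ℝ) {P : Set Plane} (D : Finset P) :
    (touched a D).ncard ≤ 625 * D.card := by
  classical
  have h1 : (touched a D).ncard ≤ (thick 12 (D.image fun d : P => boxOf a (d : Plane))).card := by
    rw [← Set.ncard_coe_finset]
    refine Set.ncard_le_ncard ?_ (Finset.finite_toSet _)
    rintro z ⟨d, hd, hz⟩
    exact Finset.mem_coe.2 (mem_thick.2 ⟨_, Finset.mem_image_of_mem _ hd, hz.symm⟩)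
  have h2 := card_thick_le (k := 12) (by norm_num) (D.image fun d : P => boxOf a (d : Plane))
  norm_num at h2
  have h3 : (D.image fun d : P => boxOf a (d : Plane)).card ≤ D.card := Finset.card_image_le
  omega

theorem compOf_eq {S : Set (ℤ × ℤ)} {g z : ℤ × ℤ} (h : z ∈ compOf S g) : compOf S z = compOf S g := by
  ext w
  exact ⟨fun hw => Linked.trans h hw, fun hw => (Linked.symm nbr_symm h).trans hw⟩

namespace Separation

variable {a t : ℝ} {P : Set Plane} {n m : ℕ} {o : P} {D : Finset P} (h : Separation a P n m t o D)

include h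

theorem near_of_touched {z : ℤ × ℤ} (hz : z ∈ touched a D) : Near (1012 * n) z 0 := by
  obtain ⟨d, hd, hdz⟩ := hz
  have h1 := h.one_le_n
  exact (hdz.symm.trans (h.near_of_edist_le h.nearest (h.sub d hd))).mono (by omega)

theorem touched_subset_obstacles : touched a D ⊆ obstacles a n D := fun z hz =>
  ⟨(h.near_of_touched hz).mono (by have := h.one_le_n; omega), Or.inr hz⟩

theorem barrier_subset_obstacles : barrier a n D ⊆ obstacles a n D := by
  rintro z ⟨y, hy, hyz⟩
  exact hyz.mem (h.touched_subset_obstacles hy)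

/-- The number of boxes of a rooted set of boxes, a proportion of which is bad or touched. -/
theorem card_obstacles_le {r F : Finset (ℤ × ℤ)} (hr : Rooted r F)
    (hF : ∀ z ∈ F, z ∈ obstacles a n D) (hm : m * r.card ≤ F.card) :
    (F.card : ℝ) ≤ 8 / 7 * (625 * D.card + t) := by
  classical
  have h1 := h.card_not_good_le hr (fun z hz => (hF z hz).1.mono (by have := h.one_le_n; omega)) hm
  have h2 : ((F.filter fun z => GoodBox a P z).card : ℝ) ≤ 625 * D.card := by
    have h3 : (F.filter fun z => GoodBox a P z).card ≤ (touched a D).ncard := by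
      rw [← Set.ncard_coe_finset]
      refine Set.ncard_le_ncard (fun z hz => ?_) (finite_touched a D)
      have hz := Finset.mem_filter.1 (Finset.mem_coe.1 hz)
      exact (hF z hz.1).2.resolve_left (not_not.2 hz.2)
    exact_mod_cast h3.trans (ncard_touched_le a D)
  have h3 : ((F.filter fun z => GoodBox a P z).card : ℝ) +
    (F.filter fun z => ¬ GoodBox a P z).card = F.card := by
    exact_mod_cast Finset.card_filter_add_card_filter_not (s := F) (fun z => GoodBox a P z)
  linarith

/-- A barrier reaching this far would contain a connected set of at least `88 n` obstacles, but such
a set has at most `8/7 · n/2` boxes. -/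
theorem near_of_barrier {z : ℤ × ℤ} (hz : z ∈ barrier a n D) : Near (1100 * n) z 0 := by
  by_contra hcon
  have hn := h.one_le_n
  obtain ⟨y, hy, hyz⟩ := hz
  have hy0 := h.near_of_touched hy
  obtain ⟨F, hF, hFS, hx⟩ := exists_truncation (b := 0) (R := 1100 * n)
    (h.touched_subset_obstacles hy) (hy0.mono (by omega)) hyz
  have hx : ∃ u ∈ F, ¬ Near (1100 * n - 1) u 0 := by
    rcases hx with hx | hx
    · exact absurd (hFS _ hx).2 hcon
    · exact hx
  obtain ⟨u, huF, hu⟩ := hx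
  have hcard : 88 * n ≤ F.card := by
    obtain ⟨c, hc, hlink⟩ := hF.2 u huF
    rw [Finset.mem_singleton] at hc
    subst hc
    have h1 := (card_of_linked (hF.1 (Finset.mem_singleton_self _)) hlink).trans hy0
    by_contra hlt
    exact hu (h1.mono (by omega))
  have h1 := h.card_obstacles_le hF (fun z hz => (hFS z hz).1) (by
    rw [Finset.card_singleton]; have := h.hm; omega)
  have h2 := h.small
  have hn' : (1 : ℝ) ≤ n := by exact_mod_cast hn
  have hcard' : (88 : ℝ) * n ≤ F.card := by exact_mod_cast hcard
  linarith

theorem barrier_subset_shielded : barrier a n D ⊆ shielded a n D :=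
  subset_fillIn fun _ hz => h.near_of_barrier hz

theorem touched_subset_shielded : touched a D ⊆ shielded a n D :=
  fun z hz => h.barrier_subset_shielded ⟨z, hz, Linked.refl z⟩

theorem near_of_shielded {z : ℤ × ℤ} (hz : z ∈ shielded a n D) : Near (1100 * n) z 0 :=
  near_of_mem_fillIn (fun _ hz => h.near_of_barrier hz) hz

theorem finite_shielded : (shielded a n D).Finite :=
  (Finset.finite_toSet (latSq 0 (1100 * n))).subset fun _ hz =>
    Finset.mem_coe.2 (mem_latSq.2 (h.near_of_shielded hz))

theorem finite_pocket {g : ℤ × ℤ} (hg : g ∈ shielded a n D) : (pocket a n D g).Finite :=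
  h.finite_shielded.subset (compOf_subset hg)

theorem finite_innerBdry {g : ℤ × ℤ} (hg : g ∈ shielded a n D) :
    (innerBdry (pocket a n D g)).Finite :=
  (h.finite_pocket hg).subset fun _ hz => hz.1

/-- Such a box is next to a box of the barrier; if it were an obstacle, it would belong to the same
cluster and hence to the barrier, although it lies outside. -/
theorem outerBdry_good {g w : ℤ × ℤ} (hg : g ∈ shielded a n D)
    (hw : w ∈ outerBdry (pocket a n D g)) : GoodBox a P w ∧ w ∉ touched a D := by
  have hY : ∀ z ∈ barrier a n D, Near (1100 * n) z 0 := fun _ hz => h.near_of_barrier hz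
  have hout := mem_outside_of_outerBdry hg hw
  have hwY : w ∉ barrier a n D := hout.mem (base_notMem hY)
  obtain ⟨hw1, u, hu, huw⟩ := hw
  have huY : u ∈ barrier a n D := mem_of_innerBdry hY hg ⟨hu, w, hw1, huw⟩
  have hwX : w ∉ obstacles a n D := by
    intro hwX
    obtain ⟨y, hy, hyu⟩ := huY
    exact hwY ⟨y, hy, hyu.trans (Linked.single (hyu.mem (h.touched_subset_obstacles hy)) hwX huw)⟩
  have hwn : Near (1500 * n) w 0 := by
    have h1 := huw.symm.trans (hY u huY)
    have := h.one_le_n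
    exact h1.mono (by omega)
  constructor
  · by_contra hcon; exact hwX ⟨hwn, Or.inl hcon⟩
  · exact fun hcon => hwX ⟨hwn, Or.inr hcon⟩

theorem outerBdry_subset_thick {g : ℤ × ℤ} (hg : g ∈ shielded a n D) :
    outerBdry (pocket a n D g) ⊆ thick 1 (h.finite_innerBdry hg).toFinset := by
  rintro w ⟨hw, u, hu, huw⟩
  exact Finset.mem_coe.2 (mem_thick.2 ⟨u, (h.finite_innerBdry hg).mem_toFinset.2 ⟨hu, w, hw, huw⟩,
    huw.symm⟩)

theorem finite_rim {g : ℤ × ℤ} (hg : g ∈ shielded a n D) : (rim a n D g).Finite :=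
  ((Finset.finite_toSet _).subset (h.outerBdry_subset_thick hg)).biUnion fun _ _ =>
    finite_cellsMeeting h.a_pos h.fin (isBounded_bigBox h.a_pos _)

/-- Each box of the outer boundary is next to one of the inner boundary, and a box has nine
neighbours including itself: `14283 = 9 · 1587`. This is the constant in the definition of lost
points. -/
theorem ncard_rim_le {g : ℤ × ℤ} (hg : g ∈ shielded a n D) :
    ((rim a n D g).ncard : ℝ) ≤ 14283 * a ^ 2 * perim a n D g := by
  classical
  have hfo : (outerBdry (pocket a n D g)).Finite :=
    (Finset.finite_toSet _).subset (h.outerBdry_subset_thick hg)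
  have h1 : hfo.toFinset.card ≤ 9 * perim a n D g := by
    have h2 := card_thick_le (k := 1) (by norm_num) (h.finite_innerBdry hg).toFinset
    have h3 : hfo.toFinset.card ≤ (thick 1 (h.finite_innerBdry hg).toFinset).card :=
      Finset.card_le_card fun w hw =>
        Finset.mem_coe.1 (h.outerBdry_subset_thick hg (hfo.mem_toFinset.1 hw))
    rw [← Set.ncard_eq_toFinset_card _ (h.finite_innerBdry hg)] at h2
    norm_num at h2
    unfold perim
    omega
  have h2 : rim a n D g = ⋃ w ∈ hfo.toFinset, cellsMeeting P (bigBox a w) := by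
    unfold rim; simp
  rw [h2]
  have h3 : (⋃ w ∈ hfo.toFinset, cellsMeeting P (bigBox a w)).ncard ≤
      ∑ w ∈ hfo.toFinset, (cellsMeeting P (bigBox a w)).ncard :=
    Finset.set_ncard_biUnion_le _ _
  have h4 : ∑ w ∈ hfo.toFinset, ((cellsMeeting P (bigBox a w)).ncard : ℝ) ≤
      hfo.toFinset.card * (1587 * a ^ 2) := by
    rw [← nsmul_eq_mul]
    exact Finset.sum_le_card_nsmul _ _ _ fun w hw => ncard_cellsMeeting_bigBox_le h.a_pos h.fin
      (h.outerBdry_good hg (hfo.mem_toFinset.1 hw)).1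
  have h5 : ((hfo.toFinset.card : ℕ) : ℝ) ≤ 9 * perim a n D g := by exact_mod_cast h1
  have h6 : ((⋃ w ∈ hfo.toFinset, cellsMeeting P (bigBox a w)).ncard : ℝ) ≤
      ∑ w ∈ hfo.toFinset, ((cellsMeeting P (bigBox a w)).ncard : ℝ) := by exact_mod_cast h3
  have h7 := mul_le_mul_of_nonneg_right h5 (by positivity : (0 : ℝ) ≤ 1587 * a ^ 2)
  linarith

/-- Points of the rim are within eleven boxes of an outer boundary box, and that box has no point of
`D` within twelve. -/
theorem notMem_of_rim {g : ℤ × ℤ} (hg : g ∈ shielded a n D) {x : P} (hx : x ∈ rim a n D g) :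
    x ∉ D := by
  simp only [rim, Set.mem_iUnion] at hx
  obtain ⟨w, hw, hx⟩ := hx
  obtain ⟨hw1, hw2⟩ := h.outerBdry_good hg hw
  intro hxD
  exact hw2 ⟨x, hxD, (near_of_mem_cellsMeeting_bigBox h.a_pos hw1 hx).mono (by norm_num)⟩

theorem exists_mem_cell (p : Plane) : ∃ x : P, p ∈ voronoiCell P x :=
  exists_mem_voronoiCell h.a_pos h.fin o.2 p

theorem boxCenter_mem (w : ℤ × ℤ) : ∃ p : Plane, boxOf a p = w := by
  refine ⟨!₂[a * w.1, a * w.2], ?_⟩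
  have := h.a_pos.ne'
  simp [boxOf, this]

/-- The outer boundary is connected, and the cells around each of its boxes are connected among
themselves. -/
theorem rim_linked {g : ℤ × ℤ} (hg : g ∈ shielded a n D) {x y : P} (hx : x ∈ rim a n D g)
    (hy : y ∈ rim a n D g) : Linked (voronoiGraph P).Adj (rim a n D g) x y := by
  have hY : ∀ z ∈ barrier a n D, Near (1100 * n) z 0 := fun _ hz => h.near_of_barrier hz
  simp only [rim, Set.mem_iUnion] at hx hy
  obtain ⟨w, hw, hx⟩ := hx
  obtain ⟨w', hw', hy⟩ := hy
  have hsub : ∀ w ∈ outerBdry (pocket a n D g), cellsMeeting P (bigBox a w) ⊆ rim a n D g :=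
    fun w hw => Set.subset_biUnion_of_mem (u := fun w => cellsMeeting P (bigBox a w)) hw
  have hin : ∀ w ∈ outerBdry (pocket a n D g), ∀ x ∈ cellsMeeting P (bigBox a w),
      ∀ y ∈ cellsMeeting P (bigBox a w), Linked (voronoiGraph P).Adj (rim a n D g) x y :=
    fun w hw x hx y hy => (cellsMeeting_linked h.a_pos h.fin (isOpen_bigBox a w) (convex_bigBox a w)
      (isBounded_bigBox h.a_pos w) hx hy).mono (hsub w hw)
  have hlink := outerBdry_linked compOf_linked (compl_compOf_linked hY hg) hw hw'
  refine hlink.induct (p := fun w' => w' ∈ outerBdry (pocket a n D g) ∧ ∀ y ∈ cellsMeeting P (bigBox a w'),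
    Linked (voronoiGraph P).Adj (rim a n D g) x y) ?_ ⟨hw, fun y hy => hin w hw x hx y hy⟩ |>.2 y hy
  rintro u v hu hv huv ⟨-, hxu⟩
  refine ⟨hv, fun y hy => ?_⟩
  -- The squares around adjacent boxes overlap, so a cell that contains `p` belongs to both families
  -- and links them.
  obtain ⟨p, hp⟩ := h.boxCenter_mem u
  obtain ⟨q, hq⟩ := h.exists_mem_cell p
  have hqu : q ∈ cellsMeeting P (bigBox a u) :=
    ⟨p, hq, mem_bigBox h.a_pos (by rw [hp]; exact Near.rfl (by norm_num))⟩
  have hqv : q ∈ cellsMeeting P (bigBox a v) :=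
    ⟨p, hq, mem_bigBox h.a_pos (by rw [hp]; exact huv.mono (by norm_num))⟩
  exact (hxu q hqu).trans (hin v hv q hqv y hy)

theorem rim_nonempty {g : ℤ × ℤ} (hg : g ∈ shielded a n D) : (rim a n D g).Nonempty := by
  have hY : ∀ z ∈ barrier a n D, Near (1100 * n) z 0 := fun _ hz => h.near_of_barrier hz
  obtain ⟨x, hx, hrow, hex⟩ := exists_right_exit hY hg (Linked.refl g)
  obtain ⟨p, hp⟩ := h.boxCenter_mem (x + 1, g.2)
  obtain ⟨q, hq⟩ := h.exists_mem_cell p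
  refine ⟨q, Set.mem_biUnion (x := (x + 1, g.2)) ⟨hex, _, hrow x hx le_rfl, ?_⟩
    ⟨p, hq, mem_bigBox h.a_pos (by rw [hp]; exact Near.rfl (by norm_num))⟩⟩
  unfold Nbr Near; simp

/-- An edge that leaves a component joins two points around it. -/
theorem mem_rim_of_adj {g : ℤ × ℤ} (hg : g ∈ shielded a n D) {u v : P}
    (huv : (voronoiGraph P).Adj u v) (hu : boxOf a (u : Plane) ∈ pocket a n D g)
    (hv : boxOf a (v : Plane) ∉ pocket a n D g) : u ∈ rim a n D g ∧ v ∈ rim a n D g := by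
  obtain ⟨b, b', hb, hb', hbb', hbG, hbG'⟩ := (segment_linked h.a_pos
    (boxOf_mem_boxesMeeting (left_mem_segment ℝ (u : Plane) v))
    (boxOf_mem_boxesMeeting (right_mem_segment ℝ (u : Plane) v))).exists_step
      (p := (· ∈ pocket a n D g)) hu hv
  have hout : b' ∈ outerBdry (pocket a n D g) := ⟨hbG', b, hbG, hbb'⟩
  have := mem_cellsMeeting_of_adj h.a_pos huv (h.outerBdry_good hg hout).1 hb'
  exact ⟨Set.mem_biUnion hout this.1, Set.mem_biUnion hout this.2⟩

theorem edist_le_of_mem_rim {g : ℤ × ℤ} (hg : g ∈ shielded a n D) {u x : P} (hu : u ∈ rim a n D g)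
    (hx : x ∈ rim a n D g) : (voronoiGraph P).edist u x ≤ (rim a n D g).ncard := by
  have hf := h.finite_rim hg
  rw [Set.ncard_eq_toFinset_card _ hf]
  refine edist_le_of_linked (hf.mem_toFinset.2 hu) ?_
  rw [hf.coe_toFinset]
  exact h.rim_linked hg hu hx

/-! ### Carrying the side of `A` along a geodesic. -/

section Colour

variable {A : Set P}
  (hD : ∀ x ∈ A, ∀ y, (voronoiGraph P).edist o y ≤ n → y ∉ A → (voronoiGraph P).Adj x y → x ∈ D)

include hD

/-- If the points around a component lie in the ball, they are on the same side of `A`. -/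
theorem mem_iff_of_rim {g : ℤ × ℤ} (hg : g ∈ shielded a n D)
    (hball : ∀ x ∈ rim a n D g, (voronoiGraph P).edist o x ≤ n) {x y : P} (hx : x ∈ rim a n D g)
    (hy : y ∈ rim a n D g) : x ∈ A ↔ y ∈ A := by
  have key : ∀ x ∈ rim a n D g, ∀ y ∈ rim a n D g, x ∈ A → y ∈ A := by
    intro x hx y hy hxA
    refine (h.rim_linked hg hx hy).induct (p := (· ∈ A)) ?_ hxA
    intro u v hu hv huv huA
    by_contra hvA
    exact h.notMem_of_rim hg hu (hD u huA v (hball v hv) hvA huv)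
  exact ⟨key x hx y hy, key y hy x hx⟩

/-- An edge inside the ball that changes sides has an end in `D`, and the boxes of points of `D` are
shielded. -/
theorem mem_iff_of_not_shielded {u v : P} (hu : (voronoiGraph P).edist o u ≤ n)
    (hv : (voronoiGraph P).edist o v ≤ n) (hus : boxOf a (u : Plane) ∉ shielded a n D)
    (hvs : boxOf a (v : Plane) ∉ shielded a n D) (huv : (voronoiGraph P).Adj u v) :
    u ∈ A ↔ v ∈ A := by
  have key : ∀ x : P, boxOf a (x : Plane) ∉ shielded a n D → x ∉ D := fun x hx hxD =>
    hx (h.touched_subset_shielded ⟨x, hxD, Near.rfl (by norm_num)⟩)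
  constructor
  · intro huA
    by_contra hvA
    exact key u hus (hD u huA v hv hvA huv)
  · intro hvA
    by_contra huA
    exact key v hvs (hD v hvA u hu huA huv.symm)

/-- The side of `A` on which a point lies is determined at the end of its path, unless the point is
lost. -/
theorem mem_iff_at_end {v : P} (hv : (voronoiGraph P).edist o v ≤ n) (hl : ¬ Lost a n D o v) :
    (boxOf a (o : Plane) ∉ shielded a n D ∧ (o ∈ A ↔ v ∈ A)) ∨
      (boxOf a (o : Plane) ∈ shielded a n D ∧
        ∀ x ∈ rim a n D (boxOf a (o : Plane)), x ∈ A ↔ v ∈ A) := by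
  set γ : ℕ → P := fun j => (toward (voronoiGraph P) o)^[j] v with hγ
  have hball : ∀ j, (voronoiGraph P).edist o (γ j) ≤ n := iterate_toward_mem hv
  -- If the path is in a pocket at step `j` and is not lost, the rim has at most `j` points.
  -- Starting from a rim point at distance at most `n - j` from `o`, all of the rim is within `n`.
  have hrim : ∀ j ≤ n, boxOf a (γ j : Plane) ∈ shielded a n D →
      γ j ∈ rim a n D (boxOf a (γ j : Plane)) →
      ∀ x ∈ rim a n D (boxOf a (γ j : Plane)), (voronoiGraph P).edist o x ≤ n := by
    intro j hj hjs hjr x hx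
    have h1 : ((rim a n D (boxOf a (γ j : Plane))).ncard : ℝ) ≤ j := by
      by_contra hcon
      push Not at hcon
      exact hl ⟨j, hjs, hcon.le.trans (h.ncard_rim_le hjs)⟩
    have h1 : (rim a n D (boxOf a (γ j : Plane))).ncard ≤ j := by exact_mod_cast h1
    have h2 := h.edist_le_of_mem_rim hjs hjr hx
    have h3 := edist_iterate_toward_le hv j hj
    calc (voronoiGraph P).edist o x ≤ (voronoiGraph P).edist o (γ j) +
          (voronoiGraph P).edist (γ j) x := SimpleGraph.edist_triangle
      _ ≤ (n - j : ℕ) + (j : ℕ) := add_le_add h3 (h2.trans (by exact_mod_cast h1))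
      _ = n := by rw [← Nat.cast_add]; congr 1; omega
  have hself : ∀ u : P, boxOf a (u : Plane) ∈ pocket a n D (boxOf a (u : Plane)) := fun u =>
    Linked.refl _
  -- Induction along the path. In a pocket the side of the path itself is not controlled; the rim
  -- carries the side of `v` instead.
  have key : ∀ j ≤ n, (boxOf a (γ j : Plane) ∉ shielded a n D ∧ (γ j ∈ A ↔ v ∈ A)) ∨
      (boxOf a (γ j : Plane) ∈ shielded a n D ∧
        ∀ x ∈ rim a n D (boxOf a (γ j : Plane)), x ∈ A ↔ v ∈ A) := by
    intro j
    induction j with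
    | zero =>
      intro _
      left
      refine ⟨fun hcon => hl ⟨0, hcon, ?_⟩, Iff.rfl⟩
      push_cast
      positivity
    | succ j ih =>
      intro hj
      have ih := ih (by omega)
      have hstep : γ (j + 1) = toward (voronoiGraph P) o (γ j) := Function.iterate_succ_apply' _ _ _
      rcases toward_adj_or_eq (G := voronoiGraph P) (o := o) (γ j) with hadj | heq
      swap
      · rw [hstep, heq]; exact ih
      rw [← hstep] at hadj
      by_cases h1 : boxOf a (γ (j + 1) : Plane) ∈ shielded a n D
      · right
        refine ⟨h1, ?_⟩
        -- Inside one pocket nothing changes. On entering a new one, both ends of the edge are on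
        -- its rim, and the previous vertex has the side of `v`: if it was in another pocket, it is
        -- on the rim of that one.
        by_cases hsame : boxOf a (γ j : Plane) ∈ pocket a n D (boxOf a (γ (j + 1) : Plane))
        · rcases ih with ⟨h0, -⟩ | ⟨-, h0⟩
          · exact absurd (compOf_subset h1 hsame) h0
          · intro x hx
            refine h0 x ?_
            have e : pocket a n D (boxOf a (γ j : Plane)) =
              pocket a n D (boxOf a (γ (j + 1) : Plane)) := compOf_eq hsame
            unfold rim at hx ⊢
            rwa [e]
        · obtain ⟨r1, r2⟩ := h.mem_rim_of_adj h1 hadj.symm (hself _) hsame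
          have hc : γ j ∈ A ↔ v ∈ A := by
            rcases ih with ⟨-, h0⟩ | ⟨hs0, h0⟩
            · exact h0
            · refine h0 _ (h.mem_rim_of_adj hs0 hadj (hself _) fun hcon => hsame ?_).1
              exact Linked.symm nbr_symm hcon
          intro x hx
          rw [← hc]
          exact h.mem_iff_of_rim hD h1 (hrim (j + 1) hj h1 r1) hx r2
      · left
        refine ⟨h1, ?_⟩
        rcases ih with ⟨hs0, h0⟩ | ⟨hs0, h0⟩
        · rw [← h0]
          exact (h.mem_iff_of_not_shielded hD (hball _) (hball _) hs0 h1 hadj).symm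
        · exact h0 _ (h.mem_rim_of_adj hs0 hadj (hself _)
            fun hcon => h1 (compOf_subset hs0 hcon)).2
  have hend := key n le_rfl
  have e : γ n = o := iterate_toward_eq hv
  rwa [e] at hend

/-- All points of the ball that are not lost are on the same side of `A`. -/
theorem mem_iff_of_not_lost {v v' : P} (hv : (voronoiGraph P).edist o v ≤ n)
    (hv' : (voronoiGraph P).edist o v' ≤ n) (hl : ¬ Lost a n D o v) (hl' : ¬ Lost a n D o v') :
    v ∈ A ↔ v' ∈ A := by
  rcases h.mem_iff_at_end hD hv hl with ⟨h1, h2⟩ | ⟨h1, h2⟩ <;>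
    rcases h.mem_iff_at_end hD hv' hl' with ⟨h3, h4⟩ | ⟨h3, h4⟩
  · rw [← h2, h4]
  · exact absurd h3 h1
  · exact absurd h1 h3
  · obtain ⟨x, hx⟩ := h.rim_nonempty h1
    rw [← h2 x hx, h4 x hx]

end Colour

end Separation

/-! ### Counting the lost points. -/

theorem exists_left_exit {Y : Set (ℤ × ℤ)} {M : ℤ} (hY : ∀ z ∈ Y, Near M z 0) {g z : ℤ × ℤ}
    (hg : g ∈ fillIn Y M) (hz : z ∈ compOf (fillIn Y M) g) : ∃ x : ℤ, x ≤ z.1 ∧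
      (x, z.2) ∈ compOf (fillIn Y M) g ∧ (x - 1, z.2) ∉ compOf (fillIn Y M) g := by
  by_contra! hcon
  have key : ∀ k : ℕ, (z.1 - k, z.2) ∈ compOf (fillIn Y M) g := by
    intro k
    induction k with
    | zero => simpa using hz
    | succ k ih =>
      have := hcon _ (by omega) ih
      rwa [show z.1 - (k : ℤ) - 1 = z.1 - ((k + 1 : ℕ) : ℤ) by push_cast; ring] at this
  have h1 := near_of_mem_fillIn hY (compOf_subset hg hz)
  have h2 := near_of_mem_fillIn hY (compOf_subset hg (key (2 * M + 1).toNat))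
  unfold Near at h1 h2
  simp at h1 h2
  omega

theorem dist_le_iff_near {k : ℤ} {u v : ℤ × ℤ} : dist u v ≤ k ↔ Near k u v := by
  rw [Prod.dist_eq, max_le_iff, Int.dist_eq, Int.dist_eq, abs_le, abs_le]
  unfold Near
  norm_cast
  exact and_assoc

/-- The points whose path visits the component of `y` within a number of steps proportional to its
perimeter. -/
def LostVia (a : ℝ) {P : Set Plane} (n : ℕ) (D : Finset P) (o : P) (y : ℤ × ℤ) (v : P) : Prop :=
  (voronoiGraph P).edist o v ≤ n ∧ ∃ j : ℕ,
    boxOf a (((toward (voronoiGraph P) o)^[j] v : P) : Plane) ∈ pocket a n D y ∧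
    (j : ℝ) ≤ 14283 * a ^ 2 * perim a n D y

namespace Separation

variable {a t : ℝ} {P : Set Plane} {n m : ℕ} {o : P} {D : Finset P} (h : Separation a P n m t o D)

include h

theorem innerBdry_nonempty {g : ℤ × ℤ} (hg : g ∈ shielded a n D) :
    (innerBdry (pocket a n D g)).Nonempty := by
  obtain ⟨x, hx, hrow, hex⟩ := exists_right_exit (fun _ hz => h.near_of_barrier hz) hg
    (Linked.refl g)
  exact ⟨_, hrow x hx le_rfl, _, hex, by unfold Nbr Near; simp⟩

theorem one_le_perim {g : ℤ × ℤ} (hg : g ∈ shielded a n D) : 1 ≤ perim a n D g :=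
  (Set.ncard_pos (h.finite_innerBdry hg)).2 (h.innerBdry_nonempty hg)

theorem pocket_innerBdry_linked {g x y : ℤ × ℤ} (hg : g ∈ shielded a n D)
    (hx : x ∈ innerBdry (pocket a n D g)) (hy : y ∈ innerBdry (pocket a n D g)) :
    Linked Nbr (innerBdry (pocket a n D g)) x y :=
  innerBdry_linked compOf_linked
    (compl_compOf_linked (fun _ hz => h.near_of_barrier hz) hg) hx hy

theorem near_of_innerBdry {g x y : ℤ × ℤ} (hg : g ∈ shielded a n D)
    (hx : x ∈ innerBdry (pocket a n D g)) (hy : y ∈ innerBdry (pocket a n D g)) :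
    Near (perim a n D g - 1) x y := by
  have hf := h.finite_innerBdry hg
  have h1 := card_of_linked (F := hf.toFinset) (hf.mem_toFinset.2 hy) (x := x)
    (by rw [hf.coe_toFinset]; exact h.pocket_innerBdry_linked hg hy hx)
  rwa [← Set.ncard_eq_toFinset_card _ hf] at h1

/-- The row through `z` leaves the pocket on both sides at points of the inner boundary, which is
connected and so has diameter less than the perimeter. -/
theorem near_of_pocket {g c z : ℤ × ℤ} (hg : g ∈ shielded a n D)
    (hc : c ∈ innerBdry (pocket a n D g)) (hz : z ∈ pocket a n D g) :
    Near (perim a n D g - 1) z c := by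
  have hY : ∀ z ∈ barrier a n D, Near (1100 * n) z 0 := fun _ hz => h.near_of_barrier hz
  obtain ⟨x, hx, hrow, hex⟩ := exists_right_exit hY hg hz
  obtain ⟨x', hx', hrow', hex'⟩ := exists_left_exit hY hg hz
  have h1 := h.near_of_innerBdry hg (x := (x, z.2))
    ⟨hrow x hx le_rfl, _, hex, by unfold Nbr Near; simp⟩ hc
  have h2 := h.near_of_innerBdry hg (x := (x', z.2))
    ⟨hrow', _, hex', by unfold Nbr Near; simp⟩ hc
  unfold Near at *
  dsimp only at *
  omega

/-- Each component of the filled barrier contains a touched box. -/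
theorem exists_touched_mem_pocket {g : ℤ × ℤ} (hg : g ∈ shielded a n D) :
    ∃ y ∈ touched a D, y ∈ pocket a n D g := by
  obtain ⟨u, hu⟩ := h.innerBdry_nonempty hg
  obtain ⟨y, hy, hyu⟩ := mem_of_innerBdry (fun _ hz => h.near_of_barrier hz) hg hu
  refine ⟨y, hy, Linked.trans hu.1 (Linked.symm nbr_symm (hyu.self_set.mono fun z hz => ?_))⟩
  exact h.barrier_subset_shielded ⟨y, hy, hz⟩

theorem exists_lostVia {v : P} (hv : (voronoiGraph P).edist o v ≤ n) (hl : Lost a n D o v) :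
    ∃ y ∈ touched a D, LostVia a n D o y v := by
  obtain ⟨j, hj, hjC⟩ := hl
  obtain ⟨y, hy, hyp⟩ := h.exists_touched_mem_pocket hj
  have e : pocket a n D y = pocket a n D _ := compOf_eq hyp
  refine ⟨y, hy, hv, j, ?_, ?_⟩
  · rw [e]; exact Linked.refl _
  · unfold perim at hjC ⊢; rwa [e]

theorem near_of_lostVia {y : ℤ × ℤ} {v : P} (hv : LostVia a n D o y v) :
    Near (1000 * n) (boxOf a (v : Plane)) 0 := h.near_of_edist_le h.nearest hv.1

theorem near_of_pathBoxes {v : P} (hv : (voronoiGraph P).edist o v ≤ n) {j : ℕ} {z : ℤ × ℤ}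
    (hz : z ∈ pathBoxes a o v j) : Near (1000 * n) z 0 := by
  simp only [pathBoxes, Set.mem_iUnion] at hz
  obtain ⟨i, -, hz⟩ := hz
  exact near_of_mem_segment h.a_pos (h.near_of_edist_le h.nearest (iterate_toward_mem hv i))
    (h.near_of_edist_le h.nearest (iterate_toward_mem hv (i + 1))) hz

open Classical in
/-- The points lost through a component are located around a connected set of boxes, most of which
are bad or touched, whose size is proportional to the extent of these points. -/
theorem exists_witness {C : ℕ} (hC : 2312 * (14283 * a ^ 2 + 1) ≤ C) {y : ℤ × ℤ}
    (hy : y ∈ touched a D) : ∃ (F : Finset (ℤ × ℤ)) (c : ℤ × ℤ), Rooted {c} F ∧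
      (∀ z ∈ F, Near (1900 * n) z 0) ∧
      ((F.filter fun z => GoodBox a P z ∧ z ∉ touched a D).card : ℝ) ≤ F.card / 8 ∧
      ∀ v, LostVia a n D o y v → Near (C * F.card) (boxOf a (v : Plane)) c := by
  have hn := h.one_le_n
  have hys := h.touched_subset_shielded hy
  obtain ⟨c, hc⟩ := h.innerBdry_nonempty hys
  have hIf := h.finite_innerBdry hys
  have hIobs : ∀ z ∈ innerBdry (pocket a n D y), z ∈ obstacles a n D := fun z hz =>
    h.barrier_subset_obstacles (mem_of_innerBdry (fun _ hz => h.near_of_barrier hz) hys hz)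
  have hs : hIf.toFinset.card = perim a n D y := (Set.ncard_eq_toFinset_card _ hIf).symm
  have hs1 := h.one_le_perim hys
  have hIlink : ∀ z ∈ innerBdry (pocket a n D y), Linked Nbr (innerBdry (pocket a n D y)) c z :=
    fun z hz => h.pocket_innerBdry_linked hys hc hz
  have hex : ∃ k : ℕ, ∀ v, LostVia a n D o y v → Near k (boxOf a (v : Plane)) c := by
    refine ⟨3000 * n, fun v hv => ?_⟩
    have h1 := h.near_of_lostVia hv
    have h2 := (hIobs c hc).1
    exact (h1.trans h2.symm).mono (by push_cast; omega)
  -- The extent of the set of points lost through the pocket, measured from `c`. If it is at most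
  -- `C` times the perimeter, the inner boundary, which consists of obstacles, is a witness.
  set k := Nat.find hex
  have hk := Nat.find_spec hex
  by_cases hkC : k ≤ C * perim a n D y
  · refine ⟨hIf.toFinset, c, ⟨by simpa using hc, fun z hz => ⟨c, by simp, ?_⟩⟩, fun z hz => ?_, ?_,
      fun v hv => (hk v hv).mono ?_⟩
    · rw [hIf.coe_toFinset]; exact hIlink z (hIf.mem_toFinset.1 hz)
    · exact (hIobs z (hIf.mem_toFinset.1 hz)).1.mono (by omega)
    · rw [Finset.filter_eq_empty_iff.2]
      · simp; positivity
      · rintro z hz ⟨hg, ht⟩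
        exact (hIobs z (hIf.mem_toFinset.1 hz)).2.elim (fun h' => h' hg) ht
    · rw [hs]; exact_mod_cast hkC
  · push Not at hkC
    -- By minimality some lost point `v` is at distance at least `k`. The inner boundary together
    -- with the initial part of the path of `v` is then the witness; it is connected and reaches
    -- from `c` to `v`.
    have hmin := Nat.find_min hex (m := k - 1) (by omega)
    push Not at hmin
    obtain ⟨v, hv, hvk⟩ := hmin
    obtain ⟨hvn, j, hj, hjC⟩ := id hv
    have hpf := finite_pathBoxes (o := o) (v := v) h.a_pos j
    set F := hIf.toFinset ∪ hpf.toFinset with hF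
    have hFmem : ∀ z, z ∈ F ↔ z ∈ innerBdry (pocket a n D y) ∨ z ∈ pathBoxes a o v j := by
      intro z; rw [hF, Finset.mem_union, hIf.mem_toFinset, hpf.mem_toFinset]
    have hC1 : (1 : ℝ) ≤ C := by nlinarith [sq_nonneg a]
    have hC1 : 1 ≤ C := by exact_mod_cast hC1
    have hvG : boxOf a (v : Plane) ∉ pocket a n D y := by
      intro hcon
      refine hvk ((h.near_of_pocket hys hc hcon).mono ?_)
      have : perim a n D y ≤ C * perim a n D y := Nat.le_mul_of_pos_left _ hC1
      omega
    have hvF : boxOf a (v : Plane) ∈ pathBoxes a o v j := mem_pathBoxes (Nat.zero_le j)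
    have hcF : c ∈ F := (hFmem c).2 (Or.inl hc)
    have hvlink : Linked Nbr (F : Set (ℤ × ℤ)) (boxOf a (v : Plane)) c := by
      have hp := pathBoxes_linked h.a_pos (mem_pathBoxes (a := a) (o := o) (v := v) (le_refl j))
      obtain ⟨b, b', hb, hb', hbb', hbG, hbG'⟩ :=
        (hp.symm nbr_symm).exists_step (p := (· ∈ pocket a n D y)) hj hvG
      have hbI : b ∈ innerBdry (pocket a n D y) := ⟨hbG, b', hbG', hbb'⟩
      refine Linked.trans ((pathBoxes_linked h.a_pos hb).mono fun z hz => Finset.mem_coe.2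
        ((hFmem z).2 (Or.inr hz))) ((Linked.symm nbr_symm (hIlink b hbI)).mono
          fun z hz => Finset.mem_coe.2 ((hFmem z).2 (Or.inl hz)))
    have hFlink : ∀ z ∈ F, Linked Nbr (F : Set (ℤ × ℤ)) c z := by
      intro z hz
      rcases (hFmem z).1 hz with hz | hz
      · exact (hIlink z hz).mono fun w hw => Finset.mem_coe.2 ((hFmem w).2 (Or.inl hw))
      · exact (hvlink.symm nbr_symm).trans ((pathBoxes_linked h.a_pos hz).mono fun w hw =>
          Finset.mem_coe.2 ((hFmem w).2 (Or.inr hw)))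
    have hkF : k ≤ F.card := by
      have h1 := card_of_linked hcF (hvlink.symm nbr_symm)
      by_contra hlt
      exact hvk (h1.mono (by omega))
    refine ⟨F, c, ⟨by simpa using hcF, fun z hz => ⟨c, by simp, hFlink z hz⟩⟩, fun z hz => ?_, ?_,
      fun v hv => (hk v hv).mono ?_⟩
    · rcases (hFmem z).1 hz with hz | hz
      · exact (hIobs z hz).1.mono (by omega)
      · exact (h.near_of_pathBoxes hvn hz).mono (by omega)
    -- The path has few steps compared with the perimeter, hence few good boxes, while `F` has at
    -- least `C` times the perimeter many boxes. The constant is `2312 = 8 · 289`.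
    · have h1 : (F.filter fun z => GoodBox a P z ∧ z ∉ touched a D).card ≤ 289 * (j + 1) := by
        refine card_good_pathBoxes_le (o := o) (v := v) (P := P) h.a_pos fun z hz => ?_
        obtain ⟨hzF, hzg, hzt⟩ := Finset.mem_filter.1 hz
        refine ⟨((hFmem z).1 hzF).resolve_left fun hzI => ?_, hzg⟩
        exact (hIobs z hzI).2.elim (fun h' => h' hzg) hzt
      have h1' : ((F.filter fun z => GoodBox a P z ∧ z ∉ touched a D).card : ℝ) ≤ 289 * (j + 1) := by
        exact_mod_cast h1
      have h2 : (C : ℝ) * perim a n D y ≤ F.card := by exact_mod_cast hkC.le.trans hkF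
      have h3 : (1 : ℝ) ≤ perim a n D y := by exact_mod_cast hs1
      have h4 := mul_le_mul_of_nonneg_right hC (by positivity : (0 : ℝ) ≤ perim a n D y)
      linarith
    · have : F.card ≤ C * F.card := Nat.le_mul_of_pos_left _ hC1
      exact_mod_cast hkF.trans this

-- The union `U` of disjoint witnesses is rooted with at least `m` boxes per root. Its boxes are not
-- good (at most `|U|/8 + t`), touched (at most `625 |D|`), or neither (at most `|U|/8`).
open Classical in
theorem sum_card_witness_le {ι : Type*} {s : Finset ι} {F : ι → Finset (ℤ × ℤ)} {c : ι → ℤ × ℤ}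
    (hr : ∀ i ∈ s, Rooted {c i} (F i)) (hF : ∀ i ∈ s, ∀ z ∈ F i, Near (1900 * n) z 0)
    (hg : ∀ i ∈ s, (((F i).filter fun z => GoodBox a P z ∧ z ∉ touched a D).card : ℝ) ≤
      (F i).card / 8)
    (hd : (s : Set ι).PairwiseDisjoint F) (hm : ∀ i ∈ s, m ≤ (F i).card) :
    ∑ i ∈ s, ((F i).card : ℝ) ≤ 2 * (625 * D.card + t) := by
  set U := s.biUnion F
  set r := s.image c
  have hU : U.card = ∑ i ∈ s, (F i).card := Finset.card_biUnion hd
  have hrU : Rooted r U := by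
    refine ⟨fun z hz => ?_, fun z hz => ?_⟩
    · obtain ⟨i, hi, rfl⟩ := Finset.mem_image.1 hz
      exact Finset.mem_biUnion.2 ⟨i, hi, (hr i hi).1 (Finset.mem_singleton_self _)⟩
    · obtain ⟨i, hi, hz⟩ := Finset.mem_biUnion.1 hz
      obtain ⟨c', hc', hl⟩ := (hr i hi).2 z hz
      rw [Finset.mem_singleton] at hc'
      subst hc'
      exact ⟨c i, Finset.mem_image_of_mem c hi, hl.mono fun w hw =>
        Finset.mem_coe.2 (Finset.mem_biUnion.2 ⟨i, hi, hw⟩)⟩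
  have hcard : m * r.card ≤ U.card := by
    calc m * r.card ≤ m * s.card := Nat.mul_le_mul_left m Finset.card_image_le
      _ = ∑ _i ∈ s, m := by rw [Finset.sum_const, smul_eq_mul, mul_comm]
      _ ≤ _ := by rw [hU]; exact Finset.sum_le_sum hm
  have h1 := h.card_not_good_le hrU (fun z hz => by
    obtain ⟨i, hi, hz⟩ := Finset.mem_biUnion.1 hz
    exact hF i hi z hz) hcard
  have h2 : ((U.filter fun z => z ∈ touched a D).card : ℝ) ≤ 625 * D.card := by
    have h3 : (U.filter fun z => z ∈ touched a D).card ≤ (touched a D).ncard := by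
      rw [← Set.ncard_coe_finset]
      exact Set.ncard_le_ncard (fun z hz => (Finset.mem_filter.1 (Finset.mem_coe.1 hz)).2)
        (finite_touched a D)
    exact_mod_cast h3.trans (ncard_touched_le a D)
  have h3 : ((U.filter fun z => GoodBox a P z ∧ z ∉ touched a D).card : ℝ) ≤ U.card / 8 := by
    rw [Finset.filter_biUnion]
    refine (Nat.cast_le.2 Finset.card_biUnion_le).trans ?_
    rw [hU]
    push_cast
    rw [Finset.sum_div]
    exact Finset.sum_le_sum hg
  have h4 : U.card ≤ (U.filter fun z => ¬ GoodBox a P z).card +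
      (U.filter fun z => z ∈ touched a D).card +
      (U.filter fun z => GoodBox a P z ∧ z ∉ touched a D).card := by
    refine le_trans (Finset.card_le_card fun z hz => ?_) ((Finset.card_union_le _ _).trans
      (Nat.add_le_add_right (Finset.card_union_le _ _) _))
    simp only [Finset.mem_union, Finset.mem_filter]
    by_cases h5 : GoodBox a P z
    · by_cases h6 : z ∈ touched a D
      · exact Or.inl (Or.inr ⟨hz, h6⟩)
      · exact Or.inr ⟨hz, h5, h6⟩
    · exact Or.inl (Or.inl ⟨hz, h5⟩)
  have h4' : (U.card : ℝ) ≤ (U.filter fun z => ¬ GoodBox a P z).card +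
      (U.filter fun z => z ∈ touched a D).card +
      (U.filter fun z => GoodBox a P z ∧ z ∉ touched a D).card := by exact_mod_cast h4
  have h5 : ∑ i ∈ s, ((F i).card : ℝ) = U.card := by rw [hU]; push_cast; rfl
  have := h.ht0
  have : (0 : ℝ) ≤ D.card := by positivity
  rw [h5]
  linarith

theorem card_near_le {R : ℕ} {c : ℤ × ℤ} (hR : (R : ℝ) ≤ 100 * n) (hm : m ≤ R)
    (hc : Near (1900 * n) c 0) {L : Finset P} (hL : ∀ v ∈ L, Near R (boxOf a (v : Plane)) c) :
    (L.card : ℝ) ≤ (3 * a ^ 2 + 9) * (9 * (R : ℝ) ^ 2) + t := by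
  classical
  have hR' : R ≤ 100 * n := by exact_mod_cast hR
  have h1R : 1 ≤ R := h.hm1.trans hm
  have h1 := h.card_points_le (c := c) (R := R) (by positivity) (by nlinarith)
    (hc.mono (by omega)) (S := L.image Subtype.val) (fun p hp => by
      obtain ⟨v, -, rfl⟩ := Finset.mem_image.1 hp; exact v.2) (fun p hp => by
      obtain ⟨v, hv, rfl⟩ := Finset.mem_image.1 hp; exact hL v hv)
  rw [Finset.card_image_of_injective _ Subtype.val_injective] at h1
  refine h1.trans (add_le_add_left (mul_le_mul_of_nonneg_left ?_ (by positivity)) t)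
  have : (1 : ℝ) ≤ R := by exact_mod_cast h1R
  push_cast
  nlinarith

/-- The number of lost points is small compared to the square of the size of `D`. -/
theorem card_lost_le {C : ℕ} (hC : 2312 * (14283 * a ^ 2 + 1) ≤ C)
    (hΘ : 10 * C * (625 * D.card + t) ≤ 100 * n) (hCm : (C * m : ℝ) ≤ 100 * n) {L : Finset P}
    (hL : ∀ v ∈ L, (voronoiGraph P).edist o v ≤ n ∧ Lost a n D o v) :
    (L.card : ℝ) ≤ (3 * a ^ 2 + 9) * (900 * C ^ 2) * (625 * D.card + t) ^ 2 +
      625 * D.card * ((3 * a ^ 2 + 9) * (9 * C ^ 2 * m ^ 2) + 2 * t) := by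
  classical
  set Θ := 625 * (D.card : ℝ) + t with hΘdef
  have hC1 : (1 : ℝ) ≤ C := by nlinarith [sq_nonneg a]
  have hC1 : 1 ≤ C := by exact_mod_cast hC1
  have hchoice : ∀ y : ℤ × ℤ, ∃ (F : Finset (ℤ × ℤ)) (c : ℤ × ℤ), y ∈ touched a D → Rooted {c} F ∧
      (∀ z ∈ F, Near (1900 * n) z 0) ∧
      ((F.filter fun z => GoodBox a P z ∧ z ∉ touched a D).card : ℝ) ≤ F.card / 8 ∧
      ∀ v, LostVia a n D o y v → Near (C * F.card) (boxOf a (v : Plane)) c := by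
    intro y
    by_cases hy : y ∈ touched a D
    · obtain ⟨F, c, hFc⟩ := h.exists_witness hC hy
      exact ⟨F, c, fun _ => hFc⟩
    · exact ⟨∅, 0, fun hy' => absurd hy' hy⟩
  choose F c hFc using hchoice
  set T := (finite_touched a D).toFinset
  have hT : ∀ y, y ∈ T ↔ y ∈ touched a D := fun y => (finite_touched a D).mem_toFinset
  have hTc : (T.card : ℝ) ≤ 625 * D.card := by
    have := ncard_touched_le a D
    rw [Set.ncard_eq_toFinset_card _ (finite_touched a D)] at this
    exact_mod_cast this
  set big := T.filter fun y => m ≤ (F y).card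
  have hbig1 : ∀ y ∈ big, ((F y).card : ℝ) ≤ 2 * Θ := by
    intro y hy
    obtain ⟨hyT, hym⟩ := Finset.mem_filter.1 hy
    have hy' := hFc y ((hT y).1 hyT)
    have := h.sum_card_witness_le (s := {y}) (F := F) (c := c) (by simpa using hy'.1)
      (by simpa using hy'.2.1) (by simpa using hy'.2.2.1) (by simp) (by simpa using hym)
    simpa using this
  -- Vitali selection: disjoint balls whose fivefold enlargements cover the balls around all large
  -- witnesses. A witness lies in its ball, so the selected witnesses are disjoint and their sizes
  -- can be added.
  obtain ⟨u, hu, hdisj, hcov⟩ := Vitali.exists_disjoint_subfamily_covering_enlargement_closedBall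
    (big : Set (ℤ × ℤ)) c (fun y => ((C * (F y).card : ℕ) : ℝ)) (C * (2 * Θ)) (by
      intro y hy
      push_cast
      exact mul_le_mul_of_nonneg_left (hbig1 y (Finset.mem_coe.1 hy)) (by positivity)) 5 (by norm_num)
  have hufin : u.Finite := (Finset.finite_toSet big).subset hu
  set B := hufin.toFinset
  have hBu : ∀ b, b ∈ B ↔ b ∈ u := fun b => hufin.mem_toFinset
  have hBbig : ∀ b ∈ B, b ∈ big := fun b hb => Finset.mem_coe.1 (hu ((hBu b).1 hb))
  have hBT : ∀ b ∈ B, b ∈ T := fun b hb => (Finset.mem_filter.1 (hBbig b hb)).1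
  have hFball : ∀ y ∈ T, ∀ z ∈ F y, z ∈ Metric.closedBall (c y) ((C * (F y).card : ℕ) : ℝ) := by
    intro y hy z hz
    have hy' := (hFc y ((hT y).1 hy)).1
    obtain ⟨c', hc', hl⟩ := hy'.2 z hz
    rw [Finset.mem_singleton] at hc'
    subst hc'
    have h1 := card_of_linked (hy'.1 (Finset.mem_singleton_self _)) hl
    rw [Metric.mem_closedBall]
    have h2 : (F y).card ≤ C * (F y).card := Nat.le_mul_of_pos_left _ hC1
    exact_mod_cast dist_le_iff_near.2 (h1.mono (l := ((C * (F y).card : ℕ) : ℤ)) (by omega))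
  have hsum : ∑ b ∈ B, ((F b).card : ℝ) ≤ 2 * Θ := by
    refine h.sum_card_witness_le (c := c) (fun i hi => (hFc i ((hT i).1 (hBT i hi))).1)
      (fun i hi => (hFc i ((hT i).1 (hBT i hi))).2.1)
      (fun i hi => (hFc i ((hT i).1 (hBT i hi))).2.2.1) ?_
      (fun i hi => (Finset.mem_filter.1 (hBbig i hi)).2)
    intro i hi j hj hij
    refine Finset.disjoint_left.2 fun z hzi hzj => ?_
    exact Set.disjoint_left.1 (hdisj ((hBu i).1 hi) ((hBu j).1 hj) hij)
      (hFball i (hBT i hi) z hzi) (hFball j (hBT j hj) z hzj)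
  have hlost : ∀ v ∈ L, ∃ y ∈ T, LostVia a n D o y v := fun v hv => by
    obtain ⟨y, hy, hyv⟩ := h.exists_lostVia (hL v hv).1 (hL v hv).2
    exact ⟨y, (hT y).2 hy, hyv⟩
  -- Lost points with a large witness are in an enlarged selected ball. Witnesses with fewer than
  -- `m` boxes are outside the reach of the Peierls bound, and each of them gets a ball of radius `C
  -- m` of its own.
  have hsub : L ⊆ B.biUnion (fun b => L.filter fun v : P =>
        Near ((5 * (C * (F b).card) : ℕ) : ℤ) (boxOf a (v : Plane)) (c b)) ∪
      (T.filter fun y => (F y).card < m).biUnion (fun y => L.filter fun v : P =>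
        Near ((C * m : ℕ) : ℤ) (boxOf a (v : Plane)) (c y)) := by
    intro v hv
    obtain ⟨y, hy, hyv⟩ := hlost v hv
    have hnear := (hFc y ((hT y).1 hy)).2.2.2 v hyv
    rw [Finset.mem_union]
    by_cases hym : m ≤ (F y).card
    · left
      obtain ⟨b, hb, hball⟩ := hcov y (Finset.mem_coe.2 (Finset.mem_filter.2 ⟨hy, hym⟩))
      refine Finset.mem_biUnion.2 ⟨b, (hBu b).2 hb, Finset.mem_filter.2 ⟨hv, ?_⟩⟩
      have h1 : boxOf a (v : Plane) ∈ Metric.closedBall (c y) ((C * (F y).card : ℕ) : ℝ) := by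
        rw [Metric.mem_closedBall]
        exact_mod_cast dist_le_iff_near.2 hnear
      have h2 := hball h1
      rw [Metric.mem_closedBall] at h2
      refine dist_le_iff_near.1 ?_
      push_cast at h2 ⊢
      exact h2
    · right
      refine Finset.mem_biUnion.2 ⟨y, Finset.mem_filter.2 ⟨hy, not_le.1 hym⟩,
        Finset.mem_filter.2 ⟨hv, hnear.mono ?_⟩⟩
      exact_mod_cast Nat.mul_le_mul_left C (not_le.1 hym).le
  have hΘ0 : 0 ≤ Θ := by have := h.ht0; positivity
  have hroot : ∀ y ∈ T, Near (1900 * n) (c y) 0 := fun y hy =>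
    (hFc y ((hT y).1 hy)).2.1 _ ((hFc y ((hT y).1 hy)).1.1 (Finset.mem_singleton_self _))
  have hb1 : ∀ b ∈ B, ((L.filter fun v : P =>
      Near ((5 * (C * (F b).card) : ℕ) : ℤ) (boxOf a (v : Plane)) (c b)).card : ℝ) ≤
      (3 * a ^ 2 + 9) * (225 * C ^ 2) * ((F b).card : ℝ) ^ 2 + t := by
    intro b hb
    have hbb := hbig1 b (hBbig b hb)
    have hbm : m ≤ (F b).card := (Finset.mem_filter.1 (hBbig b hb)).2
    refine (h.card_near_le (c := c b) ?_ ?_ (hroot b (hBT b hb))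
      fun v hv => (Finset.mem_filter.1 hv).2).trans_eq ?_
    · push_cast
      have := mul_le_mul_of_nonneg_left hbb (by positivity : (0 : ℝ) ≤ 5 * C)
      linarith
    · nlinarith [Nat.le_mul_of_pos_left (F b).card hC1]
    · push_cast; ring
  have hb2 : ∀ y ∈ T.filter fun y => (F y).card < m, ((L.filter fun v : P =>
      Near ((C * m : ℕ) : ℤ) (boxOf a (v : Plane)) (c y)).card : ℝ) ≤
      (3 * a ^ 2 + 9) * (9 * C ^ 2 * m ^ 2) + t := by
    intro y hy
    refine (h.card_near_le (c := c y) ?_ ?_ (hroot y (Finset.mem_filter.1 hy).1)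
      fun v hv => (Finset.mem_filter.1 hv).2).trans_eq ?_
    · push_cast; exact hCm
    · exact Nat.le_mul_of_pos_left m hC1
    · push_cast; ring
  have hcardL : (L.card : ℝ) ≤ ∑ b ∈ B, ((L.filter fun v : P =>
      Near ((5 * (C * (F b).card) : ℕ) : ℤ) (boxOf a (v : Plane)) (c b)).card : ℝ) +
      ∑ y ∈ T.filter fun y => (F y).card < m, ((L.filter fun v : P =>
      Near ((C * m : ℕ) : ℤ) (boxOf a (v : Plane)) (c y)).card : ℝ) := by
    have := (Finset.card_le_card hsub).trans ((Finset.card_union_le _ _).trans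
      (add_le_add Finset.card_biUnion_le Finset.card_biUnion_le))
    exact_mod_cast this
  have ht0 := h.ht0
  have hBc : (B.card : ℝ) ≤ 625 * D.card :=
    le_trans (by exact_mod_cast Finset.card_le_card fun b hb => hBT b hb) hTc
  have hSc : ((T.filter fun y => (F y).card < m).card : ℝ) ≤ 625 * D.card :=
    le_trans (by exact_mod_cast Finset.card_le_card (Finset.filter_subset _ _)) hTc
  -- The number of points in a ball is quadratic in its radius, and the sum of the squares is at
  -- most the square of the sum.
  have hsq : ∑ b ∈ B, ((F b).card : ℝ) ^ 2 ≤ (2 * Θ) ^ 2 := by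
    refine (Finset.sum_sq_le_sq_sum_of_nonneg fun b _ => by positivity).trans ?_
    exact pow_le_pow_left₀ (Finset.sum_nonneg fun b _ => by positivity) hsum 2
  have e1 := Finset.sum_le_sum hb1
  have e2 := Finset.sum_le_sum hb2
  rw [Finset.sum_add_distrib, ← Finset.mul_sum, Finset.sum_const, nsmul_eq_mul] at e1
  rw [Finset.sum_const, nsmul_eq_mul] at e2
  have e3 := mul_le_mul_of_nonneg_left hsq
    (by positivity : 0 ≤ (3 * a ^ 2 + 9) * (225 * (C : ℝ) ^ 2))
  have e4 := mul_le_mul_of_nonneg_right hBc ht0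
  have e5 := mul_le_mul_of_nonneg_right hSc
    (by positivity : 0 ≤ (3 * a ^ 2 + 9) * (9 * (C : ℝ) ^ 2 * m ^ 2) + t)
  nlinarith [e1, e2, e3, e4, e5]

end Separation

/-! ### Graph distance along a segment. -/

section CompactConvex

variable {a : ℝ} {P : Set Plane} {K : Set Plane}

/-- The cells that meet a compact set are the cells that meet a thin neighbourhood of it. -/
theorem exists_thickening_cellsMeeting (ha : 0 < a) (hP : LocFinite a P) (hK : IsCompact K) :
    ∃ δ : ℝ, 0 < δ ∧ cellsMeeting P (Metric.thickening δ K) = cellsMeeting P K := by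
  have hfin : (cellsMeeting P (Metric.thickening 1 K)).Finite :=
    finite_cellsMeeting ha hP hK.isBounded.thickening
  set Z : Set Plane := ⋃ x ∈ cellsMeeting P (Metric.thickening 1 K) \ cellsMeeting P K,
    voronoiCell P (x : Plane)
  have hZ : IsClosed Z := (hfin.subset Set.sdiff_subset).isClosed_biUnion
    fun x _ => isClosed_voronoiCell (x : Plane)
  obtain ⟨δ, hδ, hsub⟩ := hK.exists_thickening_subset_open hZ.isOpen_compl (by
    intro p hp hpZ
    simp only [Z, Set.mem_iUnion] at hpZ
    obtain ⟨x, hx, hpx⟩ := hpZ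
    exact hx.2 ⟨p, hpx, hp⟩)
  refine ⟨min δ 1, by positivity, Set.Subset.antisymm ?_ ?_⟩
  · rintro x ⟨p, hpx, hp⟩
    by_contra hx
    refine hsub (Metric.thickening_mono (min_le_left _ _) K hp) ?_
    simp only [Z, Set.mem_iUnion]
    exact ⟨x, ⟨⟨p, hpx, Metric.thickening_mono (min_le_right _ _) K hp⟩, hx⟩, hpx⟩
  · rintro x ⟨p, hpx, hp⟩
    exact ⟨p, hpx, Metric.self_subset_thickening (by positivity) K hp⟩

theorem finite_cellsMeeting_of_isCompact (ha : 0 < a) (hP : LocFinite a P) (hK : IsCompact K) :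
    (cellsMeeting P K).Finite := finite_cellsMeeting ha hP hK.isBounded

theorem edist_le_of_cellsMeeting (ha : 0 < a) (hP : LocFinite a P) (hK : IsCompact K)
    (hc : Convex ℝ K) {x y : P} (hx : x ∈ cellsMeeting P K) (hy : y ∈ cellsMeeting P K) :
    (voronoiGraph P).edist x y ≤ (cellsMeeting P K).ncard := by
  obtain ⟨δ, hδ, heq⟩ := exists_thickening_cellsMeeting ha hP hK
  have hf := finite_cellsMeeting_of_isCompact ha hP hK
  rw [Set.ncard_eq_toFinset_card _ hf]
  refine edist_le_of_linked (hf.mem_toFinset.2 hx) ?_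
  rw [hf.coe_toFinset]
  rw [← heq] at hx hy ⊢
  exact cellsMeeting_linked ha hP Metric.isOpen_thickening (hc.thickening δ)
    hK.isBounded.thickening hx hy

end CompactConvex

/-! ### Cells that cross an axis near their nuclei. -/

/-- A thin piece of a pair of strips along the first axis of a frame. -/
def slab (Φ : Plane → Plane) (x r w : ℝ) : Set Plane :=
  Φ ⁻¹' planeRect (Set.Ico x (x + 1 / 100)) {v | |v| ∈ Set.Ico r (r + w)}

/-- A half disc without a thin piece. -/
def shadow (Φ : Plane → Plane) (x r : ℝ) : Set Plane :=
  Φ ⁻¹' {p | x + 1 / 100 ≤ p 0 ∧ (p 0 - x) ^ 2 + p 1 ^ 2 < r ^ 2}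

open Classical in
/-- The number of points in consecutive pieces of a pair of strips with empty shadows. -/
noncomputable def rowSum (P : Set Plane) (Φ : Plane → Plane) (x : ℝ) (N : ℕ) (r w : ℝ) : ℝ :=
  ∑ i ∈ Finset.range N, if (P ∩ shadow Φ (x + i / 100) r).encard = 0 then
    ((P ∩ slab Φ (x + i / 100) r w).encard.toNat : ℝ) else 0

section Rows

variable {a : ℝ} {P : Set Plane} {Φ : Plane → Plane}

theorem finite_inter_slab (ha : 0 < a) (hP : LocFinite a P)
    (hΦ : ∀ p q, dist (Φ p) (Φ q) = dist p q) (x r w : ℝ) : (P ∩ slab Φ x r w).Finite := by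
  rcases Set.eq_empty_or_nonempty (slab Φ x r w) with he | ⟨q, hq⟩
  · rw [he, Set.inter_empty]; exact Set.finite_empty
  refine (hP.finite_inter_closedBall ha q (3 / 2 * (1 + 2 * |r + w|))).subset ?_
  rintro p ⟨hp, hps⟩
  refine ⟨hp, ?_⟩
  rw [Metric.mem_closedBall, ← hΦ]
  obtain ⟨⟨h1, h2⟩, h3, h4⟩ := hps
  obtain ⟨⟨k1, k2⟩, k3, k4⟩ := hq
  have h5 := le_abs_self (r + w)
  have h6 := abs_nonneg (r + w)
  refine dist_le_of_coord (by positivity) ?_ ?_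
  · rw [abs_le]; constructor <;> linarith
  · have := abs_sub (Φ p 1) (Φ q 1)
    linarith

/-- The shadow of a point whose cell reaches the axis ahead of the point is empty. -/
theorem inter_shadow_eq_empty (hΦ : ∀ p q, dist (Φ p) (Φ q) = dist p q) {y t : Plane}
    (ht : t ∈ voronoiCell P y) (ht1 : Φ t 1 = 0) (hs : Φ y 0 ≤ Φ t 0) {x r w : ℝ} (hr : 0 ≤ r)
    (hy : y ∈ slab Φ x r w) : P ∩ shadow Φ x r = ∅ := by
  refine Set.eq_empty_iff_forall_notMem.2 ?_
  rintro p ⟨hp, hp1, hp2⟩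
  obtain ⟨⟨h1, h2⟩, h3, h4⟩ := hy
  have h5 := pow_le_pow_left₀ dist_nonneg (ht p hp) 2
  rw [← hΦ t y, ← hΦ t p, plane_dist_sq, plane_dist_sq, ht1] at h5
  have h6 : r ^ 2 ≤ Φ y 1 ^ 2 := by rw [← sq_abs (Φ y 1)]; exact pow_le_pow_left₀ hr h3 2
  -- For `p` not behind `y` and `y` not ahead of `t`, one has `(p₀ - t₀)² - (y₀ - t₀)² ≤ (p₀ - y₀)²
  -- ≤ (p₀ - x)²`. So points of the shadow would be closer to `t` than `y` is, wherever `t` is on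
  -- the axis.
  nlinarith [mul_nonneg (by linarith : 0 ≤ Φ p 0 - Φ y 0) (by linarith : 0 ≤ Φ t 0 - Φ y 0)]

theorem card_le_rowSum (ha : 0 < a) (hP : LocFinite a P)
    (hΦ : ∀ p q, dist (Φ p) (Φ q) = dist p q) {x r w : ℝ} {N : ℕ} {Y : Finset Plane}
    (hY : ∀ y ∈ Y, y ∈ P ∧ ∃ i < N, y ∈ slab Φ (x + (i : ℕ) / 100) r w ∧
      P ∩ shadow Φ (x + (i : ℕ) / 100) r = ∅) : (Y.card : ℝ) ≤ rowSum P Φ x N r w := by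
  classical
  set I := (Finset.range N).filter fun i => (P ∩ shadow Φ (x + (i : ℕ) / 100) r).encard = 0
  have hsub : Y ⊆ I.biUnion fun i => (finite_inter_slab ha hP hΦ (x + (i : ℕ) / 100) r w).toFinset := by
    intro y hy
    obtain ⟨hyP, i, hi, hys, he⟩ := hY y hy
    refine Finset.mem_biUnion.2 ⟨i, Finset.mem_filter.2 ⟨Finset.mem_range.2 hi, ?_⟩, ?_⟩
    · rw [he, Set.encard_empty]
    · exact (Set.Finite.mem_toFinset _).2 ⟨hyP, hys⟩
  unfold rowSum
  rw [← Finset.sum_filter]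
  have h1 := (Finset.card_le_card hsub).trans Finset.card_biUnion_le
  refine (Nat.cast_le (α := ℝ) |>.2 h1).trans_eq ?_
  rw [Nat.cast_sum]
  refine Finset.sum_congr rfl fun i _ => ?_
  rw [← Set.ncard_eq_toFinset_card _ (finite_inter_slab ha hP hΦ (x + (i : ℕ) / 100) r w)]
  rfl

theorem exists_slab {x : ℝ} {N : ℕ} {y : Plane} {r w : ℝ} (h0 : x ≤ Φ y 0)
    (h1 : Φ y 0 < x + N / 100) (h2 : r ≤ |Φ y 1|) (h3 : |Φ y 1| < r + w) :
    ∃ i < N, y ∈ slab Φ (x + (i : ℕ) / 100) r w := by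
  refine ⟨⌊(Φ y 0 - x) * 100⌋₊, ?_, ⟨?_, ?_⟩, h2, h3⟩
  · rw [Nat.floor_lt (by linarith)]; linarith
  · have := Nat.floor_le (by linarith : 0 ≤ (Φ y 0 - x) * 100)
    linarith
  · have := Nat.lt_floor_add_one ((Φ y 0 - x) * 100)
    linarith

end Rows

/-- The sum over all strips up to a given height on both sides of an axis, where the shadows of
points outside the strip around the axis are taken in one of the two frames. -/
noncomputable def crossSum (P : Set Plane) (Φ Φ' : Plane → Plane) (x : ℝ) (N J : ℕ) : ℝ :=
  rowSum P Φ x N 0 (2 / 3) + ∑ j ∈ Finset.Ico 2 J,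
    (rowSum P Φ x N (j / 3) (1 / 3) + rowSum P Φ' x N (j / 3) (1 / 3))

/-- The number of points near an axis whose cells meet the axis. -/
theorem card_le_crossSum {a : ℝ} (ha : 0 < a) {P : Set Plane} (hP : LocFinite a P)
    {Φ Φ' : Plane → Plane} (hΦ : ∀ p q, dist (Φ p) (Φ q) = dist p q)
    (hΦ' : ∀ p q, dist (Φ' p) (Φ' q) = dist p q) {L H : ℝ} (hrev : ∀ p, Φ' p 0 = L - Φ p 0 ∧ |Φ' p 1| = |Φ p 1|)
    {N J : ℕ} (hN : L + 2 * H < N / 100) (hJ : 3 * H + 1 ≤ J) {Y : Finset Plane}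
    (hY : ∀ y ∈ Y, y ∈ P ∧ ∃ t ∈ voronoiCell P y, dist t y ≤ H ∧ Φ t 1 = 0 ∧ 0 ≤ Φ t 0 ∧ Φ t 0 ≤ L) :
    (Y.card : ℝ) ≤ crossSum P Φ Φ' (-H) N J := by
  classical
  set Y₀ := Y.filter fun y => |Φ y 1| < 2 / 3
  set Y₁ : ℕ → Finset Plane := fun j => Y.filter fun y => ∃ i < N,
    y ∈ slab Φ (-H + (i : ℕ) / 100) (j / 3) (1 / 3) ∧ P ∩ shadow Φ (-H + (i : ℕ) / 100) (j / 3) = ∅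
  set Y₂ : ℕ → Finset Plane := fun j => Y.filter fun y => ∃ i < N,
    y ∈ slab Φ' (-H + (i : ℕ) / 100) (j / 3) (1 / 3) ∧ P ∩ shadow Φ' (-H + (i : ℕ) / 100) (j / 3) = ∅
  have hloc : ∀ y ∈ Y, -H ≤ Φ y 0 ∧ Φ y 0 ≤ L + H ∧ |Φ y 1| ≤ H := by
    intro y hy
    obtain ⟨-, t, -, hd, ht1, ht0, htL⟩ := hY y hy
    rw [← hΦ] at hd
    have h0 := abs_le.1 ((abs_coord_le_dist (Φ t) (Φ y) 0).trans hd)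
    have h1 := (abs_coord_le_dist (Φ t) (Φ y) 1).trans hd
    rw [ht1, zero_sub, abs_neg] at h1
    exact ⟨by linarith, by linarith, h1⟩
  have hsub : Y ⊆ Y₀ ∪ (Finset.Ico 2 J).biUnion fun j => Y₁ j ∪ Y₂ j := by
    intro y hy
    obtain ⟨h1, h2, h3⟩ := hloc y hy
    obtain ⟨-, t, ht, hd, ht1, ht0, htL⟩ := hY y hy
    rw [Finset.mem_union]
    by_cases hv : |Φ y 1| < 2 / 3
    · exact Or.inl (Finset.mem_filter.2 ⟨hy, hv⟩)
    right
    push Not at hv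
    set j := ⌊3 * |Φ y 1|⌋₊ with hj
    have hj1 : (j : ℝ) ≤ 3 * |Φ y 1| := Nat.floor_le (by positivity)
    have hj2 : 3 * |Φ y 1| < j + 1 := Nat.lt_floor_add_one _
    have hj3 : 2 ≤ j := Nat.le_floor (by push_cast; linarith)
    have hj4 : j < J := by
      have : (j : ℝ) < J := by linarith
      exact_mod_cast this
    refine Finset.mem_biUnion.2 ⟨j, Finset.mem_Ico.2 ⟨hj3, hj4⟩, ?_⟩
    rw [Finset.mem_union]
    -- If the nucleus is ahead of `t` in the first frame, it is behind `t` in the reversed one.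
    rcases le_total (Φ y 0) (Φ t 0) with hs | hs
    · left
      obtain ⟨i, hi, hyi⟩ := exists_slab (Φ := Φ) (x := -H) (N := N) (y := y) (r := j / 3) (w := 1 / 3)
        h1 (by linarith) (by linarith) (by linarith)
      exact Finset.mem_filter.2 ⟨hy, i, hi, hyi,
        inter_shadow_eq_empty hΦ ht ht1 hs (by positivity) hyi⟩
    · right
      have ht1' : Φ' t 1 = 0 := by rw [← abs_eq_zero, (hrev t).2, ht1, abs_zero]
      obtain ⟨i, hi, hyi⟩ := exists_slab (Φ := Φ') (x := -H) (N := N) (y := y) (r := j / 3) (w := 1 / 3)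
        (by rw [(hrev y).1]; linarith) (by rw [(hrev y).1]; linarith)
        (by rw [(hrev y).2]; linarith) (by rw [(hrev y).2]; linarith)
      exact Finset.mem_filter.2 ⟨hy, i, hi, hyi, inter_shadow_eq_empty hΦ' ht ht1'
        (by rw [(hrev y).1, (hrev t).1]; linarith) (by positivity) hyi⟩
  -- The shadow of radius `0` is empty, so all points of the inner strip are counted.
  have k0 : (Y₀.card : ℝ) ≤ rowSum P Φ (-H) N 0 (2 / 3) := by
    refine card_le_rowSum ha hP hΦ fun y hy => ?_
    obtain ⟨hyY, hyv⟩ := Finset.mem_filter.1 hy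
    obtain ⟨h1, h2, h3⟩ := hloc y hyY
    obtain ⟨i, hi, hyi⟩ := exists_slab (Φ := Φ) (x := -H) (N := N) (y := y) (r := 0) (w := 2 / 3)
      h1 (by linarith) (by positivity) (by linarith)
    refine ⟨(hY y hyY).1, i, hi, hyi, Set.eq_empty_iff_forall_notMem.2 ?_⟩
    rintro p ⟨-, -, hp⟩
    nlinarith [sq_nonneg (Φ p 0 - (-H + (i : ℕ) / 100)), sq_nonneg (Φ p 1)]
  have k1 : ∀ j, ((Y₁ j).card : ℝ) ≤ rowSum P Φ (-H) N (j / 3) (1 / 3) := fun j =>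
    card_le_rowSum ha hP hΦ fun y hy => ⟨(hY y (Finset.mem_filter.1 hy).1).1,
      (Finset.mem_filter.1 hy).2⟩
  have k2 : ∀ j, ((Y₂ j).card : ℝ) ≤ rowSum P Φ' (-H) N (j / 3) (1 / 3) := fun j =>
    card_le_rowSum ha hP hΦ' fun y hy => ⟨(hY y (Finset.mem_filter.1 hy).1).1,
      (Finset.mem_filter.1 hy).2⟩
  have h1 : Y.card ≤ Y₀.card + ∑ j ∈ Finset.Ico 2 J, ((Y₁ j).card + (Y₂ j).card) :=
    (Finset.card_le_card hsub).trans ((Finset.card_union_le _ _).trans (Nat.add_le_add_left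
      (Finset.card_biUnion_le.trans (Finset.sum_le_sum fun j _ => Finset.card_union_le _ _)) _))
  refine (Nat.cast_le (α := ℝ) |>.2 h1).trans ?_
  push_cast
  exact add_le_add k0 (Finset.sum_le_sum fun j _ => add_le_add (k1 j) (k2 j))

theorem volume_abs_preimage_Ico {r w : ℝ} (hr : 0 ≤ r) (hw : 0 ≤ w) :
    volume {v : ℝ | |v| ∈ Set.Ico r (r + w)} = ENNReal.ofReal (2 * w) := by
  have e : {v : ℝ | |v| ∈ Set.Ico r (r + w)} = Set.Ioo (-(r + w)) (r + w) \ Set.Ioo (-r) r := by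
    ext v
    simp only [Set.mem_ofPred_eq, Set.mem_Ico, Set.mem_sdiff, Set.mem_Ioo, ← abs_lt, not_lt]
    exact and_comm
  rw [e, measure_sdiff (Set.Ioo_subset_Ioo (by linarith) (by linarith))
    measurableSet_Ioo.nullMeasurableSet (by simp), Real.volume_Ioo, Real.volume_Ioo,
    ← ENNReal.ofReal_sub _ (by linarith)]
  congr 1; ring

theorem measurableSet_abs_preimage_Ico (r w : ℝ) : MeasurableSet {v : ℝ | |v| ∈ Set.Ico r (r + w)} :=
  measurableSet_Ico.preimage measurable_norm

theorem measurableSet_shadow_pre (x r : ℝ) :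
    MeasurableSet {p : Plane | x + 1 / 100 ≤ p 0 ∧ (p 0 - x) ^ 2 + p 1 ^ 2 < r ^ 2} :=
  (measurableSet_le (f := fun _ : Plane => x + 1 / 100) (g := fun p : Plane => p 0) (by fun_prop)
    (by fun_prop)).inter (measurableSet_lt (f := fun p : Plane => (p 0 - x) ^ 2 + p 1 ^ 2)
    (g := fun _ : Plane => r ^ 2) (by fun_prop) (by fun_prop))

section Frame

variable {Φ : Plane → Plane} (hΦ : MeasurePreserving Φ volume volume)

include hΦ

theorem measurableSet_slab (x r w : ℝ) : MeasurableSet (slab Φ x r w) :=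
  hΦ.measurable (measurableSet_planeRect measurableSet_Ico (measurableSet_abs_preimage_Ico r w))

theorem volume_slab (x : ℝ) {r w : ℝ} (hr : 0 ≤ r) (hw : 0 ≤ w) :
    volume (slab Φ x r w) = ENNReal.ofReal (w / 50) := by
  unfold slab
  rw [hΦ.measure_preimage (measurableSet_planeRect measurableSet_Ico
    (measurableSet_abs_preimage_Ico r w)).nullMeasurableSet,
    volume_planeRect measurableSet_Ico (measurableSet_abs_preimage_Ico r w),
    volume_abs_preimage_Ico hr hw, Real.volume_Ico, ← ENNReal.ofReal_mul (by linarith)]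
  congr 1; ring

theorem measurableSet_shadow (x r : ℝ) : MeasurableSet (shadow Φ x r) :=
  hΦ.measurable (measurableSet_shadow_pre x r)

/-- The disc is covered by the shadow, its reflection in the centre, and a strip of width `1/50` and
height `2r`. -/
theorem volume_shadow (x : ℝ) {r : ℝ} (hr : 0 ≤ r) : volume (shadow Φ x r) ≠ ⊤ ∧
    Real.pi * r ^ 2 / 2 - r / 50 ≤ (volume (shadow Φ x r)).toReal := by
  unfold shadow
  rw [hΦ.measure_preimage (measurableSet_shadow_pre x r).nullMeasurableSet]
  set D := {p : Plane | x + 1 / 100 ≤ p 0 ∧ (p 0 - x) ^ 2 + p 1 ^ 2 < r ^ 2} with hD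
  have hball : volume (Metric.ball (!₂[x, 0] : Plane) r) = ENNReal.ofReal (Real.pi * r ^ 2) := by
    rw [EuclideanSpace.volume_ball_fin_two, mul_comm, ENNReal.ofReal_mul Real.pi_pos.le,
      ENNReal.ofReal_pow hr]
  have hin : ∀ p : Plane, p ∈ Metric.ball (!₂[x, 0] : Plane) r ↔ (p 0 - x) ^ 2 + p 1 ^ 2 < r ^ 2 := by
    intro p
    have h1 := plane_dist_sq p !₂[x, 0]
    simp only [Matrix.cons_val_zero, Matrix.cons_val_one, sub_zero] at h1
    rw [Metric.mem_ball, ← h1, sq_lt_sq₀ dist_nonneg hr]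
  have hsubD : D ⊆ Metric.ball (!₂[x, 0] : Plane) r := fun p hp => (hin p).2 hp.2
  have htop : volume D ≠ ⊤ :=
    ((measure_mono hsubD).trans_lt (by rw [hball]; exact ENNReal.ofReal_lt_top)).ne
  refine ⟨htop, ?_⟩
  set D' := (fun p : Plane => !₂[2 * x, 0] - p) ⁻¹' D
  have hD' : volume D' = volume D :=
    (Measure.measurePreserving_sub_left volume (!₂[2 * x, 0] : Plane)).measure_preimage
      (measurableSet_shadow_pre x r).nullMeasurableSet
  have hcov : Metric.ball (!₂[x, 0] : Plane) r ⊆ D ∪ D' ∪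
      planeRect (Set.Ioo (x - 1 / 100) (x + 1 / 100)) (Set.Ioo (-r) r) := by
    intro p hp
    have hp := (hin p).1 hp
    by_cases h1 : x + 1 / 100 ≤ p 0
    · exact Or.inl (Or.inl ⟨h1, hp⟩)
    by_cases h2 : p 0 ≤ x - 1 / 100
    · refine Or.inl (Or.inr ⟨?_, ?_⟩)
      · simp; linarith
      · simp; linarith
    · push Not at h1 h2
      have h3 : p 1 ^ 2 < r ^ 2 := by nlinarith [sq_nonneg (p 0 - x)]
      have h4 := abs_lt_of_sq_lt_sq h3 hr
      exact Or.inr ⟨⟨h2, h1⟩, abs_lt.1 h4⟩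
  have hrect : volume (planeRect (Set.Ioo (x - 1 / 100) (x + 1 / 100)) (Set.Ioo (-r) r)) =
      ENNReal.ofReal (r / 25) := by
    rw [volume_planeRect measurableSet_Ioo measurableSet_Ioo, Real.volume_Ioo, Real.volume_Ioo,
      ← ENNReal.ofReal_mul (by linarith)]
    congr 1; ring
  have hle : volume (Metric.ball (!₂[x, 0] : Plane) r) ≤ volume D + volume D' +
      volume (planeRect (Set.Ioo (x - 1 / 100) (x + 1 / 100)) (Set.Ioo (-r) r)) := by
    refine (measure_mono hcov).trans ((measure_union_le _ _).trans ?_)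
    gcongr
    exact measure_union_le _ _
  rw [hball, hD', hrect] at hle
  have h5 := ENNReal.toReal_mono (by finiteness) hle
  rw [ENNReal.toReal_add (by finiteness) (by finiteness), ENNReal.toReal_add htop htop,
    ENNReal.toReal_ofReal (by positivity), ENNReal.toReal_ofReal (by positivity)] at h5
  linarith

end Frame

theorem sum_range_mul (f : ℕ → ℝ) (b M : ℕ) :
    ∑ i ∈ Finset.range (b * M), f i =
      ∑ s ∈ Finset.range b, ∑ k ∈ Finset.range M, f (s + b * k) := by
  induction M with
  | zero => simp
  | succ M ih =>
    rw [Nat.mul_succ, Finset.sum_range_add, ih, ← Finset.sum_add_distrib]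
    refine Finset.sum_congr rfl fun s _ => ?_
    rw [Finset.sum_range_succ, add_comm (b * M) s]

/-- The number of points with empty shadows in a long pair of strips is not much larger than its
mean, except with exponentially small probability. -/
theorem exists_rowSum_bound {r w η : ℝ} (hr : 0 ≤ r) (hw : 0 ≤ w)
    (hq : 0 ≤ Real.pi * r ^ 2 / 2 - r / 50) (hη : 0 < η) {b : ℕ} (hb : r + 1 / 100 ≤ b / 100) :
    ∃ c : ℝ, 0 < c ∧ ∀ {Ω : Type*} [MeasurableSpace Ω] (μ : Measure Ω) [IsProbabilityMeasure μ]
      (Pts : Ω → Set Plane), IsUnitPoissonProcess μ Pts →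
      ∀ Φ : Plane → Plane, MeasurePreserving Φ volume volume → ∀ (x : ℝ) (M : ℕ),
        μ {ω | b * (M * (w / 50 * Real.exp (-(Real.pi * r ^ 2 / 2 - r / 50)) + η)) ≤
          rowSum (Pts ω) Φ x (b * M) r w} ≤ ENNReal.ofReal (b * Real.exp (-c * M)) := by
  classical
  obtain ⟨c, hc, H⟩ := exists_chernoff (v := w / 50) (by positivity) hη
  refine ⟨c, hc, ?_⟩
  intro Ω _ μ _ Pts hP Φ hΦ x M
  set θ := w / 50 * Real.exp (-(Real.pi * r ^ 2 / 2 - r / 50)) + η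
  have hb0 : (0 : ℝ) < b := by linarith
  -- Indices in one residue class modulo `b` are at least `r + 1/100` apart along the axis, so their
  -- slabs and shadows are pairwise disjoint and the Chernoff bound applies to each class.
  have hcls : ∀ s : ℕ, μ {ω | M * θ ≤ ∑ k ∈ Finset.range M,
      if (Pts ω ∩ shadow Φ (x + (s + b * k : ℕ) / 100) r).encard = 0 then
        ((Pts ω ∩ slab Φ (x + (s + b * k : ℕ) / 100) r w).encard.toNat : ℝ) else 0} ≤
      ENNReal.ofReal (Real.exp (-c * M)) := by
    intro s
    have hQr : ∀ k : ℕ, ∀ p ∈ slab Φ (x + (s + b * k : ℕ) / 100) r w,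
        x + (s + b * k : ℕ) / 100 ≤ Φ p 0 ∧ Φ p 0 < x + (s + b * k : ℕ) / 100 + 1 / 100 :=
      fun k p hp => hp.1
    have hRr : ∀ k : ℕ, ∀ p ∈ shadow Φ (x + (s + b * k : ℕ) / 100) r,
        x + (s + b * k : ℕ) / 100 + 1 / 100 ≤ Φ p 0 ∧ Φ p 0 < x + (s + b * k : ℕ) / 100 + r := by
      rintro k p ⟨h1, h2⟩
      refine ⟨h1, ?_⟩
      have := abs_lt_of_sq_lt_sq (by nlinarith [sq_nonneg (Φ p 1)] :
        (Φ p 0 - (x + (s + b * k : ℕ) / 100)) ^ 2 < r ^ 2) hr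
      linarith [(abs_lt.1 this).2]
    have hstep : ∀ k l : ℕ, k < l → x + (s + b * k : ℕ) / 100 + (r + 1 / 100) ≤
        x + ((s + b * l : ℕ) : ℝ) / 100 := by
      intro k l hkl
      have h1 : (k : ℝ) + 1 ≤ l := by exact_mod_cast hkl
      have h2 := mul_le_mul_of_nonneg_left h1 hb0.le
      push_cast
      linarith
    refine H μ Pts hP M (fun k => slab Φ (x + (s + b * k : ℕ) / 100) r w)
      (fun k => shadow Φ (x + (s + b * k : ℕ) / 100) r)
      (Real.exp (-(Real.pi * r ^ 2 / 2 - r / 50))) (Real.exp_pos _).le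
      (Real.exp_le_one_iff.2 (by linarith)) (fun k => measurableSet_slab hΦ _ _ _)
      (fun k => measurableSet_shadow hΦ _ _) (fun k => volume_slab hΦ _ hr hw)
      (fun k => (volume_shadow hΦ _ hr).1)
      (fun k => Real.exp_le_exp.2 (neg_le_neg (volume_shadow hΦ _ hr).2)) ?_ ?_ ?_
    · intro k l hkl
      refine Set.disjoint_left.2 fun p hp hp' => ?_
      have h1 := hQr k p hp
      have h2 := hQr l p hp'
      rcases lt_or_gt_of_ne hkl with h | h
      · linarith [hstep k l h]
      · linarith [hstep l k h]
    · intro k l hkl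
      refine Set.disjoint_left.2 fun p hp hp' => ?_
      have h1 := hRr k p hp
      have h2 := hRr l p hp'
      rcases lt_or_gt_of_ne hkl with h | h
      · linarith [hstep k l h]
      · linarith [hstep l k h]
    · intro k l
      refine Set.disjoint_left.2 fun p hp hp' => ?_
      have h1 := hQr k p hp
      have h2 := hRr l p hp'
      rcases lt_trichotomy k l with h | h | h
      · linarith [hstep k l h]
      · subst h; linarith
      · linarith [hstep l k h]
  have hsub : {ω | b * (M * θ) ≤ rowSum (Pts ω) Φ x (b * M) r w} ⊆
      ⋃ s ∈ Finset.range b, {ω | M * θ ≤ ∑ k ∈ Finset.range M,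
      if (Pts ω ∩ shadow Φ (x + (s + b * k : ℕ) / 100) r).encard = 0 then
        ((Pts ω ∩ slab Φ (x + (s + b * k : ℕ) / 100) r w).encard.toNat : ℝ) else 0} := by
    intro ω hω
    by_contra hcon
    simp only [Set.mem_iUnion, Set.mem_ofPred_eq, not_exists, not_le] at hcon
    have h1 : rowSum (Pts ω) Φ x (b * M) r w < ∑ _s ∈ Finset.range b, M * θ := by
      unfold rowSum
      rw [sum_range_mul]
      refine Finset.sum_lt_sum_of_nonempty ?_ fun s hs => hcon s hs
      rw [Finset.nonempty_range_iff]
      exact_mod_cast hb0.ne'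
    rw [Finset.sum_const, Finset.card_range, nsmul_eq_mul] at h1
    exact absurd hω (not_le.2 h1)
  refine (measure_mono hsub).trans ((measure_biUnion_finset_le _ _).trans
    ((Finset.sum_le_sum fun s _ => hcls s).trans_eq ?_))
  rw [Finset.sum_const, Finset.card_range, nsmul_eq_mul, ENNReal.ofReal_mul (by positivity),
    ENNReal.ofReal_natCast]

theorem exists_pos_le {ι : Type*} (s : Finset ι) (f : ι → ℝ) (hf : ∀ i, 0 < f i) :
    ∃ c : ℝ, 0 < c ∧ ∀ i ∈ s, c ≤ f i := by
  classical
  induction s using Finset.induction_on with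
  | empty => exact ⟨1, one_pos, by simp⟩
  | insert i s _ ih =>
    obtain ⟨c, hc, h⟩ := ih
    refine ⟨min c (f i), lt_min hc (hf i), fun j hj => ?_⟩
    rcases Finset.mem_insert.1 hj with rfl | hj
    · exact min_le_right _ _
    · exact (min_le_left _ _).trans (h j hj)

theorem half_disc_area_nonneg {j : ℕ} (hj : 2 ≤ j) :
    0.171 * (j : ℝ) ^ 2 ≤ Real.pi * ((j : ℝ) / 3) ^ 2 / 2 - (j / 3 : ℝ) / 50 := by
  have h1 := Real.pi_gt_d2
  have h2 : (2 : ℝ) ≤ j := by exact_mod_cast hj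
  nlinarith [mul_nonneg (by linarith : (0 : ℝ) ≤ j) (by linarith : (0 : ℝ) ≤ j - 2)]

/-- The terms are at most `x^(j²)` with `x = e^(-0.171)`. The term `j = 2` is kept, and the others
are compared with a geometric series through `(3 + i)² ≥ 9 + 7i`. -/
theorem sum_exp_half_disc_le (J : ℕ) :
    ∑ j ∈ Finset.Ico 2 J, Real.exp (-(Real.pi * ((j : ℝ) / 3) ^ 2 / 2 - (j / 3 : ℝ) / 50)) ≤ 0.82 := by
  set x := Real.exp (-0.171) with hx
  have hx0 : 0 < x := Real.exp_pos _
  have hx1 : x ≤ 0.8435 := by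
    rw [hx, Real.exp_neg]
    have h1 := Real.quadratic_le_exp_of_nonneg (x := 0.171) (by norm_num)
    rw [inv_le_comm₀ (Real.exp_pos _) (by norm_num)]
    refine le_trans ?_ h1
    norm_num
  have hterm : ∀ j ∈ Finset.Ico 2 J,
      Real.exp (-(Real.pi * ((j : ℝ) / 3) ^ 2 / 2 - (j / 3 : ℝ) / 50)) ≤ x ^ (j ^ 2) := by
    intro j hj
    rw [hx, ← Real.exp_nat_mul]
    refine Real.exp_le_exp.2 ?_
    have := half_disc_area_nonneg (Finset.mem_Ico.1 hj).1
    push_cast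
    linarith
  refine (Finset.sum_le_sum hterm).trans ?_
  rcases le_or_gt J 2 with hJ | hJ
  · rw [Finset.Ico_eq_empty (by omega)]; norm_num
  rw [Finset.sum_eq_sum_Ico_succ_bot hJ, Finset.sum_Ico_eq_sum_range]
  have h4 : x ^ 2 ^ 2 ≤ 0.5063 := (pow_le_pow_left₀ hx0.le hx1 _).trans (by norm_num)
  have h9 : x ^ 9 ≤ 0.2162 := (pow_le_pow_left₀ hx0.le hx1 _).trans (by norm_num)
  have h7 : x ^ 7 ≤ 0.31 := (pow_le_pow_left₀ hx0.le hx1 _).trans (by norm_num)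
  have hle1 : x ≤ 1 := by linarith
  have hgeo : ∑ i ∈ Finset.range (J - (2 + 1)), x ^ (2 + 1 + i) ^ 2 ≤ 0.2162 * (1 - 0.31)⁻¹ := by
    calc ∑ i ∈ Finset.range (J - (2 + 1)), x ^ (2 + 1 + i) ^ 2
        ≤ ∑ i ∈ Finset.range (J - (2 + 1)), 0.2162 * (0.31 : ℝ) ^ i := by
          refine Finset.sum_le_sum fun i _ => ?_
          calc x ^ (2 + 1 + i) ^ 2 ≤ x ^ (9 + 7 * i) := by
                refine pow_le_pow_of_le_one hx0.le hle1 ?_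
                rcases Nat.eq_zero_or_pos i with rfl | hi
                · norm_num
                · nlinarith
            _ = x ^ 9 * (x ^ 7) ^ i := by rw [pow_add, pow_mul]
            _ ≤ 0.2162 * (0.31 : ℝ) ^ i := mul_le_mul h9 (pow_le_pow_left₀ (by positivity) h7 _)
                (by positivity) (by norm_num)
      _ = 0.2162 * ∑ i ∈ Finset.range (J - (2 + 1)), (0.31 : ℝ) ^ i := by rw [Finset.mul_sum]
      _ ≤ 0.2162 * (1 - 0.31)⁻¹ := by
          refine mul_le_mul_of_nonneg_left ?_ (by norm_num)
          rw [← tsum_geometric_of_lt_one (by norm_num) (by norm_num : (0.31 : ℝ) < 1)]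
          exact (summable_geometric_of_lt_one (by norm_num) (by norm_num)).sum_le_tsum _
            fun i _ => by positivity
  have : (0.2162 : ℝ) * (1 - 0.31)⁻¹ ≤ 0.3137 := by norm_num
  linarith

/-- The number of cells that cross an axis near their nuclei is at most about `2.43` per unit of
length, except with exponentially small probability. -/
theorem exists_crossSum_bound.{u} {J : ℕ} (hJ : 2 ≤ J) :
    ∃ c : ℝ, 0 < c ∧ ∀ {Ω : Type u} [MeasurableSpace Ω] (μ : Measure Ω) [IsProbabilityMeasure μ]
      (Pts : Ω → Set Plane), IsUnitPoissonProcess μ Pts →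
      ∀ Φ Φ' : Plane → Plane, MeasurePreserving Φ volume volume →
      MeasurePreserving Φ' volume volume → ∀ (x : ℝ) (M : ℕ), 1 ≤ M →
        μ {ω | 2.43 * (J * M : ℝ) ≤ crossSum (Pts ω) Φ Φ' x (100 * J * M) J} ≤
          ENNReal.ofReal (200 * J ^ 2 * Real.exp (-c * M)) := by
  have hJ' : (2 : ℝ) ≤ J := by exact_mod_cast hJ
  set η : ℝ := 1 / (100000 * (2 * J + 1)) with hη
  have hη0 : 0 < η := by positivity
  obtain ⟨c₀, hc₀, H₀⟩ := exists_rowSum_bound (r := 0) (w := 2 / 3) le_rfl (by norm_num)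
    (by norm_num) hη0 (b := 100 * J) (by push_cast; linarith)
  have hrow : ∀ j : ℕ, ∃ c : ℝ, 0 < c ∧ (2 ≤ j → j < J → ∀ {Ω : Type u} [MeasurableSpace Ω]
      (μ : Measure Ω) [IsProbabilityMeasure μ]
      (Pts : Ω → Set Plane), IsUnitPoissonProcess μ Pts →
      ∀ Φ : Plane → Plane, MeasurePreserving Φ volume volume → ∀ (x : ℝ) (M : ℕ),
        μ {ω | (100 * J : ℕ) * (M * (1 / 3 / 50 *
          Real.exp (-(Real.pi * ((j : ℝ) / 3) ^ 2 / 2 - (j / 3 : ℝ) / 50)) + η)) ≤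
          rowSum (Pts ω) Φ x (100 * J * M) (j / 3) (1 / 3)} ≤
          ENNReal.ofReal ((100 * J : ℕ) * Real.exp (-c * M))) := by
    intro j
    by_cases hj : 2 ≤ j ∧ j < J
    · have hjJ : (j : ℝ) + 1 ≤ J := by exact_mod_cast hj.2
      obtain ⟨c, hc, H⟩ := exists_rowSum_bound (r := (j : ℝ) / 3) (w := 1 / 3) (by positivity)
        (by norm_num) ((by positivity : (0 : ℝ) ≤ 0.171 * (j : ℝ) ^ 2).trans
          (half_disc_area_nonneg hj.1)) hη0 (b := 100 * J) (by
            push_cast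
            have : (0 : ℝ) ≤ j := by positivity
            linarith)
      exact ⟨c, hc, fun _ _ => H⟩
    · exact ⟨1, one_pos, fun h1 h2 => absurd ⟨h1, h2⟩ hj⟩
  choose cj hcj Hj using hrow
  obtain ⟨c, hc, hcle⟩ := exists_pos_le (Finset.range J) cj hcj
  refine ⟨min c c₀, lt_min hc hc₀, ?_⟩
  intro Ω _ μ _ Pts hP Φ Φ' hΦ hΦ' x M hM
  have hM' : (1 : ℝ) ≤ M := by exact_mod_cast hM
  set E : ℝ := (100 * J : ℕ) * Real.exp (-(min c c₀) * M) with hE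
  set τ : ℕ → ℝ := fun j => (100 * J : ℕ) * (M * (1 / 3 / 50 *
          Real.exp (-(Real.pi * ((j : ℝ) / 3) ^ 2 / 2 - (j / 3 : ℝ) / 50)) + η)) with hτ
  set A₀ := {ω | (100 * J : ℕ) * (M * (2 / 3 / 50 + η)) ≤ rowSum (Pts ω) Φ x (100 * J * M) 0 (2 / 3)}
  set A : ℕ → Set Ω := fun j => {ω | τ j ≤ rowSum (Pts ω) Φ x (100 * J * M) (j / 3) (1 / 3)}
  set A' : ℕ → Set Ω := fun j => {ω | τ j ≤ rowSum (Pts ω) Φ' x (100 * J * M) (j / 3) (1 / 3)}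
  have hA₀ : μ A₀ ≤ ENNReal.ofReal E := by
    have := H₀ μ Pts hP Φ hΦ x M
    rw [show Real.exp (-(Real.pi * 0 ^ 2 / 2 - 0 / 50)) = 1 by norm_num, mul_one] at this
    refine this.trans (ENNReal.ofReal_le_ofReal ?_)
    refine mul_le_mul_of_nonneg_left (Real.exp_le_exp.2 ?_) (by positivity)
    have := min_le_right c c₀
    nlinarith
  have hexp : ∀ j, 2 ≤ j → j < J → (100 * J : ℕ) * Real.exp (-(cj j) * M) ≤ E := by
    intro j _ h2
    refine mul_le_mul_of_nonneg_left (Real.exp_le_exp.2 ?_) (by positivity)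
    have := (min_le_left c c₀).trans (hcle j (Finset.mem_range.2 h2))
    nlinarith
  have hA : ∀ j ∈ Finset.Ico 2 J, μ (A j ∪ A' j) ≤ ENNReal.ofReal (2 * E) := by
    intro j hj
    obtain ⟨h1, h2⟩ := Finset.mem_Ico.1 hj
    have e1 := (Hj j h1 h2 μ Pts hP Φ hΦ x M).trans (ENNReal.ofReal_le_ofReal (hexp j h1 h2))
    have e2 := (Hj j h1 h2 μ Pts hP Φ' hΦ' x M).trans (ENNReal.ofReal_le_ofReal (hexp j h1 h2))
    refine (measure_union_le _ _).trans ((add_le_add e1 e2).trans_eq ?_)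
    rw [← ENNReal.ofReal_add (by positivity) (by positivity), two_mul]
  have hsub : {ω | 2.43 * (J * M : ℝ) ≤ crossSum (Pts ω) Φ Φ' x (100 * J * M) J} ⊆
      A₀ ∪ ⋃ j ∈ Finset.Ico 2 J, (A j ∪ A' j) := by
    intro ω hω
    by_contra hcon
    simp only [Set.mem_union, Set.mem_iUnion, not_or, not_exists] at hcon
    obtain ⟨h0, hj⟩ := hcon
    have h0 : rowSum (Pts ω) Φ x (100 * J * M) 0 (2 / 3) <
        (100 * J : ℕ) * (M * (2 / 3 / 50 + η)) := lt_of_not_ge h0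
    have hsum : crossSum (Pts ω) Φ Φ' x (100 * J * M) J <
        (100 * J : ℕ) * (M * (2 / 3 / 50 + η)) + ∑ j ∈ Finset.Ico 2 J, (τ j + τ j) := by
      refine add_lt_add_of_lt_of_le h0 (Finset.sum_le_sum fun j hjm => ?_)
      have := hj j hjm
      exact add_le_add (lt_of_not_ge this.1).le (lt_of_not_ge this.2).le
    have hτsum : ∑ j ∈ Finset.Ico 2 J, (τ j + τ j) ≤
        (100 * J * M : ℝ) * (1 / 75 * 0.82 + 2 * J * η) := by
      have e : ∀ j, τ j + τ j = (100 * J * M : ℝ) * (1 / 75 *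
          Real.exp (-(Real.pi * ((j : ℝ) / 3) ^ 2 / 2 - (j / 3 : ℝ) / 50)) + 2 * η) := by
        intro j; rw [hτ]; push_cast; ring
      simp_rw [e]
      rw [← Finset.mul_sum, Finset.sum_add_distrib, ← Finset.mul_sum, Finset.sum_const,
        Nat.card_Ico, nsmul_eq_mul]
      refine mul_le_mul_of_nonneg_left (add_le_add (mul_le_mul_of_nonneg_left
        (sum_exp_half_disc_le J) (by norm_num)) ?_) (by positivity)
      have : ((J - 2 : ℕ) : ℝ) ≤ J := by exact_mod_cast Nat.sub_le _ _
      nlinarith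
    have hηe : η * (2 * J + 1) = 1 / 100000 := by rw [hη]; field_simp
    have hJM : (0 : ℝ) < J * M := by positivity
    have hω : 2.43 * (J * M : ℝ) ≤ crossSum (Pts ω) Φ Φ' x (100 * J * M) J := hω
    push_cast at hsum
    -- Per unit of length, the inner strip contributes `4/3`, the strips with shadows, counted in
    -- both frames, `4/3 · 0.82`, and the slack `10^(-3)`. The sum is below `2.43`.
    have : (100 * J * M : ℝ) * (2 / 3 / 50 + η) + (100 * J * M : ℝ) * (1 / 75 * 0.82 + 2 * J * η) =
      100 * (J * M : ℝ) * (1 / 75 * 1.82 + η * (2 * J + 1)) := by ring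
    rw [hηe] at this
    nlinarith
  refine (measure_mono hsub).trans ((measure_union_le _ _).trans ((add_le_add hA₀
    ((measure_biUnion_finset_le _ _).trans (Finset.sum_le_sum hA))).trans ?_))
  rw [Finset.sum_const, Nat.card_Ico, nsmul_eq_mul, ← ENNReal.ofReal_natCast,
    ← ENNReal.ofReal_mul (by positivity), ← ENNReal.ofReal_add (by positivity) (by positivity)]
  refine ENNReal.ofReal_le_ofReal ?_
  have h1 : ((J - 2 : ℕ) : ℝ) = J - 2 := by rw [Nat.cast_sub hJ]; norm_num
  rw [h1, hE]
  push_cast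
  have := Real.exp_pos (-(min c c₀) * M)
  nlinarith [mul_pos this (by linarith : (0 : ℝ) < J)]

/-! ### Cells that reach a segment far away from their nuclei. -/

/-- The boxes that meet the segment from a distant point of a cell to the nucleus are not good. -/
theorem not_good_of_far {a : ℝ} (ha : 0 < a) {P : Set Plane} {y t : Plane}
    (ht : t ∈ voronoiCell P y) (hd : 4 * a < dist t y) {p : Plane} (hp : p ∈ segment ℝ t y) :
    ¬ GoodBox a P (boxOf a p) := by
  -- If `p` is too close to the nucleus, replace it by the point of the segment at distance `2a`
  -- from the nucleus. An occupied box at `p'` would contain a point closer to `t` than `y`.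
  obtain ⟨p', hp', hfar, hnear⟩ : ∃ p' ∈ segment ℝ t y, 3 / 2 * a < dist p' y ∧ dist p' p ≤ 4 * a := by
    by_cases h1 : 3 / 2 * a < dist p y
    · exact ⟨p, hp, h1, by rw [dist_self]; positivity⟩
    · push Not at h1
      have hd0 : 0 < dist t y := by linarith
      set θ := 2 * a / dist t y
      have hθ : θ * dist t y = 2 * a := div_mul_cancel₀ _ hd0.ne'
      have hθ0 : 0 ≤ θ := by positivity
      have hθ1 : θ ≤ 1 := by rw [div_le_one hd0]; linarith
      have h2 : dist (AffineMap.lineMap y t θ) y = 2 * a := by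
        rw [dist_lineMap_left, Real.norm_of_nonneg hθ0, dist_comm, hθ]
      refine ⟨AffineMap.lineMap y t θ, ?_, by rw [h2]; linarith, ?_⟩
      · rw [segment_symm, segment_eq_image_lineMap]
        exact ⟨θ, ⟨hθ0, hθ1⟩, rfl⟩
      · have := dist_triangle_right (AffineMap.lineMap y t θ) p y
        linarith
  intro hg
  have hc := (hg (boxOf a p') ((near_boxOf ha (k := 4) (by push_cast; exact hnear)).mono
    (by norm_num))).1
  obtain ⟨w, hwP, hw⟩ := Set.nonempty_of_ncard_ne_zero hc
  have h1 : dist w p' ≤ 3 / 2 * a := dist_le_of_boxOf_eq ha hw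
  have h2 := ht w hwP
  have h3 := dist_add_dist_of_mem_segment hp'
  have h4 := dist_triangle t p' w
  rw [dist_comm p' w] at h4
  linarith

theorem ncard_boxesMeeting_segment_le {a : ℝ} (ha : 0 < a) (e : Plane) :
    ((boxesMeeting a (segment ℝ 0 e)).ncard : ℝ) ≤ 9 * (‖e‖ / a + 2) := by
  classical
  set N := ⌈‖e‖ / a⌉₊
  have hN : (N : ℝ) < ‖e‖ / a + 1 := Nat.ceil_lt_add_one (by positivity)
  have hN' : ‖e‖ ≤ N * a := by rw [← div_le_iff₀ ha]; exact Nat.le_ceil _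
  have hsub : boxesMeeting a (segment ℝ 0 e) ⊆
      (Finset.range (N + 1)).biUnion fun i => latSq (boxOf a ((i / N : ℝ) • e)) 1 := by
    rintro _ ⟨p, hp, rfl⟩
    rw [segment_eq_image_lineMap] at hp
    obtain ⟨θ, ⟨hθ0, hθ1⟩, rfl⟩ := hp
    have e1 : AffineMap.lineMap (0 : Plane) e θ = θ • e := by simp [AffineMap.lineMap_apply]
    rw [e1]
    refine Finset.mem_coe.2 (Finset.mem_biUnion.2 ⟨⌊θ * N⌋₊, ?_, mem_latSq.2 (near_boxOf ha ?_)⟩)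
    · rw [Finset.mem_range, Nat.lt_succ_iff]
      refine Nat.floor_le_of_le ?_
      have : (0 : ℝ) ≤ N := by positivity
      nlinarith
    · rw [dist_eq_norm, ← sub_smul, norm_smul]
      rcases Nat.eq_zero_or_pos N with h0 | h0
      · have : ‖e‖ = 0 := le_antisymm (by rw [h0] at hN'; simpa using hN') (norm_nonneg _)
        rw [this]; push_cast; linarith
      · have hNr : (0 : ℝ) < N := by exact_mod_cast h0
        have f1 := Nat.floor_le (by positivity : 0 ≤ θ * N)
        have f2 := Nat.lt_floor_add_one (θ * N)
        have f3 : |θ - ⌊θ * N⌋₊ / N| ≤ 1 / N := by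
          rw [abs_le]
          constructor
          · rw [← sub_nonneg]
            have : (⌊θ * N⌋₊ : ℝ) / N ≤ θ := by rw [div_le_iff₀ hNr]; exact f1
            have : (0 : ℝ) ≤ 1 / N := by positivity
            linarith
          · rw [sub_le_iff_le_add, ← add_div, le_div_iff₀ hNr]; linarith
        rw [Real.norm_eq_abs]
        calc |θ - ⌊θ * N⌋₊ / N| * ‖e‖ ≤ 1 / N * (N * a) := by gcongr
          _ = (1 : ℤ) * a := by push_cast; field_simp
  have h1 : (boxesMeeting a (segment ℝ 0 e)).ncard ≤ (N + 1) * 9 := by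
    rw [← Finset.card_range (N + 1)]
    refine (Set.ncard_le_ncard hsub (Finset.finite_toSet _)).trans ?_
    rw [Set.ncard_coe_finset]
    refine Finset.card_biUnion_le.trans (Finset.sum_le_card_nsmul _ _ _ fun i _ => ?_)
    have := card_latSq (boxOf a ((i / N : ℝ) • e)) (k := 1) (by norm_num)
    norm_num at this
    exact (by exact_mod_cast this.le)
  have h2 : ((boxesMeeting a (segment ℝ 0 e)).ncard : ℝ) ≤ (N + 1) * 9 := by exact_mod_cast h1
  linarith

namespace Coarse

variable {a t : ℝ} {P : Set Plane} {n m : ℕ} (h : Coarse a P n m t)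

include h

open Classical in
/-- Few cells reach a long segment far away from their nuclei. -/
theorem card_far_le {e : Plane} (he : ‖e‖ ≤ n) (hem : 2 * a * m ≤ ‖e‖) {Y : Finset Plane}
    (hY : ∀ y ∈ Y, y ∈ P ∧ ∃ p ∈ segment ℝ 0 e, p ∈ voronoiCell P y ∧ 4 * a < dist p y) :
    (Y.card : ℝ) ≤ 13000000 * (9 * ‖e‖ / a + 18 + t) := by
  have ha := h.a_pos
  have ha1 : 1 ≤ a := by linarith [h.ha]
  have hn := h.one_le_n
  have hn' : (1 : ℝ) ≤ n := by exact_mod_cast hn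
  have hchoice : ∀ y : Plane, ∃ p : Plane, y ∈ Y → p ∈ segment ℝ 0 e ∧ p ∈ voronoiCell P y ∧
      4 * a < dist p y := by
    intro y
    by_cases hy : y ∈ Y
    · obtain ⟨-, p, hp⟩ := hY y hy
      exact ⟨p, fun _ => hp⟩
    · exact ⟨0, fun hy' => absurd hy' hy⟩
  choose τ hτ using hchoice
  have hAf : (boxesMeeting a (segment ℝ 0 e)).Finite := finite_boxesMeeting ha (isBounded_segment _ _)
  have hTf : ∀ y, (boxesMeeting a (segment ℝ (τ y) y)).Finite := fun y =>
    finite_boxesMeeting ha (isBounded_segment _ _)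
  -- The boxes of the segment and, attached to them, the boxes between each far nucleus and a point
  -- where its cell reaches the segment. The latter are not good.
  set F := hAf.toFinset ∪ Y.biUnion fun y => (hTf y).toFinset with hF
  have hmem : ∀ z, z ∈ F ↔ z ∈ boxesMeeting a (segment ℝ 0 e) ∨
      ∃ y ∈ Y, z ∈ boxesMeeting a (segment ℝ (τ y) y) := by
    intro z; simp [hF]
  have h0 : boxOf a 0 = 0 := by simp [boxOf]
  have h0m : boxOf a 0 ∈ boxesMeeting a (segment ℝ 0 e) :=
    boxOf_mem_boxesMeeting (left_mem_segment ℝ _ _)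
  have hAlink : ∀ z ∈ boxesMeeting a (segment ℝ 0 e), Linked Nbr (F : Set (ℤ × ℤ)) (boxOf a 0) z :=
    fun z hz => (segment_linked ha h0m hz).mono fun w hw => Finset.mem_coe.2 ((hmem w).2 (Or.inl hw))
  have hroot : Rooted {boxOf a 0} F := by
    refine ⟨Finset.singleton_subset_iff.2 ((hmem _).2 (Or.inl h0m)), fun z hz => ⟨boxOf a 0, Finset.mem_singleton_self _, ?_⟩⟩
    rcases (hmem z).1 hz with hz | ⟨y, hy, hz⟩
    · exact hAlink z hz
    · refine (hAlink (boxOf a (τ y)) (boxOf_mem_boxesMeeting (hτ y hy).1)).trans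
        ((segment_linked ha (boxOf_mem_boxesMeeting (left_mem_segment ℝ _ _)) hz).mono
          fun w hw => Finset.mem_coe.2 ((hmem w).2 (Or.inr ⟨y, hy, hw⟩)))
  have hAn : ∀ p ∈ segment ℝ 0 e, Near n (boxOf a p) 0 := by
    intro p hp
    rw [← h0]
    refine near_boxOf ha ?_
    have h1 := dist_add_dist_of_mem_segment hp
    rw [dist_comm 0 p, dist_zero_left] at h1
    have h2 := dist_nonneg (x := p) (y := e)
    push_cast
    nlinarith
  have hYn : ∀ y ∈ Y, Near (4 * n) (boxOf a y) 0 := by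
    intro y hy
    obtain ⟨h1, h2, h3⟩ := hτ y hy
    obtain ⟨p, hpP, hp⟩ := h.exists_near ((hAn _ h1).mono (by omega))
    have h4 := dist_le_of_near ha hp
    have h5 := h2 p hpP
    have h6 : Near (3 * n) (boxOf a y) (boxOf a (τ y)) := by
      refine near_boxOf ha ?_
      rw [dist_comm] at h4
      rw [dist_comm]
      push_cast at h4 ⊢
      nlinarith
    exact (h6.trans (hAn _ h1)).mono (by omega)
  have hFn : ∀ z ∈ F, Near (1900 * n) z 0 := by
    intro z hz
    rcases (hmem z).1 hz with ⟨p, hp, rfl⟩ | ⟨y, hy, hz⟩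
    · exact (hAn p hp).mono (by omega)
    · exact near_of_mem_segment ha ((hAn _ (hτ y hy).1).mono (by omega))
        ((hYn y hy).mono (by omega)) hz
  have hAm : m ≤ hAf.toFinset.card := by
    have h1 := card_of_linked (F := hAf.toFinset) (hAf.mem_toFinset.2 h0m) (x := boxOf a e) (by
      rw [hAf.coe_toFinset]
      exact segment_linked ha h0m (boxOf_mem_boxesMeeting (right_mem_segment ℝ _ _)))
    have h2 := dist_le_of_near ha h1
    rw [dist_zero_right] at h2
    push_cast at h2
    have h3 : 2 * a * m ≤ 2 * a * hAf.toFinset.card := by nlinarith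
    exact_mod_cast le_of_mul_le_mul_left h3 (by positivity)
  have hAF : hAf.toFinset ⊆ F := Finset.subset_union_left
  have hmF : m * ({boxOf a 0} : Finset (ℤ × ℤ)).card ≤ F.card := by
    rw [Finset.card_singleton, mul_one]; exact hAm.trans (Finset.card_le_card hAF)
  set N := F.filter fun z => ¬ GoodBox a P z
  have hbad : ∀ y ∈ Y, ∀ z ∈ boxesMeeting a (segment ℝ (τ y) y), z ∈ N := by
    rintro y hy _ ⟨p, hp, rfl⟩
    exact Finset.mem_filter.2 ⟨(hmem _).2 (Or.inr ⟨y, hy, boxOf_mem_boxesMeeting hp⟩),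
      not_good_of_far ha (hτ y hy).2.1 (hτ y hy).2.2 hp⟩
  -- `k1` and `k3` bound `|F|` in terms of the boxes of the segment, about `‖e‖/a`. By `k2` the
  -- boxes that are not good number `O((|F| + t)/a²)`, so even `3a²` points in each of them, plus
  -- the excess bounded by `k5`, amount to `O(|F| + t)`.
  have k1 := h.card_not_good_le hroot hFn hmF
  have k2 := h.sq_mul_card_not_good_le hroot hFn hmF
  have k3 : F.card ≤ hAf.toFinset.card + N.card := by
    refine (Finset.card_le_card fun z hz => ?_).trans (Finset.card_union_le _ _)
    rw [Finset.mem_union]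
    rcases (hmem z).1 hz with hz | ⟨y, hy, hz⟩
    · exact Or.inl (hAf.mem_toFinset.2 hz)
    · exact Or.inr (hbad y hy z hz)
  have k3' : (F.card : ℝ) ≤ hAf.toFinset.card + N.card := by exact_mod_cast k3
  have k4 := ncard_boxesMeeting_segment_le ha e
  rw [Set.ncard_eq_toFinset_card _ hAf] at k4
  have k5 := h.peierls {boxOf a 0} F hroot (fun z hz => mem_latSq.2 ((hFn z hz).mono (by omega))) hmF
  have k6 : Y.card ≤ ∑ z ∈ N, boxCount a P z := by
    rw [Finset.card_eq_sum_card_fiberwise (f := boxOf a) (t := N) fun y hy =>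
      Finset.mem_coe.2 (hbad y hy _ (boxOf_mem_boxesMeeting (right_mem_segment ℝ _ _)))]
    refine Finset.sum_le_sum fun z _ => ?_
    unfold boxCount
    rw [← Set.ncard_coe_finset]
    refine Set.ncard_le_ncard (fun p hp => ?_) (h.fin z)
    have hp := Finset.mem_filter.1 (Finset.mem_coe.1 hp)
    exact ⟨(hY p hp.1).1, hp.2⟩
  have k7 : ∑ z ∈ N, (boxCount a P z : ℝ) ≤ N.card * (3 * a ^ 2) + (9 * F.card + t) := by
    calc ∑ z ∈ N, (boxCount a P z : ℝ)
        ≤ ∑ z ∈ N, (3 * a ^ 2 + penalty a (P ∩ boxSet a z).encard) :=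
          Finset.sum_le_sum fun z _ => boxCount_le_penalty a P z
      _ = N.card * (3 * a ^ 2) + ∑ z ∈ N, penalty a (P ∩ boxSet a z).encard := by
          rw [Finset.sum_add_distrib, Finset.sum_const, nsmul_eq_mul]
      _ ≤ N.card * (3 * a ^ 2) + ∑ z ∈ F, penalty a (P ∩ boxSet a z).encard :=
          add_le_add_right (Finset.sum_le_sum_of_subset_of_nonneg (Finset.filter_subset _ _)
            fun z _ _ => penalty_nonneg _ _) _
      _ ≤ _ := add_le_add_right k5 _
  have k6' : (Y.card : ℝ) ≤ ∑ z ∈ N, (boxCount a P z : ℝ) := by exact_mod_cast k6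
  have := h.ht0
  have k8 : 9 * ‖e‖ / a = 9 * (‖e‖ / a) := by ring
  have k9 : 0 ≤ ‖e‖ / a := by positivity
  rw [k8]
  linarith

end Coarse

/-! ### A disc inside the graph ball. -/

/-- Two vectors of the same norm are exchanged by the reflection in their perpendicular bisector. -/
theorem exists_frame (q : Plane) : ∃ ρ : Plane ≃ₗᵢ[ℝ] Plane, ρ q = !₂[‖q‖, 0] := by
  refine ⟨(ℝ ∙ (q - !₂[‖q‖, 0]))ᗮ.reflection, Submodule.reflection_sub ?_⟩
  rw [EuclideanSpace.norm_eq !₂[‖q‖, 0]]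
  simp

/-- A frame whose first axis passes through a given point. -/
noncomputable def frame (q : Plane) : Plane ≃ₗᵢ[ℝ] Plane := (exists_frame q).choose

theorem frame_apply_self (q : Plane) : frame q q = !₂[‖q‖, 0] := (exists_frame q).choose_spec

/-- The opposite frame, with its origin on the first axis of a given frame. -/
noncomputable def oppositeFrame (L : ℝ) (q p : Plane) : Plane := !₂[L, 0] - frame q p

theorem measurePreserving_frame (q : Plane) : MeasurePreserving (frame q) volume volume :=
  LinearIsometryEquiv.measurePreserving _

theorem measurePreserving_oppositeFrame (L : ℝ) (q : Plane) :
    MeasurePreserving (oppositeFrame L q) volume volume :=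
  (Measure.measurePreserving_sub_left volume (!₂[L, 0] : Plane)).comp (measurePreserving_frame q)

/-- The point of the plane with given integer coordinates. -/
noncomputable def latPoint (z : ℤ × ℤ) : Plane := !₂[(z.1 : ℝ), (z.2 : ℝ)]

theorem dist_latPoint_floor_le (x : Plane) : dist (latPoint (⌊x 0⌋, ⌊x 1⌋)) x ≤ 3 / 2 := by
  have key : ∀ u : ℝ, |(⌊u⌋ : ℝ) - u| ≤ 1 := fun u => by
    rw [abs_le]
    constructor <;> linarith [Int.floor_le u, Int.lt_floor_add_one u]
  have := dist_le_of_coord (p := latPoint (⌊x 0⌋, ⌊x 1⌋)) (q := x) (d := 1) (by norm_num)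
    (by simpa [latPoint] using key (x 0)) (by simpa [latPoint] using key (x 1))
  linarith

theorem near_floor_of_norm_le {x : Plane} {n : ℕ} (hx : ‖x‖ ≤ n) :
    Near (n + 1) (⌊x 0⌋, ⌊x 1⌋) 0 := by
  have key : ∀ i, -(n + 1 : ℤ) ≤ ⌊x i⌋ ∧ ⌊x i⌋ ≤ (n + 1 : ℤ) := by
    intro i
    have h1 : |x i - (0 : Plane) i| ≤ n := (abs_coord_le_dist x 0 i).trans (by rwa [dist_zero_right])
    have h2 := abs_le.1 h1
    rw [PiLp.zero_apply, sub_zero] at h2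
    constructor
    · refine Int.le_floor.2 ?_; push_cast; linarith
    · have := Int.floor_le (x i)
      have h3 : (⌊x i⌋ : ℝ) ≤ ((n : ℤ) : ℝ) := by push_cast; linarith
      have h4 : ⌊x i⌋ ≤ (n : ℤ) := by exact_mod_cast h3
      omega
  have h0 := key 0
  have h1 := key 1
  unfold Near
  simp only [Prod.fst_zero, Prod.snd_zero, sub_zero]
  exact ⟨h0.1, h0.2, h1.1, h1.2⟩

/-- On a regular configuration on which no axis is crossed by too many cells, the points of a disc
are in the graph ball. -/
theorem Coarse.edist_le_of_norm_le {a t : ℝ} {P : Set Plane} {n m : ℕ} (h : Coarse a P n m t)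
    {o : P} (ho : ∀ y ∈ P, dist (0 : Plane) o ≤ dist 0 y) {L : ℝ} (hL : 2 / 5 * n + 2 ≤ L)
    (hLn : L ≤ n) (hLm : 2 * a * m ≤ L) {J M : ℕ} (hJ : 12 * a + 1 ≤ J) (hM : L + 8 * a < J * M)
    (hcross : ∀ z : ℤ × ℤ, Near (n + 1) z 0 → crossSum P (frame (latPoint z))
      (oppositeFrame L (latPoint z)) (-(4 * a)) (100 * J * M) J < 2.43 * (J * M : ℝ))
    (hn : 2.43 * (J * M : ℝ) + 13000000 * (9 * L / a + 18 + t) +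
      ((3 * a ^ 2 + 9) * (2 * m + 1) ^ 2 + t) ≤ n) {x : P} (hx : ‖(x : Plane)‖ ≤ 2 / 5 * n) :
    (voronoiGraph P).edist o x ≤ n := by
  classical
  have ha := h.a_pos
  have hn1 : (1 : ℝ) ≤ n := by exact_mod_cast h.one_le_n
  have hxn : ‖(x : Plane)‖ ≤ n := by linarith
  set z : ℤ × ℤ := (⌊(x : Plane) 0⌋, ⌊(x : Plane) 1⌋)
  -- Only directions through lattice points are used, which keeps the union bound over axes
  -- quadratic in `n`.
  set q := latPoint z with hq
  have hqx : dist q x ≤ 3 / 2 := dist_latPoint_floor_le _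
  have hqn : ‖q‖ ≤ L := by
    have := dist_triangle q x 0
    rw [dist_zero_right, dist_zero_right] at this
    linarith
  have hL0 : 0 < L := by linarith
  set ρ := frame q
  -- The segment has the same length `L` for all points, so the same number of slabs serves every
  -- direction.
  set e := ρ.symm !₂[L, 0] with he
  have hρe : ρ e = !₂[L, 0] := by rw [he, LinearIsometryEquiv.apply_symm_apply]
  have hen : ‖e‖ = L := by
    rw [he, LinearIsometryEquiv.norm_map, EuclideanSpace.norm_eq]
    simp [hL0.le]
  set K := segment ℝ 0 e
  have hKmem : ∀ p ∈ K, ρ p 1 = 0 ∧ 0 ≤ ρ p 0 ∧ ρ p 0 ≤ L := by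
    intro p hp
    rw [show K = segment ℝ 0 e from rfl, segment_eq_image_lineMap] at hp
    obtain ⟨θ, ⟨hθ0, hθ1⟩, rfl⟩ := hp
    have e1 : AffineMap.lineMap (0 : Plane) e θ = θ • e := by simp [AffineMap.lineMap_apply]
    rw [e1, map_smul, hρe]
    simp
    constructor <;> nlinarith
  have hqK : q ∈ K := by
    rw [show K = segment ℝ 0 e from rfl, segment_eq_image_lineMap]
    refine ⟨‖q‖ / L, ⟨by positivity, (div_le_one hL0).2 hqn⟩, ρ.injective ?_⟩
    have e1 : AffineMap.lineMap (0 : Plane) e (‖q‖ / L) = (‖q‖ / L) • e := by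
      simp [AffineMap.lineMap_apply]
    rw [e1, map_smul, hρe, frame_apply_self]
    ext i
    fin_cases i
    · simp; field_simp
    · simp
  have hseg : ∀ u v : Plane, IsCompact (segment ℝ u v) := fun u v => by
    rw [segment_eq_image_lineMap]
    exact isCompact_Icc.image AffineMap.lineMap_continuous
  obtain ⟨y, hy⟩ := exists_mem_voronoiCell ha h.fin o.2 q
  have hoK : o ∈ cellsMeeting P K := ⟨0, ho, left_mem_segment ℝ _ _⟩
  have hself : (x : Plane) ∈ voronoiCell P x := fun w _ => by simp
  have d1 := edist_le_of_cellsMeeting ha h.fin (hseg 0 e) (convex_segment 0 e) hoK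
    (⟨q, hy, hqK⟩ : y ∈ cellsMeeting P K)
  have d2 := edist_le_of_cellsMeeting ha h.fin (hseg q x) (convex_segment q _)
    (⟨q, hy, left_mem_segment ℝ _ _⟩ : y ∈ cellsMeeting P (segment ℝ q x))
    (⟨x, hself, right_mem_segment ℝ _ _⟩ : x ∈ cellsMeeting P (segment ℝ q x))
  have hf1 := finite_cellsMeeting_of_isCompact ha h.fin (hseg 0 e)
  have hf2 := finite_cellsMeeting_of_isCompact ha h.fin (hseg q x)
  set S := hf1.toFinset.image (Subtype.val : P → Plane)
  have hSmem : ∀ w, w ∈ S ↔ w ∈ P ∧ ∃ p ∈ K, p ∈ voronoiCell P w := by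
    intro w
    simp only [S, Finset.mem_image, hf1.mem_toFinset]
    constructor
    · rintro ⟨w, ⟨p, hp, hpK⟩, rfl⟩
      exact ⟨w.2, p, hpK, hp⟩
    · rintro ⟨hw, p, hpK, hp⟩
      exact ⟨⟨w, hw⟩, ⟨p, hp, hpK⟩, rfl⟩
  have hScard : (cellsMeeting P K).ncard = S.card := by
    rw [Finset.card_image_of_injective _ Subtype.val_injective, Set.ncard_eq_toFinset_card _ hf1]
  -- Cells met within `4a` of their nuclei are counted by the crossing sum, the others by the
  -- Peierls bound.
  set Sn := S.filter fun w => ∃ p ∈ K, p ∈ voronoiCell P w ∧ dist p w ≤ 4 * a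
  set Sf := S.filter fun w => ∃ p ∈ K, p ∈ voronoiCell P w ∧ 4 * a < dist p w
  have hS : S.card ≤ Sn.card + Sf.card := by
    refine (Finset.card_le_card fun w hw => ?_).trans (Finset.card_union_le _ _)
    obtain ⟨-, p, hp, hpw⟩ := (hSmem w).1 hw
    rw [Finset.mem_union]
    rcases le_or_gt (dist p w) (4 * a) with hd | hd
    · exact Or.inl (Finset.mem_filter.2 ⟨hw, p, hp, hpw, hd⟩)
    · exact Or.inr (Finset.mem_filter.2 ⟨hw, p, hp, hpw, hd⟩)
  have c1 : (Sn.card : ℝ) < 2.43 * (J * M : ℝ) := by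
    refine lt_of_le_of_lt ?_ (hcross z (near_floor_of_norm_le hxn))
    refine card_le_crossSum ha h.fin (L := L) (fun p p' => LinearIsometryEquiv.dist_map _ _ _)
      (fun p p' => ?_) (fun p => ?_) ?_ (by linarith) fun w hw => ?_
    · unfold oppositeFrame
      rw [dist_sub_left, LinearIsometryEquiv.dist_map]
    · unfold oppositeFrame; simp
    · push_cast; linarith
    · obtain ⟨hwS, p, hp, hpw, hd⟩ := Finset.mem_filter.1 hw
      exact ⟨((hSmem w).1 hwS).1, p, hpw, hd, hKmem p hp⟩
  have c2 : (Sf.card : ℝ) ≤ 13000000 * (9 * L / a + 18 + t) := by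
    have := h.card_far_le (e := e) (Y := Sf) (by rw [hen]; exact hLn) (by rw [hen]; exact hLm)
      fun w hw => ⟨((hSmem w).1 (Finset.mem_filter.1 hw).1).1, (Finset.mem_filter.1 hw).2⟩
    rwa [hen] at this
  have hm1 : 1 ≤ m := h.hm1
  have hmn : m ≤ n := h.hm
  have hxnear : Near (1900 * n) (boxOf a (x : Plane)) 0 := by
    have h0 : boxOf a 0 = 0 := by simp [boxOf]
    rw [← h0]
    refine (near_boxOf ha (k := n) ?_).mono (by omega)
    rw [dist_zero_right]
    have := h.ha
    push_cast
    nlinarith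
  -- The short way from `q` to `x` crosses only cells with nuclei near `x`; a square of radius `m`
  -- is large enough for the Peierls bound.
  have c3 := h.card_points_le (c := boxOf a (x : Plane)) (R := m) (by positivity) (by nlinarith)
    (hxnear.mono (by omega)) (S := hf2.toFinset.image (Subtype.val : P → Plane)) (fun w hw => by
      obtain ⟨w, -, rfl⟩ := Finset.mem_image.1 hw; exact w.2) (fun w hw => by
      obtain ⟨w, hw', rfl⟩ := Finset.mem_image.1 hw
      obtain ⟨p, hp, hpK⟩ := hf2.mem_toFinset.1 hw'
      refine (near_boxOf ha (k := 1) ?_).mono (by omega)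
      have g1 := hp x x.2
      have g2 := dist_add_dist_of_mem_segment hpK
      have g3 := dist_triangle (w : Plane) p x
      rw [dist_comm (w : Plane) p] at g3
      have g4 := dist_nonneg (x := q) (y := p)
      have := h.ha
      push_cast
      linarith)
  rw [Finset.card_image_of_injective _ Subtype.val_injective,
    ← Set.ncard_eq_toFinset_card _ hf2] at c3
  have hS' : (S.card : ℝ) ≤ Sn.card + Sf.card := by exact_mod_cast hS
  have htot : ((cellsMeeting P K).ncard : ℝ) + (cellsMeeting P (segment ℝ q x)).ncard ≤ n := by
    rw [hScard]
    push_cast at c3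
    linarith
  have htot' : (cellsMeeting P K).ncard + (cellsMeeting P (segment ℝ q x)).ncard ≤ n := by
    exact_mod_cast htot
  calc (voronoiGraph P).edist o x ≤ (voronoiGraph P).edist o y + (voronoiGraph P).edist y x :=
        SimpleGraph.edist_triangle
    _ ≤ (cellsMeeting P K).ncard + (cellsMeeting P (segment ℝ q x)).ncard := add_le_add d1 d2
    _ ≤ n := by exact_mod_cast htot'

/-! ### Absence of bad sets on regular configurations. -/

/-- On a regular configuration with a large graph ball there is no bad set. -/
theorem Coarse.not_hasBadSet {a t κ : ℝ} {P : Set Plane} {n m k C : ℕ} (h : Coarse a P n m t)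
    (hball : ∀ o : P, (∀ y ∈ P, dist (0 : Plane) o ≤ dist 0 y) → ∃ X : Finset P,
      (∀ x ∈ X, (voronoiGraph P).edist o x ≤ n) ∧ 0.501 * (n : ℝ) ^ 2 ≤ X.card)
    (hC : 2312 * (14283 * a ^ 2 + 1) ≤ C) (hCm : (C * m : ℝ) ≤ 100 * n) (ht : t = κ * √(k : ℝ))
    (hκ0 : 0 ≤ κ) (hκC : 20 * C * κ ≤ 100) (hκ : κ ≤ 1 / 4) (hk1 : 1 ≤ k)
    (hk : (k : ℝ) ≤ (n : ℝ) ^ 2 / 2)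
    (hb : (3 * a ^ 2 + 9) * (900 * C ^ 2) * (2 * κ * √(k : ℝ)) ^ 2 +
      κ * √(k : ℝ) * ((3 * a ^ 2 + 9) * (9 * C ^ 2 * m ^ 2) + 2 * t) ≤ k / 1000) :
    ¬ HasBadSet (κ / 625) n k P := by
  classical
  rintro ⟨o, ho, A, hAB, -, hAk, hAD⟩
  have hn1 : (1 : ℝ) ≤ n := by exact_mod_cast h.one_le_n
  have hk1' : (1 : ℝ) ≤ k := by exact_mod_cast hk1
  have hsk0 : 0 ≤ √(k : ℝ) := Real.sqrt_nonneg _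
  have hskn : √(k : ℝ) ≤ n := by
    rw [Real.sqrt_le_left (by positivity)]
    nlinarith
  set I := interiorBoundary (voronoiGraph P) (graphBall (voronoiGraph P) o n) (A : Set P)
  have hIA : I ⊆ A := fun v hv => hv.1.1
  have hIf : I.Finite := (Finset.finite_toSet A).subset hIA
  set D := hIf.toFinset
  have hDc : 625 * (D.card : ℝ) ≤ κ * √(k : ℝ) := by
    rw [Set.ncard_eq_toFinset_card _ hIf] at hAD
    have : 625 * (D.card : ℝ) ≤ 625 * (κ / 625 * √(k : ℝ)) :=
      mul_le_mul_of_nonneg_left hAD (by norm_num)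
    linarith
  have hΘ : 625 * (D.card : ℝ) + t ≤ 2 * κ * √(k : ℝ) := by rw [ht]; linarith
  have hκn : κ * √(k : ℝ) ≤ κ * n := mul_le_mul_of_nonneg_left hskn hκ0
  have hsep : Separation a P n m t o D :=
    { toCoarse := h
      nearest := ho
      sub := fun d hd => hAB (hIA (hIf.mem_toFinset.1 hd))
      small := by
        have := mul_le_mul_of_nonneg_right hκ (by positivity : (0 : ℝ) ≤ n)
        linarith }
  have hD : ∀ x ∈ (A : Set P), ∀ y, (voronoiGraph P).edist o y ≤ n → y ∉ (A : Set P) →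
      (voronoiGraph P).Adj x y → x ∈ D := fun x hx y hy hyA hxy =>
    hIf.mem_toFinset.2 ⟨⟨hx, y, hyA, hxy⟩, y, ⟨hy, hyA⟩, hxy⟩
  have ht0 := h.ht0
  have hlost : ∀ L : Finset P, (∀ v ∈ L, (voronoiGraph P).edist o v ≤ n ∧ Lost a n D o v) →
      (L.card : ℝ) ≤ k / 1000 := by
    intro L hL
    refine (hsep.card_lost_le hC ?_ hCm hL).trans (le_trans (add_le_add ?_ ?_) hb)
    · have h1 := mul_le_mul_of_nonneg_left (hΘ.trans (by linarith : 2 * κ * √(k : ℝ) ≤ 2 * κ * n))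
        (by positivity : (0 : ℝ) ≤ 10 * C)
      nlinarith
    · exact mul_le_mul_of_nonneg_left (pow_le_pow_left₀ (by positivity) hΘ 2) (by positivity)
    · exact mul_le_mul_of_nonneg_right hDc (by positivity)
  -- If `A` has a vertex that is not lost, all vertices of `X` outside `A` are lost, so `|X| ≤ 1.001
  -- k ≤ 0.5005 n²`. Otherwise all `k` vertices of `A` are among the at most `k/1000` lost ones.
  by_cases hex : ∃ v ∈ A, ¬ Lost a n D o v
  · obtain ⟨v, hvA, hvl⟩ := hex
    obtain ⟨X, hX, hXc⟩ := hball o ho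
    have h1 := hlost (X \ A) fun w hw => by
      obtain ⟨hwX, hwA⟩ := Finset.mem_sdiff.1 hw
      refine ⟨hX w hwX, ?_⟩
      by_contra hwl
      exact hwA (Finset.mem_coe.1 ((hsep.mem_iff_of_not_lost hD (hAB hvA) (hX w hwX) hvl hwl).1
        (Finset.mem_coe.2 hvA)))
    have h2 : X.card ≤ (X \ A).card + A.card := by
      refine (Finset.card_le_card fun w hw => ?_).trans (Finset.card_union_le _ _)
      rw [Finset.mem_union, Finset.mem_sdiff]
      by_cases hwA : w ∈ A
      · exact Or.inr hwA
      · exact Or.inl ⟨hw, hwA⟩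
    have h2' : (X.card : ℝ) ≤ (X \ A).card + k := by rw [hAk] at h2; exact_mod_cast h2
    nlinarith
  · push Not at hex
    have h1 := hlost A fun v hv => ⟨hAB hv, hex v hv⟩
    rw [hAk] at h1
    linarith

/-! ### Asymptotics and the final probability bound. -/

/-- Since `√k ≥ n^(α/2)`, this makes the terms in `m²` negligible against `√k`. The threshold `n₀`
is the only place where `α` enters. -/
theorem exists_log_growth {α G : ℝ} (hα : 0 < α) (hG : 0 ≤ G) : ∃ n₀ : ℕ, ∀ n : ℕ, n₀ ≤ n →
    G * (2 * (⌈2 * Real.log (4000 * n + 1)⌉₊ : ℝ) + 1) ^ 2 ≤ (n : ℝ) ^ (α / 2) := by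
  set s := α / 8 with hs
  have hs0 : 0 < s := by positivity
  set K := 4 * ((4001 : ℝ) ^ s / s) + 3 with hK
  have hK0 : 0 ≤ K := by positivity
  have hlim : Filter.Tendsto (fun n : ℕ => (n : ℝ) ^ (α / 4)) Filter.atTop Filter.atTop :=
    (tendsto_rpow_atTop (by positivity)).comp tendsto_natCast_atTop_atTop
  obtain ⟨n₀, hn₀⟩ := Filter.eventually_atTop.1 (hlim.eventually_ge_atTop (G * K ^ 2))
  refine ⟨max n₀ 1, fun n hn => ?_⟩
  have h1 := hn₀ n ((le_max_left _ _).trans hn)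
  have hn1 : (1 : ℝ) ≤ n := by exact_mod_cast (le_max_right n₀ 1).trans hn
  have hlog0 : 0 ≤ Real.log (4000 * n + 1) := Real.log_nonneg (by linarith)
  have hceil := Nat.ceil_lt_add_one (by positivity : 0 ≤ 2 * Real.log (4000 * n + 1))
  have hlog : Real.log (4000 * n + 1) ≤ (4001 : ℝ) ^ s / s * (n : ℝ) ^ s := by
    refine (Real.log_le_rpow_div (by positivity) hs0).trans ?_
    rw [div_mul_eq_mul_div, ← Real.mul_rpow (by norm_num) (by positivity)]
    exact div_le_div_of_nonneg_right (Real.rpow_le_rpow (by positivity) (by linarith) hs0.le) hs0.le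
  have hns : (1 : ℝ) ≤ (n : ℝ) ^ s := Real.one_le_rpow hn1 hs0.le
  have h2 : 2 * (⌈2 * Real.log (4000 * n + 1)⌉₊ : ℝ) + 1 ≤ K * (n : ℝ) ^ s := by
    rw [hK]; nlinarith
  have e1 : ((n : ℝ) ^ s) ^ 2 = (n : ℝ) ^ (α / 4) := by
    rw [← Real.rpow_natCast, ← Real.rpow_mul (by positivity)]
    congr 1; rw [hs]; push_cast; ring
  have e2 : (n : ℝ) ^ (α / 4) * (n : ℝ) ^ (α / 4) = (n : ℝ) ^ (α / 2) := by
    rw [← Real.rpow_add (by positivity)]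
    congr 1; ring
  calc G * (2 * (⌈2 * Real.log (4000 * n + 1)⌉₊ : ℝ) + 1) ^ 2
      ≤ G * (K * (n : ℝ) ^ s) ^ 2 :=
        mul_le_mul_of_nonneg_left (pow_le_pow_left₀ (by positivity) h2 2) hG
    _ = G * K ^ 2 * (n : ℝ) ^ (α / 4) := by rw [mul_pow, e1]; ring
    _ ≤ (n : ℝ) ^ (α / 4) * (n : ℝ) ^ (α / 4) := mul_le_mul_of_nonneg_right h1 (by positivity)
    _ = _ := e2

/-- Half of the exponential rate absorbs the number of lattice directions. -/
theorem sq_mul_exp_le {β : ℝ} (hβ : 0 < β) (n : ℕ) :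
    (2 * n + 3 : ℝ) ^ 2 * Real.exp (-(β * n)) ≤ (15 + 80 / β ^ 2) * Real.exp (-(β / 2 * n)) := by
  have e : Real.exp (-(β / 2 * n)) = Real.exp (β / 2 * n) * Real.exp (-(β * n)) := by
    rw [← Real.exp_add]; congr 1; ring
  rw [e, ← mul_assoc]
  refine mul_le_mul_of_nonneg_right ?_ (Real.exp_pos _).le
  have h1 := Real.quadratic_le_exp_of_nonneg (x := β / 2 * n) (by positivity)
  have h2 : 0 ≤ β / 2 * n := by positivity
  have h3 : β ^ 2 * n ^ 2 / 8 ≤ Real.exp (β / 2 * n) := by nlinarith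
  have h4 : 1 ≤ Real.exp (β / 2 * n) := by nlinarith [sq_nonneg (β / 2 * n)]
  have h5 := mul_le_mul_of_nonneg_left h3 (by positivity : 0 ≤ 80 / β ^ 2)
  have h6 : 80 / β ^ 2 * (β ^ 2 * (n : ℝ) ^ 2 / 8) = 10 * (n : ℝ) ^ 2 := by field_simp; ring
  rw [h6] at h5
  nlinarith [sq_nonneg ((n : ℝ) - 1)]

/-- With high probability a disc contains more than half as many points as the square of the
graph distance in which it is contained. -/
theorem IsUnitPoissonProcess.measure_disc_le {Ω : Type*} [MeasurableSpace Ω] {μ : Measure Ω}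
    [IsProbabilityMeasure μ] {Pts : Ω → Set Plane} (h : IsUnitPoissonProcess μ Pts) (n : ℕ) :
    μ {ω | ((Pts ω ∩ Metric.ball 0 (2 / 5 * n)).encard.toNat : ℝ) ≤ 0.501 * (n : ℝ) ^ 2} ≤
      ENNReal.ofReal (Real.exp (-(1 / 10 ^ 7 * n ^ 2))) := by
  have hv : volume (Metric.ball (0 : Plane) (2 / 5 * n)) =
      ENNReal.ofReal (Real.pi * (2 / 5 * n) ^ 2) := by
    rw [EuclideanSpace.volume_ball_fin_two, mul_comm, ENNReal.ofReal_mul Real.pi_pos.le,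
      ENNReal.ofReal_pow (by positivity)]
  -- The deviation `0.001` suffices because `0.999 · 0.16 π > 0.501`.
  have h1 := h.measure_count_le (B := Metric.ball 0 (2 / 5 * n)) Metric.isOpen_ball.measurableSet
    (by rw [hv]; exact ENNReal.ofReal_ne_top) (δ := 0.001) (by norm_num) (by norm_num)
  rw [hv, ENNReal.toReal_ofReal (by positivity)] at h1
  have hpi := Real.pi_gt_d2
  have hn2 : (0 : ℝ) ≤ (n : ℝ) ^ 2 := by positivity
  refine (measure_mono fun ω hω => ?_).trans (h1.trans (ENNReal.ofReal_le_ofReal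
    (Real.exp_le_exp.2 ?_)))
  · have hω : ((Pts ω ∩ Metric.ball 0 (2 / 5 * n)).encard.toNat : ℝ) ≤ 0.501 * (n : ℝ) ^ 2 := hω
    refine hω.trans ?_
    nlinarith
  · nlinarith

theorem exists_finset_of_count {P U : Set Plane} (hf : (P ∩ U).Finite) {s : ℝ}
    (h : s ≤ (P ∩ U).encard.toNat) :
    ∃ X : Finset P, (∀ x ∈ X, (x : Plane) ∈ U) ∧ s ≤ X.card := by
  classical
  refine ⟨hf.toFinset.subtype (· ∈ P), fun x hx => ?_, h.trans_eq ?_⟩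
  · exact (hf.mem_toFinset.1 (Finset.mem_subtype.1 hx)).2
  · rw [Finset.card_subtype, Finset.filter_true_of_mem fun x hx => (hf.mem_toFinset.1 hx).1,
      ← Set.ncard_eq_toFinset_card _ hf]
    rfl

/-- For large `n` the conditions under which there are no bad sets hold up to exponentially small
probability. -/
theorem measure_hasBadSet_le.{u} {a κ c₁ : ℝ} {C J : ℕ} (ha : a = 10 ^ 11)
    (hC : 2312 * (14283 * a ^ 2 + 1) ≤ C) (hJ : 12 * a + 1 ≤ J) (hJ' : (J : ℝ) ≤ 12 * a + 2)
    (hκ0 : 0 < κ) (hκ : κ ≤ 1 / 10 ^ 10) (hκC : κ * C ≤ 1)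
    (hκK : κ * ((3 * a ^ 2 + 9) * (3600 * C ^ 2) + 2) ≤ 1 / 2000) (hc₁ : 0 < c₁)
    (hcross : ∀ {Ω : Type u} [MeasurableSpace Ω] (μ : Measure Ω) [IsProbabilityMeasure μ]
      (Pts : Ω → Set Plane), IsUnitPoissonProcess μ Pts →
      ∀ Φ Φ' : Plane → Plane, MeasurePreserving Φ volume volume →
      MeasurePreserving Φ' volume volume → ∀ (x : ℝ) (M : ℕ), 1 ≤ M →
        μ {ω | 2.43 * (J * M : ℝ) ≤ crossSum (Pts ω) Φ Φ' x (100 * J * M) J} ≤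
          ENNReal.ofReal (200 * J ^ 2 * Real.exp (-c₁ * M)))
    {Ω : Type u} [MeasurableSpace Ω] {μ : Measure Ω} [IsProbabilityMeasure μ]
    {Pts : Ω → Set Plane} (hP : IsUnitPoissonProcess μ Pts) {n m k : ℕ}
    (hm : m = ⌈2 * Real.log (4000 * n + 1)⌉₊) (hn : (10 : ℝ) ^ 15 ≤ n)
    (hmn : (2000 * ((3 * a ^ 2 + 9) * (9 * C ^ 2)) + 100 * (3 * a ^ 2 + 9) + 5 * a + C + 1) *
      (2 * (m : ℝ) + 1) ^ 2 ≤ n)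
    (hmk : (2000 * ((3 * a ^ 2 + 9) * (9 * C ^ 2)) + 100 * (3 * a ^ 2 + 9) + 5 * a + C + 1) *
      (2 * (m : ℝ) + 1) ^ 2 ≤ √(k : ℝ)) (hk1 : 1 ≤ k) (hk : (k : ℝ) ≤ (n : ℝ) ^ 2 / 2) :
    μ {ω | HasBadSet (κ / 625) n k (Pts ω)} ≤
      ENNReal.ofReal (Real.exp (1 - κ * √(k : ℝ)) + Real.exp (-(1 / 10 ^ 7 * n ^ 2)) +
        200 * J ^ 2 * ((2 * n + 3) ^ 2 * Real.exp (-(2 / 5 * c₁ / J * n)))) := by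
  have ha0 : 0 < a := by rw [ha]; norm_num
  have hn1 : (1 : ℝ) ≤ n := le_trans (by norm_num) hn
  have hJ0 : (0 : ℝ) < J := by linarith
  have hk1' : (1 : ℝ) ≤ k := by exact_mod_cast hk1
  have hsk1 : 1 ≤ √(k : ℝ) := Real.one_le_sqrt.2 hk1'
  have hsk : √(k : ℝ) * √(k : ℝ) = k := Real.mul_self_sqrt (by positivity)
  have hskn : √(k : ℝ) ≤ n := by
    rw [Real.sqrt_le_left (by positivity)]
    nlinarith
  have hm1 : 1 ≤ m := by
    rw [hm, Nat.one_le_ceil_iff]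
    have := Real.log_pos (by linarith : (1 : ℝ) < 4000 * n + 1)
    linarith
  have hm1' : (1 : ℝ) ≤ m := by exact_mod_cast hm1
  have hmm : (m : ℝ) ≤ (2 * (m : ℝ) + 1) ^ 2 := by nlinarith
  have hmsq : (m : ℝ) ^ 2 ≤ (2 * (m : ℝ) + 1) ^ 2 := by nlinarith
  set s := (2 * (m : ℝ) + 1) ^ 2 with hs
  have hs0 : 0 ≤ s := by positivity
  set A3 := 3 * a ^ 2 + 9 with hA3
  have hA30 : 0 < A3 := by positivity
  have hpos1 : 0 ≤ A3 * (9 * (C : ℝ) ^ 2) * s := by positivity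
  have hpos2 : 0 ≤ A3 * s := by positivity
  have hpos3 : 0 ≤ a * s := by positivity
  have hpos4 : 0 ≤ C * s := by positivity
  have hmn' : 2000 * (A3 * (9 * (C : ℝ) ^ 2) * s) + 100 * (A3 * s) + 5 * (a * s) + C * s + s ≤ n :=
    le_trans (le_of_eq (by ring)) hmn
  have hmk' : 2000 * (A3 * (9 * (C : ℝ) ^ 2) * s) + 100 * (A3 * s) + 5 * (a * s) + C * s + s ≤
    √(k : ℝ) := le_trans (le_of_eq (by ring)) hmk
  have f1 : A3 * s ≤ n / 100 := by linarith
  have f2 : a * s ≤ n / 5 := by linarith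
  have f3 : C * s ≤ n := by linarith
  have f4 : s ≤ n := by linarith
  have f5 : A3 * (9 * (C : ℝ) ^ 2) * s ≤ √(k : ℝ) / 2000 := by linarith
  clear hmn hmk hmn' hmk'
  -- With this `t` the Peierls bound fails with probability at most `e^(1 - κ√k)`, the source of the
  -- rate in `√k`.
  set t := κ * √(k : ℝ) with ht
  have ht0 : 0 ≤ t := by positivity
  have htn : t ≤ 1 / 10 ^ 10 * n := mul_le_mul hκ hskn (by positivity) (by norm_num)
  set L : ℝ := 2 / 5 * n + 2 with hL
  set M := ⌊(L + 8 * a) / J⌋₊ + 1 with hM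
  have hM1 : L + 8 * a < J * M := by
    have h1 := Nat.lt_floor_add_one ((L + 8 * a) / J)
    rw [div_lt_iff₀ hJ0] at h1
    rw [hM]; push_cast; linarith
  have hM2 : J * M ≤ L + 8 * a + J := by
    have h1 := Nat.floor_le (by positivity : 0 ≤ (L + 8 * a) / J)
    rw [le_div_iff₀ hJ0] at h1
    rw [hM]; push_cast; linarith
  set E₁ := {ω | ¬ PeierlsBound (fun z => penalty a (Pts ω ∩ boxSet a z).encard)
    (latSq 0 (2000 * n)) m t}
  set E₂ := {ω | ((Pts ω ∩ Metric.ball 0 (2 / 5 * n)).encard.toNat : ℝ) ≤ 0.501 * (n : ℝ) ^ 2}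
  set E₃ : ℤ × ℤ → Set Ω := fun z => {ω | 2.43 * (J * M : ℝ) ≤ crossSum (Pts ω) (frame (latPoint z))
    (oppositeFrame L (latPoint z)) (-(4 * a)) (100 * J * M) J}
  set E₀ := {ω | ¬ ∀ z, (Pts ω ∩ boxSet a z).Finite}
  have hE₀ : μ E₀ = 0 := hP.ae_finite_box ha0
  have hE₁ : μ E₁ ≤ ENNReal.ofReal (Real.exp (1 - t)) := by
    refine hP.measure_not_peierlsBound (by rw [ha]; norm_num) _ m ?_ t
    have h1 : ((latSq 0 (2000 * n)).card : ℝ) = (4000 * n + 1) ^ 2 := by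
      have := card_latSq 0 (k := 2000 * n) (by positivity)
      have h2 : (((latSq 0 (2000 * n)).card : ℤ) : ℝ) = ((2 * (2000 * n) + 1) ^ 2 : ℤ) := by
        rw [this]
      push_cast at h2
      rw [h2]; ring
    rw [h1]
    -- The value of `m` makes `e^m` at least the number of boxes in the window.
    calc ((4000 * n + 1 : ℝ)) ^ 2 = Real.exp (2 * Real.log (4000 * n + 1)) := by
          rw [← Real.exp_log (by positivity : (0 : ℝ) < 4000 * n + 1), ← Real.exp_nat_mul,
            Real.log_exp]
          push_cast
          rfl
      _ ≤ _ := Real.exp_le_exp.2 (by rw [hm]; exact Nat.le_ceil _)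
  have hE₂ : μ E₂ ≤ ENNReal.ofReal (Real.exp (-(1 / 10 ^ 7 * n ^ 2))) := hP.measure_disc_le n
  have hE₃ : ∀ z, μ (E₃ z) ≤ ENNReal.ofReal (200 * J ^ 2 * Real.exp (-(2 / 5 * c₁ / J * n))) := by
    intro z
    refine (hcross μ Pts hP _ _ (measurePreserving_frame _) (measurePreserving_oppositeFrame L _)
      (-(4 * a)) M (by omega)).trans (ENNReal.ofReal_le_ofReal (mul_le_mul_of_nonneg_left
        (Real.exp_le_exp.2 ?_) (by positivity)))
    have h1 : 2 / 5 * (n : ℝ) / J ≤ M := by rw [div_le_iff₀ hJ0]; linarith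
    have h2 := mul_le_mul_of_nonneg_left h1 hc₁.le
    have h3 : 2 / 5 * c₁ / J * n = c₁ * (2 / 5 * n / J) := by ring
    rw [h3]
    linarith
  have hsub : {ω | HasBadSet (κ / 625) n k (Pts ω)} ⊆
      (E₀ ∪ E₁) ∪ (E₂ ∪ ⋃ z ∈ latSq 0 (n + 1), E₃ z) := by
    intro ω hω
    by_contra hcon
    simp only [Set.mem_union, Set.mem_iUnion, not_or, not_exists] at hcon
    obtain ⟨⟨h0, h1⟩, h2, h3⟩ := hcon
    have hfin : LocFinite a (Pts ω) := not_not.1 h0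
    have hco : Coarse a (Pts ω) n m t :=
      { ha := by rw [ha]; norm_num
        fin := hfin
        peierls := not_not.1 h1
        ht0 := ht0
        ht := by linarith
        hm1 := hm1
        hm := by
          have : (m : ℝ) ≤ n := hmm.trans f4
          exact_mod_cast this }
    refine hco.not_hasBadSet (C := C) ?_ hC ?_ ht hκ0.le ?_ ?_ hk1 hk ?_ hω
    · intro o ho
      have hfb : (Pts ω ∩ Metric.ball 0 (2 / 5 * n)).Finite :=
        (hfin.finite_inter_closedBall ha0 0 (2 / 5 * n)).subset
          (Set.inter_subset_inter_right _ Metric.ball_subset_closedBall)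
      obtain ⟨X, hX, hXc⟩ := exists_finset_of_count hfb (le_of_lt (lt_of_not_ge h2))
      refine ⟨X, fun x hx => ?_, hXc⟩
      refine hco.edist_le_of_norm_le ho (L := L) le_rfl (by rw [hL]; linarith) ?_ hJ hM1
        (fun z hz => lt_of_not_ge fun hge => h3 z (mem_latSq.2 hz) hge) ?_
        (mem_ball_zero_iff.1 (hX x hx)).le
      · have : a * m ≤ a * s := mul_le_mul_of_nonneg_left hmm ha0.le
        rw [hL]; linarith
      · have h5 : 9 * L / a = 9 * L / 10 ^ 11 := by rw [ha]
        rw [h5]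
        have h7 : (J : ℝ) ≤ 12 * 10 ^ 11 + 2 := by rw [← ha]; exact hJ'
        have h8 : a = 10 ^ 11 := ha
        have h6 : (3 * a ^ 2 + 9) * (2 * (m : ℝ) + 1) ^ 2 ≤ n / 100 := f1
        rw [h8] at hM2
        linarith
    · have : (C : ℝ) * m ≤ C * s := mul_le_mul_of_nonneg_left hmm (by positivity)
      linarith
    · have : 20 * C * κ = 20 * (κ * C) := by ring
      linarith
    · linarith
    · have h5 : κ * ((A3 * (3600 * C ^ 2) + 2) * κ) ≤ κ * ((A3 * (3600 * C ^ 2) + 2) * 1) :=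
        mul_le_mul_of_nonneg_left (mul_le_mul_of_nonneg_left (by linarith) (by positivity)) hκ0.le
      have h6 := mul_le_mul_of_nonneg_right (h5.trans
        (by linarith : κ * ((A3 * (3600 * (C : ℝ) ^ 2) + 2) * 1) ≤ 1 / 2000))
        (by positivity : (0 : ℝ) ≤ k)
      have h7 : A3 * (9 * (C : ℝ) ^ 2) * m ^ 2 ≤ A3 * (9 * (C : ℝ) ^ 2) * s :=
        mul_le_mul_of_nonneg_left hmsq (by positivity)
      have h8 : A3 * (9 * (C : ℝ) ^ 2) * m ^ 2 ≤ √(k : ℝ) / 2000 := h7.trans f5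
      have h9 : κ * √(k : ℝ) * (A3 * (9 * (C : ℝ) ^ 2) * m ^ 2) ≤ 1 * √(k : ℝ) * (√(k : ℝ) / 2000) :=
        mul_le_mul (mul_le_mul_of_nonneg_right (by linarith) (by positivity)) h8 (by positivity)
          (by positivity)
      have e1 : A3 * (900 * C ^ 2) * (2 * κ * √(k : ℝ)) ^ 2 +
          κ * √(k : ℝ) * (A3 * (9 * C ^ 2 * m ^ 2) + 2 * t) =
          κ * ((A3 * (3600 * C ^ 2) + 2) * κ) * (√(k : ℝ) * √(k : ℝ)) +
          κ * √(k : ℝ) * (A3 * (9 * (C : ℝ) ^ 2) * m ^ 2) := by rw [ht]; ring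
      have e2 : 1 * √(k : ℝ) * (√(k : ℝ) / 2000) = k / 2000 := by
        rw [show 1 * √(k : ℝ) * (√(k : ℝ) / 2000) = √(k : ℝ) * √(k : ℝ) / 2000 by ring, hsk]
      rw [e1, hsk]
      linarith
  have hcard : ((latSq 0 (n + 1)).card : ℝ) = (2 * n + 3) ^ 2 := by
    have h1 := card_latSq 0 (k := (n : ℤ) + 1) (by positivity)
    have h2 : (((latSq 0 ((n : ℤ) + 1)).card : ℤ) : ℝ) = ((2 * ((n : ℤ) + 1) + 1) ^ 2 : ℤ) := by
      rw [h1]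
    push_cast at h2
    rw [h2]; ring
  have hU : μ (⋃ z ∈ latSq 0 (n + 1), E₃ z) ≤ ENNReal.ofReal (200 * J ^ 2 * ((2 * n + 3) ^ 2 *
      Real.exp (-(2 / 5 * c₁ / J * n)))) := by
    refine (measure_biUnion_finset_le _ _).trans ((Finset.sum_le_sum fun z _ => hE₃ z).trans_eq ?_)
    rw [Finset.sum_const, nsmul_eq_mul, ← ENNReal.ofReal_natCast,
      ← ENNReal.ofReal_mul (by positivity), hcard]
    congr 1; ring
  refine (measure_mono hsub).trans ((measure_union_le _ _).trans
    ((add_le_add (measure_union_le _ _) (measure_union_le _ _)).trans ?_))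
  rw [hE₀, zero_add]
  refine (add_le_add hE₁ (add_le_add hE₂ hU)).trans_eq ?_
  rw [← ENNReal.ofReal_add (by positivity) (by positivity),
    ← ENNReal.ofReal_add (by positivity) (by positivity), add_assoc]

theorem mainTheorem4 :
    ∃ ε₁ : ℝ, 0 < ε₁ ∧ ∃ c' : ℝ, 0 < c' ∧
      ∀ α : ℝ, 0 < α → α < 2 → ∃ c : ℝ, 0 < c ∧
        ∀ (Ω : Type*) [MeasurableSpace Ω] (μ : Measure Ω) [IsProbabilityMeasure μ]
          (Pts : Ω → Set Plane), IsUnitPoissonProcess μ Pts →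
          ∀ n k : ℕ, 1 ≤ n → (n : ℝ) ^ α ≤ (k : ℝ) → (k : ℝ) ≤ (n : ℝ) ^ 2 / 2 →
            μ {ω | HasBadSet ε₁ n k (Pts ω)} ≤
              ENNReal.ofReal (c * Real.exp (-c' * √(k : ℝ))) := by
  -- The side must be so large that the far cells, at most `13000000 · 9 / a` per unit of length,
  -- fit into the gap between `2.43 · 2/5` and `1`.
  obtain ⟨a, ha⟩ : ∃ a : ℝ, a = 10 ^ 11 := ⟨_, rfl⟩
  have ha0 : 0 < a := by rw [ha]; norm_num
  obtain ⟨C, hC⟩ := exists_nat_ge (2312 * (14283 * a ^ 2 + 1))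
  set J := ⌈12 * a + 1⌉₊
  have hJ : 12 * a + 1 ≤ J := Nat.le_ceil _
  have hJ' : (J : ℝ) ≤ 12 * a + 2 := by
    have := Nat.ceil_lt_add_one (by positivity : 0 ≤ 12 * a + 1)
    linarith
  have hJ2 : 2 ≤ J := by
    have : (2 : ℝ) ≤ J := le_trans (by rw [ha]; norm_num) hJ
    exact_mod_cast this
  obtain ⟨c₁, hc₁, hcross⟩ := exists_crossSum_bound hJ2
  set K₁ := (3 * a ^ 2 + 9) * (3600 * (C : ℝ) ^ 2) + 2
  have hK₁ : 0 < K₁ := by positivity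
  -- The three summands secure the bounds `hκ1`, `hκC` and `hκK`. Neither `κ` nor `c'` depends on
  -- `α`.
  set κ := 1 / (10 ^ 10 + C + 2000 * K₁) with hκ
  have hden : 0 < 10 ^ 10 + (C : ℝ) + 2000 * K₁ := by positivity
  have hκ0 : 0 < κ := by positivity
  have hC0 : (0 : ℝ) ≤ C := by positivity
  have hκ1 : κ ≤ 1 / 10 ^ 10 := one_div_le_one_div_of_le (by norm_num) (by linarith)
  have hκC : κ * C ≤ 1 := by
    rw [hκ, div_mul_eq_mul_div, div_le_one hden]; linarith
  have hκK : κ * K₁ ≤ 1 / 2000 := by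
    rw [hκ, div_mul_eq_mul_div, div_le_iff₀ hden]; linarith
  have hJ0 : (0 : ℝ) < J := by linarith
  set β := 2 / 5 * c₁ / J with hβ
  have hβ0 : 0 < β := by positivity
  set c' := min κ (min (1 / 10 ^ 7) (β / 2)) with hc'
  have hc'0 : 0 < c' := lt_min hκ0 (lt_min (by norm_num) (by positivity))
  have hc'1 : c' ≤ κ := min_le_left _ _
  have hc'2 : c' ≤ 1 / 10 ^ 7 := (min_le_right _ _).trans (min_le_left _ _)
  have hc'3 : c' ≤ β / 2 := (min_le_right _ _).trans (min_le_right _ _)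
  refine ⟨κ / 625, by positivity, c', hc'0, fun α hα hα2 => ?_⟩
  set G := 2000 * ((3 * a ^ 2 + 9) * (9 * (C : ℝ) ^ 2)) + 100 * (3 * a ^ 2 + 9) + 5 * a + C + 1
  obtain ⟨n₁, hn₁⟩ := exists_log_growth hα (by positivity : 0 ≤ G)
  set n₀ := max n₁ (10 ^ 15)
  set B := Real.exp 1 + 1 + 200 * (J : ℝ) ^ 2 * (15 + 80 / β ^ 2)
  have hB1 : 1 ≤ B := by
    have := Real.exp_pos 1
    have : 0 ≤ 200 * (J : ℝ) ^ 2 * (15 + 80 / β ^ 2) := by positivity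
    linarith
  refine ⟨B * Real.exp (c' * n₀), by positivity, ?_⟩
  intro Ω _ μ _ Pts hP n k hn hnk hkn
  have hn' : (1 : ℝ) ≤ n := by exact_mod_cast hn
  have hskn : √(k : ℝ) ≤ n := by
    rw [Real.sqrt_le_left (by positivity)]
    nlinarith
  have hsk0 := Real.sqrt_nonneg (k : ℝ)
  -- For `n < n₀` the claimed bound is at least one, because `√k ≤ n ≤ n₀`.
  rcases lt_or_ge n n₀ with hlt | hge
  · refine prob_le_one.trans ?_
    rw [← ENNReal.ofReal_one]
    refine ENNReal.ofReal_le_ofReal ?_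
    rw [mul_assoc, ← Real.exp_add]
    have h1 : (n : ℝ) ≤ n₀ := by exact_mod_cast hlt.le
    have h2 := mul_le_mul_of_nonneg_left (hskn.trans h1) hc'0.le
    have h3 := Real.one_le_exp (by linarith : 0 ≤ c' * n₀ + -c' * √(k : ℝ))
    exact one_le_mul_of_one_le_of_one_le hB1 h3
  · have hk1 : 1 ≤ k := by
      have : (1 : ℝ) ≤ k := (Real.one_le_rpow hn' hα.le).trans hnk
      exact_mod_cast this
    have hg := hn₁ n ((le_max_left _ _).trans hge)
    have hgn : (n : ℝ) ^ (α / 2) ≤ n := by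
      calc (n : ℝ) ^ (α / 2) ≤ (n : ℝ) ^ (1 : ℝ) := Real.rpow_le_rpow_of_exponent_le hn' (by linarith)
        _ = n := Real.rpow_one _
    have hgk : (n : ℝ) ^ (α / 2) ≤ √(k : ℝ) := by
      refine Real.le_sqrt_of_sq_le (le_trans (le_of_eq ?_) hnk)
      rw [← Real.rpow_natCast, ← Real.rpow_mul (by positivity)]
      congr 1; push_cast; ring
    have hbig : (10 : ℝ) ^ 15 ≤ n := by exact_mod_cast (le_max_right n₁ (10 ^ 15)).trans hge
    refine (measure_hasBadSet_le ha hC hJ hJ' hκ0 hκ1 hκC hκK hc₁ hcross hP rfl hbig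
      (hg.trans hgn) (hg.trans hgk) hk1 hkn).trans (ENNReal.ofReal_le_ofReal ?_)
    set X := Real.exp (-c' * √(k : ℝ)) with hX
    have e1 : Real.exp (1 - κ * √(k : ℝ)) ≤ Real.exp 1 * X := by
      rw [hX, ← Real.exp_add]
      have := mul_le_mul_of_nonneg_right hc'1 hsk0
      exact Real.exp_le_exp.2 (by linarith)
    have e2 : Real.exp (-(1 / 10 ^ 7 * (n : ℝ) ^ 2)) ≤ X := by
      refine Real.exp_le_exp.2 ?_
      have h1 := mul_le_mul hc'2 hskn hsk0 (by norm_num)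
      nlinarith
    have e3 : (2 * n + 3 : ℝ) ^ 2 * Real.exp (-(β * n)) ≤ (15 + 80 / β ^ 2) * X := by
      refine (sq_mul_exp_le hβ0 n).trans (mul_le_mul_of_nonneg_left (Real.exp_le_exp.2 ?_)
        (by positivity))
      have h1 := mul_le_mul hc'3 hskn hsk0 (by positivity)
      linarith
    have e4 := mul_le_mul_of_nonneg_left e3 (by positivity : 0 ≤ 200 * (J : ℝ) ^ 2)
    have hX0 : 0 < X := Real.exp_pos _
    have e5 : B * X ≤ B * Real.exp (c' * n₀) * X := by
      refine mul_le_mul_of_nonneg_right ?_ hX0.le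
      exact le_mul_of_one_le_right (by linarith) (Real.one_le_exp (by positivity))
    refine le_trans (le_of_le_of_eq (add_le_add (add_le_add e1 e2) e4) ?_) e5
    ring
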